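/- **Setting.** All logarithms are to base 2. A quantum circuit on $n$ qubits is a sequence of gates $R_x(\theta)=\cos\frac\theta2 I-i\sin\frac\theta2X$, $R_z(\theta)=\cos\frac\theta2 I-i\sin\frac\theta2Z$ with $\theta=\pm2\pi/2^t$, $t\ge1$ an integer, and $CZ$; it is applied to $|0^n\rangle$ and all qubits are then measured in the $Z$ basis, so that its output distribution is $p(x)=|\langle x|C|0^n\rangle|^2$ on $\{0,1\}^n$. Circuits, states and operations on $n$ qubits are understood as families indexed by $n\ge1$; families of circuits have polynomial size, and $1^n\mapsto C_n$ is computable in polynomial time. "Computable (samplable) in polynomial time" in the following two definitions allows an error (an $l_1$ error) $2^{-m}$, for any $m$, in time polynomial in $n$ and $m$, except for bit strings, which are computed exactly. - A state $|\varphi\rangle$ on $n$ qubits is *CT* (computationally tractable) if the distribution $x\mapsto|\langle x|\varphi\rangle|^2$ is classically samplable in polynomial time and, given $x$, the amplitude $\langle x|\varphi\rangle$ is classically computable in polynomial time. - A unitary Hermitian operation on $n$ qubits is *ECS* (efficiently computable sparse) if, for some polynomial $s$, every column of its matrix has at most $s(n)$ non-zero entries and, given a column index $x$ and $k\le s(n)$,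 the $k$-th non-zero entry of that column from the top and its row index ($0$ and $0^n$ if there is no such entry) are classically computable in polynomial time. - A circuit $C$ is *CT-ECS* if it consists of two blocks, $C=VU$, with $U$ and $V$ polynomial-size circuits such that $U|0^n\rangle$ is CT and $V^\dagger Z_jV$ is ECS for all $1\le j\le n$, uniformly in $j$. **Theorem.** Let $C$ be a CT-ECS circuit on $n$ qubits whose output distribution $p$ is anti-concentrated: $\sum_{x\in\{0,1\}^n}p(x)^2\le\alpha/2^n$ for a known constant $\alpha\ge1$. Let $0<\delta<1$ be a constant. Suppose that the depolarizing channel $D_\varepsilon(\rho)=(1-\varepsilon)\rho+\varepsilon I/2$ with (possibly unknown) constant rate $0<\varepsilon<1$ is applied to each qubit after $C$, and let $\widetilde p_{\mathrm A}$ be the distribution of the outcome of then measuring all qubits. Let $\lambda$ be a known constant with $$1\le\frac{\varepsilon}{\lambda}\le1+\frac{1}{\frac{10\sqrt\alpha}{\delta}\log\frac{10\sqrt\alpha}{\delta}}.$$ Then there is a polynomial-time randomized algorithm, which depends on $\alpha,\delta,\lambda$ and the family $C$ but not on $\varepsilon$, that on input $1^n$ outputs a classical description of a probability distribution $\widetilde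 q_{\mathrm A}$ on $\{0,1\}^n$ such that $$\Pr\left[\|\widetilde p_{\mathrm A}-\widetilde q_{\mathrm A}\|_1\le\delta\right]\ge1-e^{-n}$$ for all $n\ge 1$, and $\widetilde q_{\mathrm A}$ is classically samplable in polynomial time from $n$ and its description (exactly, with fair coin tosses). -/

import Mathlib

noncomputable section

namespace CTECS

/-! ### Classical computation with a step count

Programs of a small first-order language act on binary trees (S-expressions). Every evaluation step
is charged at least the size of the data it touches, so this model and multi-tape Turing machines
simulate each other with polynomial overhead. -/

/-- Binary trees: the data on which programs act. -/
inductive Data : Type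
  | nil : Data
  | cons : Data → Data → Data

namespace Data

/-- Number of nodes of a tree. -/
def size : Data → ℕ
  | nil => 1
  | cons a b => a.size + b.size + 1

/-- Left component (`nil` on `nil`). -/
def head : Data → Data
  | nil => nil
  | cons a _ => a

/-- Right component (`nil` on `nil`). -/
def tail : Data → Data
  | nil => nil
  | cons _ b => b

end Data

/-- Programs. -/
inductive Prog : Type
  | nil : Prog
  | id : Prog
  | head : Prog
  | tail : Prog
  | pair : Prog → Prog → Prog
  | comp : Prog → Prog → Prog
  | cond : Prog → Prog → Prog → Prog
  | loop : Prog → Prog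

/-- `Eval c x y t`: on input `x`, the program `c` halts with output `y` after `t` time units.
`loop f` applies `f` to the current value; if the head of the result is `nil` it stops with the tail
of the result as output, otherwise it goes on with that tail as the current value. -/
inductive Eval : Prog → Data → Data → ℕ → Prop
  | nil (x : Data) : Eval .nil x .nil (x.size + 1)
  | id (x : Data) : Eval .id x x (x.size + 1)
  | head (x : Data) : Eval .head x x.head (x.size + 1)
  | tail (x : Data) : Eval .tail x x.tail (x.size + 1)
  | pair {f g : Prog} {x y z : Data} {t u : ℕ} :
      Eval f x y t → Eval g x z u → Eval (.pair f g) x (.cons y z) (t + u + 1)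
  | comp {f g : Prog} {x y z : Data} {t u : ℕ} :
      Eval g x y t → Eval f y z u → Eval (.comp f g) x z (t + u + 1)
  | cond_nil {f g h : Prog} {x y : Data} {t u : ℕ} :
      Eval f x .nil t → Eval g x y u → Eval (.cond f g h) x y (t + u + 1)
  | cond_cons {f g h : Prog} {x a b y : Data} {t u : ℕ} :
      Eval f x (.cons a b) t → Eval h x y u → Eval (.cond f g h) x y (t + u + 1)
  | loop_stop {f : Prog} {x y : Data} {t : ℕ} :
      Eval f x y t → y.head = .nil → Eval (.loop f) x y.tail (t + 1)
  | loop_step {f : Prog} {x y z : Data} {t u : ℕ} :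
      Eval f x y t → y.head ≠ .nil → Eval (.loop f) y.tail z u → Eval (.loop f) x z (t + u + 1)

/-- One program maps `inp i` to `out i` for every `i`, in time polynomial in the size of `inp i`. -/
def PolyTimeComputable {ι : Type} (inp out : ι → Data) : Prop :=
  ∃ (c : Prog) (P : Polynomial ℕ), ∀ i : ι, ∃ t : ℕ,
    t ≤ P.eval (inp i).size ∧ Eval c (inp i) (out i) t

/-! ### Bit strings and encodings -/

/-- Bit strings of length `n`. -/
abbrev Bits (n : ℕ) : Type := Fin n → Bool

/-- The all-zero string. -/
def zeros (n : ℕ) : Bits n := fun _ => false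

/-- The string of length `n` that is the binary expansion of `i`, most significant bit first. -/
def binaryString (n i : ℕ) : Bits n := fun j => i.testBit (n - 1 - j)

/-- All strings of length `n` in lexicographic order (the order of the rows of a matrix). -/
def allBits (n : ℕ) : List (Bits n) := (List.range (2 ^ n)).map (binaryString n)

/-- Unary encoding of a natural number. -/
def unary : ℕ → Data
  | 0 => .nil
  | n + 1 => .cons .nil (unary n)

/-- Encoding of a bit. -/
def encBool : Bool → Data
  | false => .nil
  | true => .cons .nil .nil

/-- Encoding of a list of data. -/
def encList : List Data → Data
  | [] => .nil
  | a :: l => .cons a (encList l)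

/-- Encoding of a bit string. -/
def encBits {n : ℕ} (x : Bits n) : Data := encList ((List.ofFn x).map encBool)

/-- Binary encoding of a natural number, least significant bit first. -/
def encNat (k : ℕ) : Data := encList (k.bits.map encBool)

/-- Binary encoding of an integer: sign and absolute value. -/
def encInt (z : ℤ) : Data := .cons (encBool (decide (z < 0))) (encNat z.natAbs)

/-! ### Polynomial-time approximation and sampling -/

/-- The numbers `z i` are computable in polynomial time: on input `inp i` and `m` in unary, one
polynomial-time program outputs the numerators of a dyadic approximation of `z i` with
error at most `2⁻ᵐ`. -/
def PolyTimeApproximable {ι : Type} (inp : ι → Data) (z : ι → ℂ) : Prop :=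
  ∃ a b : ι → ℕ → ℤ,
    PolyTimeComputable (fun p : ι × ℕ => .cons (inp p.1) (unary p.2))
      (fun p => .cons (encInt (a p.1 p.2)) (encInt (b p.1 p.2))) ∧
    ∀ (i : ι) (m : ℕ),
      ‖((a i m : ℂ) + (b i m : ℂ) * Complex.I) / 2 ^ m - z i‖ ≤ (1 / 2 : ℝ) ^ m

/-- The uniform distribution on strings of `ℓ` fair coin tosses. -/
def coins (ℓ : ℕ) : PMF (Bits ℓ) := PMF.uniformOfFintype (Bits ℓ)

/-- The distributions `q i` are samplable in polynomial time: from `inp i` and polynomially many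
fair coin tosses, one polynomial-time program outputs a string whose law is `q i`. -/
def PolyTimeSamplable {ι : Type} {dim : ι → ℕ} (inp : ι → Data)
    (q : (i : ι) → PMF (Bits (dim i))) : Prop :=
  ∃ (L : Polynomial ℕ) (S : (i : ι) → Bits (L.eval (inp i).size) → Bits (dim i)),
    PolyTimeComputable
      (fun p : (i : ι) × Bits (L.eval (inp i).size) => .cons (inp p.1) (encBits p.2))
      (fun p => encBits (S p.1 p.2)) ∧
    ∀ i : ι, q i = (coins (L.eval (inp i).size)).map (S i)

/-- The `l₁` distance between a real function and a probability distribution. -/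
def l1Dist {n : ℕ} (p : Bits n → ℝ) (q : PMF (Bits n)) : ℝ := ∑ x, |p x - (q x).toReal|

/-! ### Quantum circuits -/

/-- Operators on `n` qubits, in the computational basis. -/
abbrev Op (n : ℕ) : Type := Matrix (Bits n) (Bits n) ℂ

/-- Pauli `X`. -/
def pauliX : Matrix Bool Bool ℂ := Matrix.of fun a b => if a = b then 0 else 1

/-- Pauli `Z`. -/
def pauliZ : Matrix Bool Bool ℂ :=
  Matrix.of fun a b => if a = b then (if a then -1 else 1) else 0

/-- `R_x(θ) = cos (θ/2) I - i sin (θ/2) X`. -/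
def rotX (θ : ℝ) : Matrix Bool Bool ℂ :=
  (Real.cos (θ / 2) : ℂ) • (1 : Matrix Bool Bool ℂ)
    - (Complex.I * (Real.sin (θ / 2) : ℂ)) • pauliX

/-- `R_z(θ) = cos (θ/2) I - i sin (θ/2) Z`. -/
def rotZ (θ : ℝ) : Matrix Bool Bool ℂ :=
  (Real.cos (θ / 2) : ℂ) • (1 : Matrix Bool Bool ℂ)
    - (Complex.I * (Real.sin (θ / 2) : ℂ)) • pauliZ

/-- The one-qubit operator `M` acting on the `j`-th of `n` qubits. -/
def onQubit {n : ℕ} (j : Fin n) (M : Matrix Bool Bool ℂ) : Op n :=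
  Matrix.of fun x y => if ∀ k, k ≠ j → x k = y k then M (x j) (y j) else 0

/-- The controlled-`Z` operation on qubits `i` and `j`. -/
def controlledZ {n : ℕ} (i j : Fin n) : Op n :=
  Matrix.diagonal fun x => if x i = true ∧ x j = true then -1 else 1

/-- The angle `2π/2^(t+1)`, or its negative if `neg` is true. -/
def gateAngle (neg : Bool) (t : ℕ) : ℝ :=
  (if neg then -1 else 1) * (2 * Real.pi / 2 ^ (t + 1))

/-- Elementary gates on `n` qubits: `R_x(θ)` and `R_z(θ)` with `θ = ±2π/2^t`, `t ≥ 1`, and `CZ`. -/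
inductive Gate (n : ℕ) : Type
  | rx (j : Fin n) (neg : Bool) (t : ℕ) : Gate n
  | rz (j : Fin n) (neg : Bool) (t : ℕ) : Gate n
  | cz (i j : Fin n) (hij : i ≠ j) : Gate n

/-- The matrix of a gate. -/
def Gate.matrix {n : ℕ} : Gate n → Op n
  | .rx j neg t => onQubit j (rotX (gateAngle neg t))
  | .rz j neg t => onQubit j (rotZ (gateAngle neg t))
  | .cz i j _ => controlledZ i j

/-- Classical description of a gate. -/
def Gate.encode {n : ℕ} : Gate n → Data
  | .rx j neg t => encList [unary 0, unary j, encBool neg, encNat t]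
  | .rz j neg t => encList [unary 1, unary j, encBool neg, encNat t]
  | .cz i j _ => encList [unary 2, unary i, unary j]

/-- A circuit: its elementary gates, in the order in which they are applied. -/
abbrev Circuit (n : ℕ) : Type := List (Gate n)

/-- The matrix of a circuit. -/
def Circuit.matrix {n : ℕ} : Circuit n → Op n
  | [] => 1
  | g :: C => Circuit.matrix C * g.matrix

/-- The state `C|0ⁿ⟩`. -/
def Circuit.state {n : ℕ} (C : Circuit n) : Bits n → ℂ := fun x => C.matrix x (zeros n)

/-- The output distribution `p(x) = |⟨x|C|0ⁿ⟩|²`. -/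
def Circuit.outputDist {n : ℕ} (C : Circuit n) (x : Bits n) : ℝ := ‖C.state x‖ ^ 2

/-- Uniform families: the map `1ⁿ ↦ C_n` is computable in polynomial time. -/
def IsUniform (C : (n : ℕ+) → Circuit n) : Prop :=
  PolyTimeComputable (fun n : ℕ+ => unary n) (fun n => encList ((C n).map Gate.encode))

/-- Polynomial-size families. -/
def IsPolySize (C : (n : ℕ+) → Circuit n) : Prop :=
  ∃ P : Polynomial ℕ, ∀ n : ℕ+, (C n).length ≤ P.eval (n : ℕ)

/-! ### Depolarizing noise -/

/-- `Tr_j(ρ) ⊗ I/2`: the state of the `j`-th qubit is replaced with the completely mixed one. -/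
def mixQubit {n : ℕ} (j : Fin n) (ρ : Op n) : Op n :=
  Matrix.of fun x y =>
    if x j = y j then
      (1 / 2 : ℂ) * ∑ b : Bool, ρ (Function.update x j b) (Function.update y j b)
    else 0

/-- The depolarizing channel `ρ ↦ (1 - ε) ρ + ε Tr_j(ρ) ⊗ I/2` on the `j`-th qubit. -/
def depolarize {n : ℕ} (ε : ℝ) (j : Fin n) (ρ : Op n) : Op n :=
  ((1 - ε : ℝ) : ℂ) • ρ + (ε : ℂ) • mixQubit j ρ

/-- The density matrix of `C|0ⁿ⟩` after depolarizing noise of rate `ε` on each qubit. -/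
def Circuit.noisyState {n : ℕ} (C : Circuit n) (ε : ℝ) : Op n :=
  (List.finRange n).foldl (fun ρ j => depolarize ε j ρ)
    (Matrix.vecMulVec C.state (star C.state))

/-- The distribution of the outcome of measuring all qubits of the noisy state. -/
def Circuit.noisyDist {n : ℕ} (C : Circuit n) (ε : ℝ) (x : Bits n) : ℝ :=
  (C.noisyState ε x x).re

/-! ### CT states, ECS operations, CT-ECS circuits -/

/-- Computationally tractable families of states: the distribution `|⟨x|φ⟩|²` is samplable and the
amplitudes `⟨x|φ⟩` are computable in polynomial time. Since irrational numbers are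
involved, both are to accuracy `2⁻ᵐ`, in time polynomial in `n` and `m`. -/
def IsCT (φ : (n : ℕ+) → Bits n → ℂ) : Prop :=
  (∃ q : (i : ℕ+ × ℕ) → PMF (Bits i.1),
    PolyTimeSamplable (fun i : ℕ+ × ℕ => .cons (unary i.1) (unary i.2)) q ∧
    ∀ i : ℕ+ × ℕ, l1Dist (fun x => ‖φ i.1 x‖ ^ 2) (q i) ≤ (1 / 2 : ℝ) ^ i.2) ∧
  PolyTimeApproximable
    (fun i : (n : ℕ+) × Bits n => .cons (unary i.1) (encBits i.2)) (fun i => φ i.1 i.2)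

/-- The rows of the non-zero entries of the column `x`, from top to bottom. -/
def nonzeroRows {n : ℕ} (A : Op n) (x : Bits n) : List (Bits n) :=
  (allBits n).filter fun y => decide (A y x ≠ 0)

/-- The row of the `k`-th (from `0`) non-zero entry of the column `x`; `0ⁿ` if there is none. -/
def entryRow {n : ℕ} (A : Op n) (k : ℕ) (x : Bits n) : Bits n :=
  (nonzeroRows A x).getD k (zeros n)

/-- The `k`-th (from `0`) non-zero entry of the column `x`; `0` if there is none. -/
def entryVal {n : ℕ} (A : Op n) (k : ℕ) (x : Bits n) : ℂ :=
  if k < (nonzeroRows A x).length then A (entryRow A k x) x else 0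

/-- Efficiently computable sparse operations `A n j` (`j < n`, uniformly in `j`): unitary Hermitian
operators with at most `s(n)` non-zero entries in every column, the `k`-th of which, and its
row index, are computable in polynomial time for `k < s(n)`. -/
def IsECS (A : (n : ℕ+) → Fin n → Op n) : Prop :=
  (∀ (n : ℕ+) (j : Fin n), A n j ∈ Matrix.unitaryGroup (Bits n) ℂ ∧ (A n j).IsHermitian) ∧
  ∃ s : Polynomial ℕ,
    (∀ (n : ℕ+) (j : Fin n) (x : Bits n), (nonzeroRows (A n j) x).length ≤ s.eval (n : ℕ)) ∧
    PolyTimeComputable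
      (fun i : (n : ℕ+) × Fin n × Fin (s.eval (n : ℕ)) × Bits n =>
        encList [unary i.1, unary i.2.1, unary i.2.2.1, encBits i.2.2.2])
      (fun i => encBits (entryRow (A i.1 i.2.1) i.2.2.1 i.2.2.2)) ∧
    PolyTimeApproximable
      (fun i : (n : ℕ+) × Fin n × Fin (s.eval (n : ℕ)) × Bits n =>
        encList [unary i.1, unary i.2.1, unary i.2.2.1, encBits i.2.2.2])
      (fun i => entryVal (A i.1 i.2.1) i.2.2.1 i.2.2.2)

/-- CT-ECS circuits: `C = VU` with polynomial-size blocks `U` (applied first) and `V`, where `U|0ⁿ⟩`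
is CT and every `V† Z_j V` is ECS. -/
def IsCTECS (C : (n : ℕ+) → Circuit n) : Prop :=
  ∃ U V : (n : ℕ+) → Circuit n,
    (∀ n, C n = U n ++ V n) ∧ IsPolySize U ∧ IsPolySize V ∧
    IsCT (fun n => (U n).state) ∧
    IsECS (fun n j => (V n).matrix.conjTranspose * onQubit j pauliZ * (V n).matrix)

end CTECS

end

open CTECS

/-!
The proof describes the noisy distribution by its Walsh (Fourier) coefficients. Write
`μ_s = ∑ₓ p(x) (-1)^(s·x)` for a set `s` of qubits. Depolarizing noise of rate `ε` on every qubit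
multiplies `μ_s` by `(1 - ε)^|s|` (`noisyDist_eq`). So only coefficients with `|s| ≤ l`
matter, where the constant `l` depends on `α`, `δ` and the guess `λ` of the rate, and for those
`(1 - ε)^|s|` may be replaced with `v^|s|`, `v` a dyadic number close to `1 - λ`
(`abs_truncated_pow_sub_le`; the error in the rate is harmless because `k λ (1 - λ)^(k-1) ≤ 1`). By
Cauchy-Schwarz and Parseval, the `l₁` error of this replacement is at most its largest factor times
`√α`, by anti-concentration (`Circuit.l1_noisyDist_sub_le`).

For `C = VU`, the coefficient `μ_s` is the expectation value of `∏_{j ∈ s} V† Z_j V` in the state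
`U|0ⁿ⟩` (`walshCoeff_outputDist`, `opProd_conj`). As the factors are sparse with computable
entries, a column of the product is a sum over polynomially many walks. For a Hermitian
matrix `B` and a state `φ`,
`⟨φ|B|φ⟩ = ∑ₓ |φ(x)|² Re ∑_y B(y,x) · 2 conj(φ(y)) φ(x) / (|φ(x)|² + |φ(y)|²)`
(`sum_normSq_mul_walkWeight`). The weight of an entry is bounded by one here, so a sample
`x` from the CT state gives a bounded estimate, which is computable by integer
arithmetic; averages over polynomially many samples are accurate for all low-weight `s` at once by
Hoeffding's inequality (`expect_not_accurate_le`). This yields the description: the list of the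
low-weight sets with integer estimates of `v^|s| μ_s`.

The function with these coefficients is close to the noisy distribution, but may be negative. Rejection
sampling against the uniform distribution realizes its normalized positive part up to the
probability that all trials fail. Its values times `2ⁿ` are at most `(n + 1)^l + 1`, so a
polynomial number of trials is enough (`sum_abs_noisyDist_sub_rejection_le`).

The two programs are not written out: `PolyTimeComputable` is shown to be closed under
composition, pairing, case distinction and iteration (`PolyTimeComputable.loop`,
`PolyTimeComputable.foldl`), with a context that holds the variables in scope, and
the arithmetic and the algorithms are then derived as closure properties.
-/

namespace CTECS

open scoped BigOperators Matrix

/-! ### Closure properties of polynomial-time computability -/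

theorem Data.size_pos (d : Data) : 1 ≤ d.size := by cases d <;> simp [Data.size]

theorem Data.size_head_le (d : Data) : d.head.size ≤ d.size := by
  cases d <;> simp [Data.head, Data.size]; omega

theorem Data.size_tail_le (d : Data) : d.tail.size ≤ d.size := by
  cases d <;> simp [Data.tail, Data.size]; omega

/-- Output is paid for: this makes composition preserve polynomial time. -/
theorem Eval.size_le {c : Prog} {x y : Data} {t : ℕ} (h : Eval c x y t) : y.size ≤ t := by
  induction h with
  | nil x => simp [Data.size]
  | id x => omega
  | head x => have := x.size_head_le; omega
  | tail x => have := x.size_tail_le; omega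
  | pair _ _ h1 h2 => simp only [Data.size]; omega
  | comp _ _ h1 h2 => omega
  | cond_nil _ _ h1 h2 => omega
  | cond_cons _ _ h1 h2 => omega
  | loop_stop _ _ h1 => exact ((Data.size_tail_le _).trans h1).trans (Nat.le_succ _)
  | loop_step _ _ _ h1 h2 => omega

theorem eval_mono_nat (P : Polynomial ℕ) {a b : ℕ} (h : a ≤ b) : P.eval a ≤ P.eval b := by
  induction P using Polynomial.induction_on' with
  | add p q hp hq => simp only [Polynomial.eval_add]; omega
  | monomial k c =>
    simp only [Polynomial.eval_monomial]
    exact Nat.mul_le_mul_left _ (Nat.pow_le_pow_left h _)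

namespace PolyTimeComputable

variable {ι : Type} {inp mid out out' : ι → Data}

theorem reindex {κ : Type} (h : PolyTimeComputable inp out) (f : κ → ι) :
    PolyTimeComputable (fun k => inp (f k)) (fun k => out (f k)) := by
  obtain ⟨c, P, h⟩ := h
  exact ⟨c, P, fun k => h (f k)⟩

theorem size_le (h : PolyTimeComputable inp out) :
    ∃ P : Polynomial ℕ, ∀ i, (out i).size ≤ P.eval (inp i).size := by
  obtain ⟨c, P, h⟩ := h
  refine ⟨P, fun i => ?_⟩
  obtain ⟨t, ht, he⟩ := h i
  exact he.size_le.trans ht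

theorem trans (hf : PolyTimeComputable inp mid) (hg : PolyTimeComputable mid out) :
    PolyTimeComputable inp out := by
  obtain ⟨c, P, hc⟩ := hf
  obtain ⟨d, Q, hd⟩ := hg
  refine ⟨.comp d c, P + Q.comp P + 1, fun i => ?_⟩
  obtain ⟨t, ht, he⟩ := hc i
  obtain ⟨u, hu, he'⟩ := hd i
  refine ⟨t + u + 1, ?_, .comp he he'⟩
  have := eval_mono_nat Q (he.size_le.trans ht)
  simp only [Polynomial.eval_add, Polynomial.eval_comp, Polynomial.eval_one]
  omega

theorem refl (inp : ι → Data) : PolyTimeComputable inp inp :=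
  ⟨.id, Polynomial.X + 1, fun i => ⟨_, by simp, .id _⟩⟩

theorem const_nil (inp : ι → Data) : PolyTimeComputable inp (fun _ => .nil) :=
  ⟨.nil, Polynomial.X + 1, fun i => ⟨_, by simp, .nil _⟩⟩

theorem head (h : PolyTimeComputable inp out) :
    PolyTimeComputable inp (fun i => (out i).head) :=
  h.trans ⟨.head, Polynomial.X + 1, fun i => ⟨_, by simp, .head _⟩⟩

theorem tail (h : PolyTimeComputable inp out) :
    PolyTimeComputable inp (fun i => (out i).tail) :=
  h.trans ⟨.tail, Polynomial.X + 1, fun i => ⟨_, by simp, .tail _⟩⟩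

theorem pair (hf : PolyTimeComputable inp out) (hg : PolyTimeComputable inp out') :
    PolyTimeComputable inp (fun i => .cons (out i) (out' i)) := by
  obtain ⟨c, P, hc⟩ := hf
  obtain ⟨d, Q, hd⟩ := hg
  refine ⟨.pair c d, P + Q + 1, fun i => ?_⟩
  obtain ⟨t, ht, he⟩ := hc i
  obtain ⟨u, hu, he'⟩ := hd i
  refine ⟨t + u + 1, ?_, .pair he he'⟩
  simp only [Polynomial.eval_add, Polynomial.eval_one]
  omega

theorem const (inp : ι → Data) (d : Data) : PolyTimeComputable inp (fun _ => d) := by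
  induction d with
  | nil => exact const_nil inp
  | cons a b ha hb => exact ha.pair hb

/-- Case distinction; each branch need only work on the inputs that reach it. -/
theorem cases {d : ι → Data} (hd : PolyTimeComputable inp d)
    (h0 : PolyTimeComputable (fun i : {i // d i = .nil} => inp i) (fun i => out i))
    (h1 : PolyTimeComputable (fun i : {i // d i ≠ .nil} => inp i) (fun i => out i)) :
    PolyTimeComputable inp out := by
  obtain ⟨c, P, hc⟩ := hd
  obtain ⟨c0, P0, hc0⟩ := h0
  obtain ⟨c1, P1, hc1⟩ := h1
  refine ⟨.cond c c0 c1, P + (P0 + P1) + 1, fun i => ?_⟩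
  obtain ⟨t, ht, he⟩ := hc i
  simp only [Polynomial.eval_add, Polynomial.eval_one]
  by_cases h : d i = .nil
  · obtain ⟨u, hu, he'⟩ := hc0 ⟨i, h⟩
    rw [h] at he
    exact ⟨t + u + 1, by dsimp only at hu; omega, .cond_nil he he'⟩
  · obtain ⟨u, hu, he'⟩ := hc1 ⟨i, h⟩
    cases hdi : d i with
    | nil => exact absurd hdi h
    | cons a b =>
      rw [hdi] at he
      exact ⟨t + u + 1, by dsimp only at hu; omega, .cond_cons he he'⟩

theorem ite {b : ι → Bool} (hb : PolyTimeComputable inp (fun i => encBool (b i)))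
    (h1 : PolyTimeComputable inp out) (h0 : PolyTimeComputable inp out') :
    PolyTimeComputable inp (fun i => if b i then out i else out' i) := by
  refine cases hb ?_ ?_
  · convert h0.reindex (fun i : {i // encBool (b i) = .nil} => i.1) using 2 with i
    obtain ⟨i, hi⟩ := i
    rcases h : b i <;> rw [h] at hi <;> simp [encBool] at hi ⊢
  · convert h1.reindex (fun i : {i // encBool (b i) ≠ .nil} => i.1) using 2 with i
    obtain ⟨i, hi⟩ := i
    rcases h : b i <;> rw [h] at hi <;> simp [encBool] at hi ⊢

/-- A loop through polynomially many states of polynomial size. -/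
theorem loop {st : ι → ℕ → Data} {K : ι → ℕ}
    (hstep : PolyTimeComputable (fun p : (i : ι) × Fin (K i + 1) => st p.1 p.2)
      (fun p => if (p.2 : ℕ) = K p.1 then .cons .nil (out p.1)
        else .cons (.cons .nil .nil) (st p.1 (p.2 + 1))))
    (hK : ∃ Q : Polynomial ℕ, ∀ i, K i ≤ Q.eval (st i 0).size)
    (hsize : ∃ Q : Polynomial ℕ, ∀ i, ∀ j ≤ K i, (st i j).size ≤ Q.eval (st i 0).size) :
    PolyTimeComputable (fun i => st i 0) out := by
  obtain ⟨c, P, hc⟩ := hstep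
  obtain ⟨Q, hQ⟩ := hK
  obtain ⟨Q', hQ'⟩ := hsize
  refine ⟨.loop c, (Q + 1) * (P.comp Q' + 1), fun i => ?_⟩
  set B := P.eval (Q'.eval (st i 0).size) with hB
  have key : ∀ d ≤ K i, ∃ t ≤ (d + 1) * (B + 1),
      Eval (.loop c) (st i (K i - d)) (out i) t := by
    intro d
    induction d with
    | zero =>
      intro _
      obtain ⟨t, ht, he⟩ := hc ⟨i, ⟨K i, by omega⟩⟩
      simp only [if_true] at he
      refine ⟨t + 1, ?_, ?_⟩
      · have := eval_mono_nat P (hQ' i (K i) le_rfl)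
        dsimp only at ht
        omega
      · exact Eval.loop_stop (y := .cons .nil (out i)) he rfl
    | succ d ih =>
      intro hd
      obtain ⟨u, hu, he'⟩ := ih (by omega)
      obtain ⟨t, ht, he⟩ := hc ⟨i, ⟨K i - (d + 1), by omega⟩⟩
      have hne : ¬ (K i - (d + 1) = K i) := by omega
      simp only [hne, if_false] at he
      have hst : K i - (d + 1) + 1 = K i - d := by omega
      rw [hst] at he
      refine ⟨t + u + 1, ?_, ?_⟩
      · have := eval_mono_nat P (hQ' i (K i - (d + 1)) (by omega))
        dsimp only at ht
        have h2 : (d + 1 + 1) * (B + 1) = (d + 1) * (B + 1) + (B + 1) := by ring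
        omega
      · exact Eval.loop_step (y := .cons (.cons .nil .nil) (st i (K i - d))) he
          (by simp [Data.head]) he'
  obtain ⟨t, ht, he⟩ := key (K i) le_rfl
  refine ⟨t, ht.trans ?_, by simpa using he⟩
  simp only [Polynomial.eval_add, Polynomial.eval_mul, Polynomial.eval_comp, Polynomial.eval_one]
  exact Nat.mul_le_mul_right _ (by have := hQ i; omega)

/-- Forget the innermost variable of a context. -/
theorem weak {κ : ι → Type} {e : ((i : ι) × κ i) → Data} (h : PolyTimeComputable inp out) :
    PolyTimeComputable (fun p : (i : ι) × κ i => .cons (inp p.1) (e p))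
      (fun p => out p.1) :=
  ((refl _).head).trans (h.reindex Sigma.fst)

/-- The innermost variable of a context. -/
theorem var (inp : ι → Data) {κ : ι → Type} (e : ((i : ι) × κ i) → Data) :
    PolyTimeComputable (fun p : (i : ι) × κ i => .cons (inp p.1) (e p)) e :=
  (refl _).tail

end PolyTimeComputable

theorem encList_length_le (l : List Data) : l.length ≤ (encList l).size := by
  induction l with
  | nil => simp
  | cons a l ih => simp [encList, Data.size]; omega

theorem encList_drop_size_le (l : List Data) (j : ℕ) :
    (encList (l.drop j)).size ≤ (encList l).size := by
  induction l generalizing j with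
  | nil => simp
  | cons a l ih =>
    cases j with
    | zero => simp
    | succ j => have := ih j; simp [encList, Data.size]; omega

theorem encList_tail (l : List Data) : (encList l).tail = encList l.tail := by
  cases l <;> rfl

theorem size_le_of_mem {l : List Data} {a : Data} (h : a ∈ l) : a.size ≤ (encList l).size := by
  induction l with
  | nil => simp at h
  | cons b l ih =>
    simp only [encList, Data.size]
    rcases List.mem_cons.1 h with rfl | h
    · omega
    · have := ih h; omega

namespace PolyTimeComputable

variable {ι : Type} {inp mid out out' : ι → Data}

/-- Iteration over a list, when the intermediate states have polynomial size. -/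
theorem foldl {κ σ : ι → Type} {ek : (i : ι) → κ i → Data} {es : (i : ι) → σ i → Data}
    {l : (i : ι) → List (κ i)} {init : (i : ι) → σ i} {step : (i : ι) → σ i → κ i → σ i}
    (hl : PolyTimeComputable inp (fun i => encList ((l i).map (ek i))))
    (hinit : PolyTimeComputable inp (fun i => es i (init i)))
    (hstep : PolyTimeComputable
      (fun p : (i : ι) × σ i × κ i => .cons (inp p.1) (.cons (es p.1 p.2.1) (ek p.1 p.2.2)))
      (fun p => es p.1 (step p.1 p.2.1 p.2.2)))
    (hsize : ∃ Q : Polynomial ℕ, ∀ i, ∀ j ≤ (l i).length,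
      (es i (((l i).take j).foldl (step i) (init i))).size ≤ Q.eval (inp i).size) :
    PolyTimeComputable inp (fun i => es i ((l i).foldl (step i) (init i))) := by
  let st : ι → ℕ → Data := fun i j => .cons (inp i)
    (.cons (encList (((l i).drop j).map (ek i))) (es i (((l i).take j).foldl (step i) (init i))))
  have h0 : PolyTimeComputable inp (fun i => st i 0) := by
    simpa [st] using (refl inp).pair (hl.pair hinit)
  have hle : ∀ i, (inp i).size ≤ (st i 0).size := fun i => by simp [st, Data.size]; omega
  refine h0.trans (loop (K := fun i => (l i).length) ?_ ?_ ?_)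
  · let ctx : ((i : ι) × Fin ((l i).length + 1)) → Data := fun p => st p.1 p.2
    have hR : PolyTimeComputable ctx
        (fun p => encList (((l p.1).drop p.2).map (ek p.1))) := (refl ctx).tail.head
    refine cases hR ?_ ?_
    · have h := (const_nil ctx).pair (refl ctx).tail.tail
      convert h.reindex (fun p : {p : (i : ι) × Fin ((l i).length + 1) //
        encList (((l p.1).drop p.2).map (ek p.1)) = .nil} => p.1) using 2 with p
      obtain ⟨⟨i, j⟩, hp⟩ := p
      have hj : (j : ℕ) = (l i).length := by
        by_contra hne
        have hlt : (j : ℕ) < (l i).length := by omega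
        rw [List.drop_eq_getElem_cons hlt] at hp
        simp only [List.map_cons, encList] at hp
        exact Data.noConfusion hp
      simp [ctx, st, hj, Data.tail]
    · let sub := {p : (i : ι) × Fin ((l i).length + 1) //
        encList (((l p.1).drop p.2).map (ek p.1)) ≠ .nil}
      have hlt : ∀ p : sub, (p.1.2 : ℕ) < (l p.1.1).length := by
        rintro ⟨⟨i, j⟩, hp⟩
        by_contra hne
        exact hp (by simp [List.drop_eq_nil_of_le (not_lt.1 hne), encList])
      let ctx' : sub → Data := fun p => ctx p.1
      have hI : PolyTimeComputable ctx' (fun p => inp p.1.1) := (refl ctx').head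
      have hS : PolyTimeComputable ctx' (fun p => es p.1.1
        (((l p.1.1).take p.1.2).foldl (step p.1.1) (init p.1.1))) := (refl ctx').tail.tail
      have hdrop : ∀ p : sub, encList (((l p.1.1).drop p.1.2).map (ek p.1.1)) =
          .cons (ek p.1.1 ((l p.1.1)[(p.1.2 : ℕ)]'(hlt p)))
            (encList (((l p.1.1).drop (p.1.2 + 1)).map (ek p.1.1))) := by
        intro p
        rw [List.drop_eq_getElem_cons (hlt p)]
        rfl
      have hK : PolyTimeComputable ctx'
          (fun p => ek p.1.1 ((l p.1.1)[(p.1.2 : ℕ)]'(hlt p))) := by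
        have h : PolyTimeComputable ctx' (fun p =>
          (encList (((l p.1.1).drop p.1.2).map (ek p.1.1))).head) := (refl ctx').tail.head.head
        simpa only [hdrop, Data.head] using h
      have hT : PolyTimeComputable ctx'
          (fun p => encList (((l p.1.1).drop (p.1.2 + 1)).map (ek p.1.1))) := by
        have h : PolyTimeComputable ctx' (fun p =>
          (encList (((l p.1.1).drop p.1.2).map (ek p.1.1))).tail) := (refl ctx').tail.head.tail
        simpa only [hdrop, Data.tail] using h
      have hN := (hI.pair (hS.pair hK)).trans
        (hstep.reindex (fun p : sub => ⟨p.1.1, _, (l p.1.1)[(p.1.2 : ℕ)]'(hlt p)⟩))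
      have h := (const ctx' (.cons .nil .nil)).pair (hI.pair (hT.pair hN))
      convert h using 2 with p
      have hp := hlt p
      rw [if_neg (by omega)]
      simp only [st]
      rw [List.take_succ_eq_append_getElem hp, List.foldl_append]
      rfl
  · refine ⟨Polynomial.X, fun i => ?_⟩
    have := encList_length_le ((l i).map (ek i))
    simp [st, Data.size] at this ⊢
    omega
  · obtain ⟨Q, hQ⟩ := hsize
    refine ⟨Polynomial.X + Q, fun i j hj => ?_⟩
    have h1 := encList_drop_size_le ((l i).map (ek i)) j
    have h2 := hQ i j hj
    have h3 := eval_mono_nat Q (hle i)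
    simp only [Polynomial.eval_add, Polynomial.eval_X] at *
    simp only [st, Data.size, List.drop_zero, List.map_drop] at *
    omega

end PolyTimeComputable

/-! ### Lists, unary numbers and bit strings as data -/

theorem encList_size_le {l : List Data} {B : ℕ} (h : ∀ a ∈ l, a.size ≤ B) :
    (encList l).size ≤ l.length * (B + 1) + 1 := by
  induction l with
  | nil => simp [encList, Data.size]
  | cons a l ih =>
    have h1 := h a (by simp)
    have h2 := ih fun b hb => h b (by simp [hb])
    simp only [encList, Data.size, List.length_cons, add_mul]
    omega

theorem encList_append_size (a b : List Data) :
    (encList (a ++ b)).size + 1 = (encList a).size + (encList b).size := by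
  induction a with
  | nil => simp [encList, Data.size]; omega
  | cons x a ih => simp only [List.cons_append, encList, Data.size]; omega

theorem encList_reverse_size (a : List Data) : (encList a.reverse).size = (encList a).size := by
  induction a with
  | nil => rfl
  | cons x a ih =>
    have := encList_append_size a.reverse [x]
    simp only [List.reverse_cons, encList, Data.size] at this ⊢
    omega

theorem encList_take_size_le (l : List Data) (j : ℕ) :
    (encList (l.take j)).size ≤ (encList l).size := by
  have := encList_append_size (l.take j) (l.drop j)
  have h2 := (encList (l.drop j)).size_pos
  rw [List.take_append_drop] at this
  omega

theorem unary_eq_encList (n : ℕ) : unary n = encList (List.replicate n .nil) := by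
  induction n with
  | zero => rfl
  | succ n ih => simp [unary, List.replicate_succ, encList, ih]

theorem unary_size (n : ℕ) : (unary n).size = 2 * n + 1 := by
  induction n with
  | zero => rfl
  | succ n ih => simp [unary, Data.size, ih]; omega

theorem foldl_cons_eq {α : Type*} (l s : List α) :
    l.foldl (fun s k => k :: s) s = l.reverse ++ s := by
  induction l generalizing s with
  | nil => rfl
  | cons a l ih => simp [ih]

namespace PolyTimeComputable

variable {ι : Type} {inp mid out out' : ι → Data}

theorem map_reverse {κ : ι → Type} {ek out : (i : ι) → κ i → Data} {l : (i : ι) → List (κ i)}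
    (hl : PolyTimeComputable inp (fun i => encList ((l i).map (ek i))))
    (hf : PolyTimeComputable (fun p : (i : ι) × κ i => .cons (inp p.1) (ek p.1 p.2))
      (fun p => out p.1 p.2)) :
    PolyTimeComputable inp (fun i => encList ((l i).reverse.map (out i))) := by
  have h := foldl (σ := fun i => List (κ i)) (es := fun i s => encList (s.map (out i)))
    (init := fun _ => []) (step := fun _ s k => k :: s) hl (const_nil inp) ?_ ?_
  · simpa [foldl_cons_eq] using h
  · have h1 := (refl (fun p : (i : ι) × List (κ i) × κ i =>
      .cons (inp p.1) (.cons (encList (p.2.1.map (out p.1))) (ek p.1 p.2.2))))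
    exact ((h1.head.pair h1.tail.tail).trans
      (hf.reindex (fun p : (i : ι) × List (κ i) × κ i => ⟨p.1, p.2.2⟩))).pair h1.tail.head
  · obtain ⟨P, hP⟩ := hf.size_le
    obtain ⟨Q, hQ⟩ := hl.size_le
    refine ⟨Q * (P.comp (Polynomial.X + Q + 1) + 1) + 1, fun i j hj => ?_⟩
    have hB : ∀ a ∈ (((l i).take j).foldl (fun s k => k :: s) []).map (out i),
        a.size ≤ (P.comp (Polynomial.X + Q + 1)).eval (inp i).size := by
      intro a ha
      simp only [foldl_cons_eq, List.append_nil, List.mem_map, List.mem_reverse] at ha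
      obtain ⟨k, hk, rfl⟩ := ha
      refine (hP ⟨i, k⟩).trans ?_
      have h3 := size_le_of_mem (List.mem_map_of_mem (f := ek i) (List.mem_of_mem_take hk))
      have h4 := hQ i
      simp only [Polynomial.eval_comp, Polynomial.eval_add, Polynomial.eval_X,
        Polynomial.eval_one, Data.size]
      exact eval_mono_nat _ (by omega)
    refine (encList_size_le hB).trans ?_
    have h5 := encList_length_le ((l i).map (ek i))
    have h6 := hQ i
    simp only [foldl_cons_eq, List.append_nil, List.length_map, List.length_reverse,
      List.length_take] at h5 ⊢
    simp only [Polynomial.eval_add, Polynomial.eval_mul, Polynomial.eval_one]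
    gcongr
    omega

theorem reverse {a : ι → List Data} (h : PolyTimeComputable inp (fun i => encList (a i))) :
    PolyTimeComputable inp (fun i => encList (a i).reverse) := by
  simpa using map_reverse (κ := fun _ => Data) (ek := fun _ d => d) (out := fun _ d => d)
    (l := a) (by simpa using h) (var inp (κ := fun _ => Data) fun p => p.2)

theorem map {κ : ι → Type} {ek out : (i : ι) → κ i → Data} {l : (i : ι) → List (κ i)}
    (hl : PolyTimeComputable inp (fun i => encList ((l i).map (ek i))))
    (hf : PolyTimeComputable (fun p : (i : ι) × κ i => .cons (inp p.1) (ek p.1 p.2))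
      (fun p => out p.1 p.2)) :
    PolyTimeComputable inp (fun i => encList ((l i).map (out i))) := by
  simpa using (map_reverse hl hf).reverse

theorem append {a b : ι → List Data} (ha : PolyTimeComputable inp (fun i => encList (a i)))
    (hb : PolyTimeComputable inp (fun i => encList (b i))) :
    PolyTimeComputable inp (fun i => encList (a i ++ b i)) := by
  have h := foldl (κ := fun _ => Data) (ek := fun _ d => d) (σ := fun _ => List Data)
    (es := fun _ s => encList s) (l := fun i => (a i).reverse) (init := b)
    (step := fun _ s k => k :: s) (by simpa using ha.reverse) hb ?_ ?_
  · simpa [foldl_cons_eq] using h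
  · have h1 := (refl (fun p : (_ : ι) × List Data × Data =>
      .cons (inp p.1) (.cons (encList p.2.1) p.2.2)))
    exact h1.tail.tail.pair h1.tail.head
  · obtain ⟨P, hP⟩ := ha.size_le
    obtain ⟨Q, hQ⟩ := hb.size_le
    refine ⟨P + Q, fun i j hj => ?_⟩
    have h1 := encList_take_size_le (a i).reverse j
    have h2 := encList_append_size ((a i).reverse.take j).reverse (b i)
    have h3 := hP i
    have h4 := hQ i
    rw [encList_reverse_size] at h1 h2
    simp only [foldl_cons_eq, Polynomial.eval_add]
    omega

theorem encList_map_take_flatten_size (L : List (List Data)) (j : ℕ) :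
    (encList (L.take j).flatten).size ≤ (encList (L.map encList)).size := by
  induction L generalizing j with
  | nil => simp [encList]
  | cons a L ih =>
    cases j with
    | zero => simp [encList, Data.size]
    | succ j =>
      have := ih j
      have h2 := encList_append_size a (L.take j).flatten
      simp only [List.take_succ_cons, List.flatten_cons, List.map_cons, encList, Data.size]
      omega

theorem flatten {L : ι → List (List Data)}
    (h : PolyTimeComputable inp (fun i => encList ((L i).map encList))) :
    PolyTimeComputable inp (fun i => encList (L i).flatten) := by
  have hf : ∀ (L : List (List Data)) (s : List Data),
      L.foldl (fun s a => s ++ a) s = s ++ L.flatten := by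
    intro L
    induction L with
    | nil => simp
    | cons a L ih => intro s; simp [ih]
  have h := foldl (κ := fun _ => List Data) (ek := fun _ => encList) (σ := fun _ => List Data)
    (es := fun _ s => encList s) (l := L) (init := fun _ => [])
    (step := fun _ s a => s ++ a) h (const_nil inp) ?_ ?_
  · simpa [hf] using h
  · have h1 := (refl (fun p : (_ : ι) × List Data × List Data =>
      .cons (inp p.1) (.cons (encList p.2.1) (encList p.2.2))))
    exact h1.tail.head.append h1.tail.tail
  · obtain ⟨P, hP⟩ := h.size_le
    refine ⟨P, fun i j hj => ?_⟩
    rw [hf, List.nil_append]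
    exact (encList_map_take_flatten_size _ _).trans (hP i)

theorem flatMap {κ : ι → Type} {ek : (i : ι) → κ i → Data} {f : (i : ι) → κ i → List Data}
    {l : (i : ι) → List (κ i)}
    (hl : PolyTimeComputable inp (fun i => encList ((l i).map (ek i))))
    (hf : PolyTimeComputable (fun p : (i : ι) × κ i => .cons (inp p.1) (ek p.1 p.2))
      (fun p => encList (f p.1 p.2))) :
    PolyTimeComputable inp (fun i => encList ((l i).flatMap (f i))) := by
  have h := flatten (L := fun i => (l i).map (f i)) (by simpa using map hl hf)
  simpa [List.flatMap] using h

theorem unary_add {m n : ι → ℕ} (hm : PolyTimeComputable inp (fun i => unary (m i)))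
    (hn : PolyTimeComputable inp (fun i => unary (n i))) :
    PolyTimeComputable inp (fun i => unary (m i + n i)) := by
  simp only [unary_eq_encList] at *
  simpa using hm.append hn

theorem unary_mul {m n : ι → ℕ} (hm : PolyTimeComputable inp (fun i => unary (m i)))
    (hn : PolyTimeComputable inp (fun i => unary (n i))) :
    PolyTimeComputable inp (fun i => unary (m i * n i)) := by
  simp only [unary_eq_encList] at *
  have h := flatMap (κ := fun _ => Data) (ek := fun _ d => d)
    (f := fun i _ => List.replicate (n i) Data.nil) (by simpa using hm)
    (hn.weak (κ := fun _ => Data) (e := fun p => p.2))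
  convert h using 3 with i
  simp [List.flatMap_def]

theorem unary_eval {n : ι → ℕ} (P : Polynomial ℕ)
    (h : PolyTimeComputable inp (fun i => unary (n i))) :
    PolyTimeComputable inp (fun i => unary (P.eval (n i))) := by
  induction P using Polynomial.induction_on' with
  | add p q hp hq => simpa using hp.unary_add hq
  | monomial k c =>
    simp only [Polynomial.eval_monomial]
    refine (const inp (unary c)).unary_mul ?_
    induction k with
    | zero => exact const inp (unary 1)
    | succ k ih => simpa [pow_succ] using ih.unary_mul h

theorem unary_length {l : ι → List Data} (h : PolyTimeComputable inp (fun i => encList (l i))) :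
    PolyTimeComputable inp (fun i => unary (l i).length) := by
  have := map (κ := fun _ => Data) (ek := fun _ d => d) (out := fun _ _ => .nil) (l := l)
    (by simpa using h) (const_nil _)
  simpa [unary_eq_encList, List.map_const'] using this

/-- The list `unary 0, …, unary (n - 1)`. -/
theorem finRange {n : ι → ℕ} (h : PolyTimeComputable inp (fun i => unary (n i))) :
    PolyTimeComputable inp
      (fun i => encList ((List.finRange (n i)).map fun j : Fin (n i) => unary (j : ℕ))) := by
  let es : ℕ → Data := fun t => .cons (unary t) (encList ((List.range t).map unary).reverse)
  have hf : ∀ (l : List Data) (s : ℕ), l.foldl (fun t _ => t + 1) s = s + l.length := by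
    intro l
    induction l with
    | nil => simp
    | cons a l ih => intro s; simp [ih]; omega
  have h1 := foldl (κ := fun _ => Data) (ek := fun _ d => d) (σ := fun _ => ℕ)
    (es := fun _ => es) (l := fun i => List.replicate (n i) .nil) (init := fun _ => 0)
    (step := fun _ t _ => t + 1) (by simpa [← unary_eq_encList] using h) (const inp (es 0)) ?_ ?_
  · have h2 : PolyTimeComputable inp
        (fun i => encList ((List.range (n i)).map unary).reverse) := by
      simpa only [hf, es, Data.tail, List.length_replicate, zero_add] using h1.tail
    have h3 := h2.reverse
    convert h3 using 3 with i
    rw [List.reverse_reverse, ← List.map_coe_finRange_eq_range, List.map_map]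
    rfl
  · have h2 := (refl (fun p : (_ : ι) × ℕ × Data =>
      .cons (inp p.1) (.cons (es p.2.1) p.2.2)))
    have h3 := ((const_nil _).pair h2.tail.head.head).pair
      (h2.tail.head.head.pair h2.tail.head.tail)
    convert h3 using 2 with p
    simp [es, Data.head, Data.tail, List.range_succ, encList, unary]
  · obtain ⟨P, hP⟩ := h.size_le
    refine ⟨P + (P * (P + 1) + 1) + 1, fun i j hj => ?_⟩
    have h4 := hP i
    rw [unary_size] at h4
    simp only [List.length_replicate] at hj
    simp only [hf, List.length_take, List.length_replicate, zero_add, min_eq_left hj, es,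
      Data.size, unary_size, encList_reverse_size, Polynomial.eval_add, Polynomial.eval_one,
      Polynomial.eval_mul]
    have h5 := encList_size_le (l := (List.range j).map unary) (B := P.eval (inp i).size) (by
      intro a ha
      simp only [List.mem_map, List.mem_range] at ha
      obtain ⟨k, hk, rfl⟩ := ha
      rw [unary_size]
      omega)
    simp only [List.length_map, List.length_range] at h5
    have h6 : j * (P.eval (inp i).size + 1) ≤ P.eval (inp i).size * (P.eval (inp i).size + 1) :=
      Nat.mul_le_mul_right _ (by omega)
    omega

theorem drop {l : ι → List Data} {k : ι → ℕ}
    (hl : PolyTimeComputable inp (fun i => encList (l i)))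
    (hk : PolyTimeComputable inp (fun i => unary (k i))) :
    PolyTimeComputable inp (fun i => encList ((l i).drop (k i))) := by
  have hf : ∀ (l : List Data) (s : List Data), l.foldl (fun s _ => s.tail) s = s.drop l.length := by
    intro l
    induction l with
    | nil => simp
    | cons a l ih => intro s; simp [ih, List.drop_tail]
  have h := foldl (κ := fun _ => Data) (ek := fun _ d => d) (σ := fun _ => List Data)
    (es := fun _ => encList) (l := fun i => List.replicate (k i) .nil) (init := l)
    (step := fun _ s _ => s.tail) (by simpa [← unary_eq_encList] using hk) hl ?_ ?_
  · simpa [hf] using h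
  · have h1 : PolyTimeComputable (fun p : (_ : ι) × List Data × Data =>
      .cons (inp p.1) (.cons (encList p.2.1) p.2.2)) (fun p => (encList p.2.1).tail) :=
      (refl _).tail.head.tail
    simpa only [encList_tail] using h1
  · obtain ⟨P, hP⟩ := hl.size_le
    refine ⟨P, fun i j hj => ?_⟩
    rw [hf]
    exact (encList_drop_size_le _ _).trans (hP i)

theorem getD {l : ι → List Data} {k : ι → ℕ}
    (hl : PolyTimeComputable inp (fun i => encList (l i)))
    (hk : PolyTimeComputable inp (fun i => unary (k i))) :
    PolyTimeComputable inp (fun i => (l i).getD (k i) .nil) := by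
  convert (hl.drop hk).head using 2 with i
  rcases lt_or_ge (k i) (l i).length with h | h
  · rw [List.drop_eq_getElem_cons h]
    simp [encList, Data.head, h]
  · simp [List.drop_eq_nil_of_le h, encList, Data.head, h]

/-- Reading a bit of a string. -/
theorem getBit {n : ι → ℕ} {x : (i : ι) → Bits (n i)} {k : (i : ι) → Fin (n i)}
    (hx : PolyTimeComputable inp (fun i => encBits (x i)))
    (hk : PolyTimeComputable inp (fun i => unary (k i : ℕ))) :
    PolyTimeComputable inp (fun i => encBool (x i (k i))) := by
  convert hx.getD hk using 2 with i
  simp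

/-- A string is computable as soon as its bits are. -/
theorem bits {n : ι → ℕ} {x : (i : ι) → Bits (n i)}
    (hn : PolyTimeComputable inp (fun i => unary (n i)))
    (hx : PolyTimeComputable (fun p : (i : ι) × Fin (n i) => .cons (inp p.1) (unary (p.2 : ℕ)))
      (fun p => encBool (x p.1 p.2))) :
    PolyTimeComputable inp (fun i => encBits (x i)) := by
  convert hn.finRange.map (ek := fun i (j : Fin (n i)) => unary (j : ℕ))
    (out := fun i j => encBool (x i j)) hx using 2 with i
  simp [encBits, List.ofFn_eq_map, Function.comp_def]

theorem encBool_not {b : ι → Bool} (h : PolyTimeComputable inp (fun i => encBool (b i))) :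
    PolyTimeComputable inp (fun i => encBool (!b i)) := by
  convert h.ite (const inp (encBool false)) (const inp (encBool true)) using 2 with i
  cases b i <;> rfl

theorem encBool_and {b c : ι → Bool} (hb : PolyTimeComputable inp (fun i => encBool (b i)))
    (hc : PolyTimeComputable inp (fun i => encBool (c i))) :
    PolyTimeComputable inp (fun i => encBool (b i && c i)) := by
  convert hb.ite hc (const inp (encBool false)) using 2 with i
  cases b i <;> rfl

theorem encBool_or {b c : ι → Bool} (hb : PolyTimeComputable inp (fun i => encBool (b i)))
    (hc : PolyTimeComputable inp (fun i => encBool (c i))) :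
    PolyTimeComputable inp (fun i => encBool (b i || c i)) := by
  convert hb.ite (const inp (encBool true)) hc using 2 with i
  cases b i <;> rfl

theorem encBool_xor {b c : ι → Bool} (hb : PolyTimeComputable inp (fun i => encBool (b i)))
    (hc : PolyTimeComputable inp (fun i => encBool (c i))) :
    PolyTimeComputable inp (fun i => encBool (b i ^^ c i)) := by
  convert hb.ite hc.encBool_not hc using 2 with i
  cases b i <;> simp

end PolyTimeComputable

/-! ### Binary arithmetic -/

theorem encNat_zero : encNat 0 = .nil := by simp [encNat, encList]

theorem encNat_tail (a : ℕ) : (encNat a).tail = encNat a.div2 := by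
  simp only [encNat, encList_tail, Nat.div2_bits_eq_tail, List.map_tail]

theorem encNat_head (a : ℕ) : (encNat a).head = encBool a.bodd := by
  rw [Nat.bodd_eq_bits_head, encNat]
  cases a.bits <;> rfl

theorem encNat_bit (b : Bool) (a : ℕ) :
    encNat (Nat.bit b a) = if b || decide (a ≠ 0) then .cons (encBool b) (encNat a) else .nil := by
  rcases Nat.eq_zero_or_pos a with rfl | h
  · cases b
    · simp [encNat_zero]
    · rw [encNat, Nat.bits_append_bit _ _ (by simp)]
      simp [encList, encNat]
  · rw [encNat, Nat.bits_append_bit _ _ (by omega)]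
    simp [h.ne', encList, encNat]

theorem encNat_eq_nil {a : ℕ} : encNat a = .nil ↔ a = 0 := by
  refine ⟨fun h => ?_, fun h => by rw [h, encNat_zero]⟩
  by_contra h0
  have hb := encNat_bit a.bodd a.div2
  rw [Nat.bit_bodd_div2, h] at hb
  have : (a.bodd || decide (a.div2 ≠ 0)) = true := by
    by_contra h1
    simp only [Bool.or_eq_true, decide_eq_true_eq, not_or, Bool.not_eq_true, not_not] at h1
    have h2 := Nat.bit_bodd_div2 a
    rw [h1.1, h1.2] at h2
    simp at h2
    omega
  rw [if_pos this] at hb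
  exact Data.noConfusion hb

theorem encBool_size_le (b : Bool) : (encBool b).size ≤ 3 := by
  cases b <;> simp [encBool, Data.size]

theorem encList_bool_size_le (l : List Bool) : (encList (l.map encBool)).size ≤ 4 * l.length + 1 := by
  have := encList_size_le (l := l.map encBool) (B := 3) (by
    intro a ha
    obtain ⟨b, -, rfl⟩ := List.mem_map.1 ha
    exact encBool_size_le b)
  simp only [List.length_map] at this
  omega

theorem encNat_size_le {a k : ℕ} (h : a < 2 ^ k) : (encNat a).size ≤ 4 * k + 1 := by
  have h1 := encList_bool_size_le a.bits
  rw [Nat.size_eq_bits_len] at h1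
  have := Nat.size_le.2 h
  rw [encNat]
  omega

theorem size_le_encNat_size (a : ℕ) : a.size ≤ (encNat a).size := by
  have := encList_length_le (a.bits.map encBool)
  rwa [List.length_map, Nat.size_eq_bits_len] at this

theorem lt_two_pow_encNat_size (a : ℕ) : a < 2 ^ (encNat a).size :=
  Nat.size_le.1 (size_le_encNat_size a)

/-- The number with the given binary digits, most significant digit first. -/
def ofDigits (l : List Bool) : ℕ := l.foldl (fun a b => Nat.bit b a) 0

theorem ofDigits_concat (l : List Bool) (b : Bool) :
    ofDigits (l ++ [b]) = Nat.bit b (ofDigits l) := by simp [ofDigits]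

theorem ofDigits_cons (b : Bool) (l : List Bool) :
    ofDigits (b :: l) = b.toNat * 2 ^ l.length + ofDigits l := by
  induction l using List.reverseRecOn with
  | nil => cases b <;> simp [ofDigits]
  | append_singleton l c ih =>
    rw [← List.cons_append, ofDigits_concat, ofDigits_concat, ih, Nat.bit_val, Nat.bit_val,
      List.length_append, List.length_singleton, pow_succ]
    ring

theorem ofDigits_lt (l : List Bool) : ofDigits l < 2 ^ l.length := by
  induction l with
  | nil => simp [ofDigits]
  | cons b l ih =>
    rw [ofDigits_cons, List.length_cons, pow_succ]
    cases b <;> simp <;> omega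

theorem ofDigits_bits_reverse (a : ℕ) : ofDigits a.bits.reverse = a := by
  induction a using Nat.binaryRec' with
  | zero => simp [ofDigits]
  | bit b n h ih => rw [Nat.bits_append_bit _ _ h, List.reverse_cons, ofDigits_concat, ih]

/-- One step of addition (`neg = false`) or subtraction (`neg = true`): the rest of both operands,
the carry (borrow), and the digits of the result found so far. -/
def carryStep (neg : Bool) (s : ℕ × ℕ × Bool × List Bool) : ℕ × ℕ × Bool × List Bool :=
  (s.1.div2, s.2.1.div2,
    ((s.1.bodd ^^ neg) && s.2.1.bodd) || ((s.1.bodd ^^ neg) && s.2.2.1) ||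
      (s.2.1.bodd && s.2.2.1),
    (s.1.bodd ^^ s.2.1.bodd ^^ s.2.2.1) :: s.2.2.2)

theorem carryStep_iterate (neg : Bool) (A B k : ℕ) :
    ((carryStep neg)^[k] (A, B, false, [])).1 = A / 2 ^ k ∧
    ((carryStep neg)^[k] (A, B, false, [])).2.1 = B / 2 ^ k ∧
    ((carryStep neg)^[k] (A, B, false, [])).2.2.2.length = k := by
  induction k with
  | zero => simp
  | succ k ih =>
    rw [Function.iterate_succ_apply']
    obtain ⟨h1, h2, h3⟩ := ih
    simp only [carryStep, h1, h2, List.length_cons, h3, Nat.div2_val, Nat.div_div_eq_div_mul,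
      pow_succ, and_self]

/-- The value represented by a state of the carry loop is invariant. -/
theorem carryStep_value (neg : Bool) (A B k : ℕ) :
    let s := (carryStep neg)^[k] (A, B, false, [])
    (ofDigits s.2.2.2 : ℤ) + 2 ^ k * (s.1 + (if neg then -1 else 1) * (s.2.1 + s.2.2.1.toNat)) =
      A + (if neg then -1 else 1) * B := by
  induction k with
  | zero => simp [ofDigits]
  | succ k ih =>
    have hl := (carryStep_iterate neg A B k).2.2
    simp only [Function.iterate_succ_apply'] at ih ⊢
    generalize (carryStep neg)^[k] (A, B, false, []) = s at ih hl
    obtain ⟨a, b, c, out⟩ := s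
    dsimp only at ih hl
    simp only [carryStep, ofDigits_cons, hl]
    rw [← ih]
    have ha : (a : ℤ) = 2 * (a.div2 : ℤ) + a.bodd.toNat := by
      have := Nat.bodd_add_div2 a
      omega
    have hb : (b : ℤ) = 2 * (b.div2 : ℤ) + b.bodd.toNat := by
      have := Nat.bodd_add_div2 b
      omega
    rw [ha, hb]
    generalize a.div2 = a'
    generalize b.div2 = b'
    generalize a.bodd = x
    generalize b.bodd = y
    generalize ofDigits out = o
    clear ha hb ih hl
    rw [pow_succ]
    cases neg <;> cases x <;> cases y <;> cases c <;> norm_num <;> ring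

theorem carryStep_add {A B k : ℕ} (hk : A + B < 2 ^ k) :
    ofDigits ((carryStep false)^[k] (A, B, false, [])).2.2.2 = A + B := by
  have h := carryStep_value false A B k
  simp only [Bool.false_eq_true, if_false, one_mul] at h
  norm_cast at h
  generalize (carryStep false)^[k] (A, B, false, []) = s at h ⊢
  rcases Nat.eq_zero_or_pos (s.1 + (s.2.1 + s.2.2.1.toNat)) with h0 | h0
  · rw [h0] at h; omega
  · have := Nat.le_mul_of_pos_right (2 ^ k) h0
    omega

theorem carryStep_sub {A B k : ℕ} (hA : A < 2 ^ k) (hB : B < 2 ^ k) :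
    ((carryStep true)^[k] (A, B, false, [])).2.2.1 = decide (A < B) ∧
    (B ≤ A → ofDigits ((carryStep true)^[k] (A, B, false, [])).2.2.2 = A - B) := by
  have h := carryStep_value true A B k
  obtain ⟨h1, h2, h3⟩ := carryStep_iterate true A B k
  simp only [if_true] at h
  rw [h1, h2, Nat.div_eq_of_lt hA, Nat.div_eq_of_lt hB] at h
  generalize (carryStep true)^[k] (A, B, false, []) = s at h h3 ⊢
  have h4 := ofDigits_lt s.2.2.2
  rw [h3] at h4
  have h4' : (ofDigits s.2.2.2 : ℤ) < 2 ^ k := by exact_mod_cast h4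
  cases hc : s.2.2.1
  · rw [hc] at h
    simp at h
    have : B ≤ A := by omega
    simp only [false_eq_decide_iff, not_lt]
    omega
  · rw [hc] at h
    simp at h
    have : A < B := by omega
    simp only [true_eq_decide_iff]
    omega

theorem foldl_const_eq_iterate {α β : Type*} (f : α → α) (l : List β) (a : α) :
    l.foldl (fun s _ => f s) a = f^[l.length] a := by
  induction l generalizing a with
  | nil => rfl
  | cons b l ih => simp [ih, Function.iterate_succ_apply]

/-- Encoding of a state of the carry loop. -/
def encCarry (s : ℕ × ℕ × Bool × List Bool) : Data :=
  .cons (encNat s.1) (.cons (encNat s.2.1) (.cons (encBool s.2.2.1)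
    (encList (s.2.2.2.map encBool))))

namespace PolyTimeComputable

variable {ι : Type} {inp mid out out' : ι → Data}

theorem encBool_ne_nil (h : PolyTimeComputable inp out) [∀ i, Decidable (out i ≠ .nil)] :
    PolyTimeComputable inp (fun i => encBool (decide (out i ≠ .nil))) := by
  refine cases h ?_ ?_
  · convert const _ (encBool false) using 3 with i
    simpa using i.2
  · convert const _ (encBool true) using 3 with i
    simpa using i.2

theorem encBool_ne_zero {a : ι → ℕ} (h : PolyTimeComputable inp (fun i => encNat (a i))) :
    PolyTimeComputable inp (fun i => encBool (decide (a i ≠ 0))) := by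
  classical
  convert h.encBool_ne_nil using 3 with i
  simp [encNat_eq_nil]

theorem nat_bit {b : ι → Bool} {a : ι → ℕ} (hb : PolyTimeComputable inp (fun i => encBool (b i)))
    (ha : PolyTimeComputable inp (fun i => encNat (a i))) :
    PolyTimeComputable inp (fun i => encNat (Nat.bit (b i) (a i))) := by
  simp only [encNat_bit]
  exact (hb.encBool_or ha.encBool_ne_zero).ite (hb.pair ha) (const_nil _)

theorem nat_ofDigits {l : ι → List Bool}
    (h : PolyTimeComputable inp (fun i => encList ((l i).map encBool))) :
    PolyTimeComputable inp (fun i => encNat (ofDigits (l i))) := by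
  refine foldl (κ := fun _ => Bool) (ek := fun _ => encBool) (σ := fun _ => ℕ)
    (es := fun _ => encNat) (init := fun _ => 0) h (const inp _) ?_ ?_
  · exact (refl (fun p : (_ : ι) × ℕ × Bool =>
      .cons (inp p.1) (.cons (encNat p.2.1) (encBool p.2.2)))).tail.tail.nat_bit
      (refl (fun p : (_ : ι) × ℕ × Bool =>
      .cons (inp p.1) (.cons (encNat p.2.1) (encBool p.2.2)))).tail.head
  · obtain ⟨P, hP⟩ := h.size_le
    refine ⟨4 * P + 1, fun i j hj => (encNat_size_le (ofDigits_lt _)).trans ?_⟩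
    have := (encList_length_le _).trans (hP i)
    simp only [List.length_map, List.length_take] at this ⊢
    simp
    omega

theorem carry (neg : Bool) {a b : ι → ℕ} {k : ι → ℕ}
    (ha : PolyTimeComputable inp (fun i => encNat (a i)))
    (hb : PolyTimeComputable inp (fun i => encNat (b i)))
    (hk : PolyTimeComputable inp (fun i => unary (k i))) :
    PolyTimeComputable inp
      (fun i => encCarry ((carryStep neg)^[k i] (a i, b i, false, []))) := by
  have h := foldl (κ := fun _ => Data) (ek := fun _ d => d) (σ := fun _ => ℕ × ℕ × Bool × List Bool)
    (es := fun _ => encCarry) (init := fun i => (a i, b i, false, []))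
    (l := fun i => List.replicate (k i) .nil)
    (step := fun _ s _ => carryStep neg s) (by simpa [← unary_eq_encList] using hk)
    (ha.pair (hb.pair (const inp (.cons .nil .nil)))) ?_ ?_
  · simpa [foldl_const_eq_iterate] using h
  · let ctx : ((_ : ι) × (ℕ × ℕ × Bool × List Bool) × Data) → Data :=
      fun p => .cons (inp p.1) (.cons (encCarry p.2.1) p.2.2)
    have hs := (refl ctx).tail.head
    have hA : PolyTimeComputable ctx (fun p => encNat p.2.1.1.div2) := by
      simp only [← encNat_tail]
      exact hs.head.tail
    have hB : PolyTimeComputable ctx (fun p => encNat p.2.1.2.1.div2) := by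
      simp only [← encNat_tail]
      exact hs.tail.head.tail
    have hx : PolyTimeComputable ctx (fun p => encBool p.2.1.1.bodd) := by
      simp only [← encNat_head]
      exact hs.head.head
    have hy : PolyTimeComputable ctx (fun p => encBool p.2.1.2.1.bodd) := by
      simp only [← encNat_head]
      exact hs.tail.head.head
    have hc : PolyTimeComputable ctx (fun p => encBool p.2.1.2.2.1) := hs.tail.tail.head
    have ho : PolyTimeComputable ctx (fun p => encList (p.2.1.2.2.2.map encBool)) :=
      hs.tail.tail.tail
    have hn : PolyTimeComputable ctx (fun p => encBool neg) := const _ _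
    have hc' := (((hx.encBool_xor hn).encBool_and hy).encBool_or
      ((hx.encBool_xor hn).encBool_and hc)).encBool_or (hy.encBool_and hc)
    exact hA.pair (hB.pair (hc'.pair (((hx.encBool_xor hy).encBool_xor hc).pair ho)))
  · obtain ⟨P, hP⟩ := ha.size_le
    obtain ⟨Q, hQ⟩ := hb.size_le
    obtain ⟨R, hR⟩ := hk.size_le
    refine ⟨(4 * P + 1) + ((4 * Q + 1) + (3 + (4 * R + 1) + 1) + 1) + 1, fun i j hj => ?_⟩
    rw [foldl_const_eq_iterate]
    simp only [List.length_replicate] at hj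
    simp only [List.length_take, List.length_replicate, min_eq_left hj]
    obtain ⟨h1, h2, h3⟩ := carryStep_iterate neg (a i) (b i) j
    generalize (carryStep neg)^[j] (a i, b i, false, []) = s at h1 h2 h3
    have hp1 := hP i
    have hp2 := hQ i
    have hp3 := hR i
    rw [unary_size] at hp3
    have e1 : (encNat s.1).size ≤ 4 * (encNat (a i)).size + 1 :=
      encNat_size_le (h1 ▸ (Nat.div_le_self _ _).trans_lt (lt_two_pow_encNat_size _))
    have e2 : (encNat s.2.1).size ≤ 4 * (encNat (b i)).size + 1 :=
      encNat_size_le (h2 ▸ (Nat.div_le_self _ _).trans_lt (lt_two_pow_encNat_size _))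
    have e3 := encBool_size_le s.2.2.1
    have e4 := encList_bool_size_le s.2.2.2
    simp only [encCarry, Data.size, Polynomial.eval_add, Polynomial.eval_mul, Polynomial.eval_one,
      Polynomial.eval_ofNat]
    omega

theorem unary_size {a : ι → ℕ} (h : PolyTimeComputable inp (fun i => encNat (a i))) :
    PolyTimeComputable inp (fun i => unary (a i).size) := by
  simpa [Nat.size_eq_bits_len] using h.unary_length

theorem add {a b : ι → ℕ} (ha : PolyTimeComputable inp (fun i => encNat (a i)))
    (hb : PolyTimeComputable inp (fun i => encNat (b i))) :
    PolyTimeComputable inp (fun i => encNat (a i + b i)) := by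
  have hk := (ha.unary_size.unary_add hb.unary_size).unary_add (const inp (unary 1))
  have h : PolyTimeComputable inp (fun i => encList
    (((carryStep false)^[(a i).size + (b i).size + 1] (a i, b i, false, [])).2.2.2.map encBool)) :=
    (carry false ha hb hk).tail.tail.tail
  convert h.nat_ofDigits using 2 with i
  rw [carryStep_add]
  have h1 := Nat.lt_size_self (a i)
  have h2 := Nat.lt_size_self (b i)
  have h3 : 2 ^ (a i).size ≤ 2 ^ ((a i).size + (b i).size) := Nat.pow_le_pow_right (by simp) (by omega)
  have h4 : 2 ^ (b i).size ≤ 2 ^ ((a i).size + (b i).size) := Nat.pow_le_pow_right (by simp) (by omega)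
  rw [pow_succ]
  omega

theorem lt_and_sub {a b : ι → ℕ} (ha : PolyTimeComputable inp (fun i => encNat (a i)))
    (hb : PolyTimeComputable inp (fun i => encNat (b i))) :
    PolyTimeComputable inp (fun i => encBool (decide (a i < b i))) ∧
    PolyTimeComputable inp (fun i => encNat (a i - b i)) := by
  have hk := ha.unary_size.unary_add hb.unary_size
  have key : ∀ i, _ := fun i => carryStep_sub (A := a i) (B := b i) (k := (a i).size + (b i).size)
    ((Nat.lt_size_self (a i)).trans_le (Nat.pow_le_pow_right (by simp) (by omega)))
    ((Nat.lt_size_self (b i)).trans_le (Nat.pow_le_pow_right (by simp) (by omega)))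
  have h := (carry true ha hb hk).tail.tail
  have hlt : PolyTimeComputable inp (fun i => encBool (decide (a i < b i))) := by
    convert h.head using 2 with i
    rw [← (key i).1]
    rfl
  refine ⟨hlt, ?_⟩
  have h' : PolyTimeComputable inp (fun i => encList
    (((carryStep true)^[(a i).size + (b i).size] (a i, b i, false, [])).2.2.2.map encBool)) :=
    h.tail
  convert hlt.ite (const inp (encNat 0)) h'.nat_ofDigits using 2 with i
  rcases lt_or_ge (a i) (b i) with h1 | h1
  · simp [h1, Nat.sub_eq_zero_of_le h1.le]
  · rw [(key i).2 h1]
    simp [not_lt.2 h1]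

theorem lt {a b : ι → ℕ} (ha : PolyTimeComputable inp (fun i => encNat (a i)))
    (hb : PolyTimeComputable inp (fun i => encNat (b i))) :
    PolyTimeComputable inp (fun i => encBool (decide (a i < b i))) := (lt_and_sub ha hb).1

theorem sub {a b : ι → ℕ} (ha : PolyTimeComputable inp (fun i => encNat (a i)))
    (hb : PolyTimeComputable inp (fun i => encNat (b i))) :
    PolyTimeComputable inp (fun i => encNat (a i - b i)) := (lt_and_sub ha hb).2

end PolyTimeComputable

theorem foldl_mul_eq (l : List Bool) (B : ℕ) :
    l.foldl (fun s b => Nat.bit false s + if b then B else 0) 0 = ofDigits l * B := by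
  induction l using List.reverseRecOn with
  | nil => simp [ofDigits]
  | append_singleton l b ih =>
    rw [List.foldl_append, ih, ofDigits_concat]
    cases b <;> simp [Nat.bit_val] <;> ring

/-- One step of long division by `d`: the quotient and remainder so far, and the next digit. -/
def divStep (d : ℕ) (s : ℕ × ℕ) (b : Bool) : ℕ × ℕ :=
  if Nat.bit b s.2 < d then (Nat.bit false s.1, Nat.bit b s.2)
  else (Nat.bit true s.1, Nat.bit b s.2 - d)

theorem divStep_foldl_le (d : ℕ) (l : List Bool) :
    (l.foldl (divStep d) (0, 0)).1 < 2 ^ l.length ∧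
      (l.foldl (divStep d) (0, 0)).2 ≤ ofDigits l := by
  induction l using List.reverseRecOn with
  | nil => simp
  | append_singleton l b ih =>
    rw [List.foldl_append, ofDigits_concat, List.length_append, List.length_singleton, pow_succ]
    generalize l.foldl (divStep d) (0, 0) = s at ih
    simp only [List.foldl_cons, List.foldl_nil, divStep]
    split <;> cases b <;> simp [Nat.bit_val] <;> omega

theorem divStep_foldl (d : ℕ) (hd : 0 < d) (l : List Bool) :
    (l.foldl (divStep d) (0, 0)).1 = ofDigits l / d := by
  suffices h : ofDigits l = d * (l.foldl (divStep d) (0, 0)).1 + (l.foldl (divStep d) (0, 0)).2 ∧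
      (l.foldl (divStep d) (0, 0)).2 < d by
    rw [h.1, Nat.mul_add_div hd, Nat.div_eq_of_lt h.2, add_zero]
  induction l using List.reverseRecOn with
  | nil => simp [ofDigits, hd]
  | append_singleton l b ih =>
    rw [List.foldl_append, ofDigits_concat]
    generalize l.foldl (divStep d) (0, 0) = s at ih
    obtain ⟨h1, h2⟩ := ih
    simp only [List.foldl_cons, List.foldl_nil, divStep]
    rw [h1]
    split
    · rename_i h
      refine ⟨?_, h⟩
      cases b <;> simp [Nat.bit_val] <;> ring
    · rename_i h
      have h3 : Nat.bit b s.2 < 2 * d := by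
        cases b <;> simp [Nat.bit_val] <;> omega
      refine ⟨?_, by dsimp only; omega⟩
      obtain ⟨k, hk⟩ := Nat.exists_eq_add_of_le (not_lt.1 h)
      have : Nat.bit b (d * s.1 + s.2) = 2 * (d * s.1) + Nat.bit b s.2 := by
        cases b <;> simp [Nat.bit_val] <;> ring
      rw [this, hk, Nat.add_sub_cancel_left]
      simp [Nat.bit_val]
      ring

namespace PolyTimeComputable

variable {ι : Type} {inp mid out out' : ι → Data}

theorem nat_digits {a : ι → ℕ} (h : PolyTimeComputable inp (fun i => encNat (a i))) :
    PolyTimeComputable inp (fun i => encList ((a i).bits.reverse.map encBool)) := by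
  simpa using h.reverse

theorem mul {a b : ι → ℕ} (ha : PolyTimeComputable inp (fun i => encNat (a i)))
    (hb : PolyTimeComputable inp (fun i => encNat (b i))) :
    PolyTimeComputable inp (fun i => encNat (a i * b i)) := by
  have h := foldl (κ := fun _ => Bool) (ek := fun _ => encBool) (σ := fun _ => ℕ)
    (es := fun _ => encNat) (init := fun _ => 0)
    (step := fun i s c => Nat.bit false s + if c then b i else 0) ha.nat_digits (const inp _) ?_ ?_
  · simpa only [foldl_mul_eq, ofDigits_bits_reverse] using h
  · let ctx : ((_ : ι) × ℕ × Bool) → Data :=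
      fun p => .cons (inp p.1) (.cons (encNat p.2.1) (encBool p.2.2))
    have hs : PolyTimeComputable ctx (fun p => encNat p.2.1) := (refl ctx).tail.head
    have hc : PolyTimeComputable ctx (fun p => encBool p.2.2) := (refl ctx).tail.tail
    have hB : PolyTimeComputable ctx (fun p => encNat (b p.1)) :=
      hb.weak
    refine ((const ctx (encBool false)).nat_bit hs).add ?_
    convert hc.ite hB (const ctx (encNat 0)) using 2 with p
    split <;> rfl
  · obtain ⟨P, hP⟩ := ha.size_le
    obtain ⟨Q, hQ⟩ := hb.size_le
    refine ⟨4 * (P + Q) + 1, fun i j hj => ?_⟩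
    rw [foldl_mul_eq]
    have h1 := (size_le_encNat_size _).trans (hP i)
    have h2 := hQ i
    have h3 := ofDigits_lt ((a i).bits.reverse.take j)
    have h4 : ((a i).bits.reverse.take j).length ≤ P.eval (inp i).size := by
      rw [List.length_take, List.length_reverse, Nat.size_eq_bits_len]
      omega
    have h5 : ofDigits ((a i).bits.reverse.take j) * b i <
        2 ^ (P.eval (inp i).size + Q.eval (inp i).size) := by
      rw [pow_add]
      exact mul_lt_mul'' (h3.trans_le (Nat.pow_le_pow_right (by simp) h4))
        ((lt_two_pow_encNat_size _).trans_le (Nat.pow_le_pow_right (by simp) h2))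
        (Nat.zero_le _) (Nat.zero_le _)
    simpa using encNat_size_le h5

theorem div {a b : ι → ℕ} (ha : PolyTimeComputable inp (fun i => encNat (a i)))
    (hb : PolyTimeComputable inp (fun i => encNat (b i))) :
    PolyTimeComputable inp (fun i => encNat (a i / b i)) := by
  have h : PolyTimeComputable inp (fun i => Data.cons
      (encNat ((a i).bits.reverse.foldl (divStep (b i)) (0, 0)).1)
      (encNat ((a i).bits.reverse.foldl (divStep (b i)) (0, 0)).2)) :=
    foldl (κ := fun _ => Bool) (ek := fun _ => encBool) (σ := fun _ => ℕ × ℕ)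
      (es := fun _ s => .cons (encNat s.1) (encNat s.2)) (init := fun _ => (0, 0))
      (step := fun i => divStep (b i)) ha.nat_digits (const inp _) ?_ ?_
  · convert hb.encBool_ne_zero.ite h.head (const inp (encNat 0)) using 2 with i
    rcases Nat.eq_zero_or_pos (b i) with h0 | h0
    · simp [h0]
    · rw [divStep_foldl _ h0, ofDigits_bits_reverse]
      simp [h0.ne', Data.head]
  · let ctx : ((_ : ι) × (ℕ × ℕ) × Bool) → Data :=
      fun p => .cons (inp p.1) (.cons (.cons (encNat p.2.1.1) (encNat p.2.1.2)) (encBool p.2.2))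
    have hq : PolyTimeComputable ctx (fun p => encNat p.2.1.1) := (refl ctx).tail.head.head
    have hr : PolyTimeComputable ctx (fun p => encNat p.2.1.2) := (refl ctx).tail.head.tail
    have hc : PolyTimeComputable ctx (fun p => encBool p.2.2) := (refl ctx).tail.tail
    have hB : PolyTimeComputable ctx (fun p => encNat (b p.1)) :=
      hb.weak
    have hr' := hc.nat_bit hr
    convert (hr'.lt hB).ite (((const ctx (encBool false)).nat_bit hq).pair hr')
      (((const ctx (encBool true)).nat_bit hq).pair (hr'.sub hB)) using 2 with p
    simp only [divStep, decide_eq_true_eq]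
    split <;> rfl
  · obtain ⟨P, hP⟩ := ha.size_le
    refine ⟨(4 * P + 1) + (4 * P + 1) + 1, fun i j hj => ?_⟩
    obtain ⟨h1, h2⟩ := divStep_foldl_le (b i) ((a i).bits.reverse.take j)
    have h3 := (size_le_encNat_size _).trans (hP i)
    have h4 : ((a i).bits.reverse.take j).length ≤ P.eval (inp i).size := by
      rw [List.length_take, List.length_reverse, Nat.size_eq_bits_len]
      omega
    have h5 := encNat_size_le (h1.trans_le (Nat.pow_le_pow_right (by simp) h4))
    have h6 := encNat_size_le ((h2.trans_lt (ofDigits_lt _)).trans_le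
      (Nat.pow_le_pow_right (by simp) h4))
    simp only [Data.size, Polynomial.eval_add, Polynomial.eval_mul, Polynomial.eval_one,
      Polynomial.eval_ofNat]
    omega

theorem nat_two_pow {k : ι → ℕ} (h : PolyTimeComputable inp (fun i => unary (k i))) :
    PolyTimeComputable inp (fun i => encNat (2 ^ k i)) := by
  have h1 : PolyTimeComputable inp
      (fun i => encList ((true :: List.replicate (k i) false).map encBool)) := by
    simp only [List.map_cons, List.map_replicate]
    exact (const inp (encBool true)).pair (by simpa [unary_eq_encList, encBool] using h)
  convert h1.nat_ofDigits using 2 with i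
  generalize k i = k
  have : ofDigits (List.replicate k false) = 0 := by
    induction k with
    | zero => rfl
    | succ k ih => simp [List.replicate_succ, ofDigits_cons, ih]
  simp [ofDigits_cons, this]

theorem nat_of_unary {k : ι → ℕ} (h : PolyTimeComputable inp (fun i => unary (k i))) :
    PolyTimeComputable inp (fun i => encNat (k i)) := by
  have h1 := foldl (κ := fun _ => Data) (ek := fun _ d => d) (σ := fun _ => ℕ)
    (es := fun _ => encNat) (init := fun _ => 0) (l := fun i => List.replicate (k i) .nil)
    (step := fun _ s _ => s + 1) (by simpa [← unary_eq_encList] using h) (const inp _) ?_ ?_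
  · simpa [foldl_const_eq_iterate, Nat.succ_iterate] using h1
  · let ctx : ((_ : ι) × ℕ × Data) → Data :=
      fun p => .cons (inp p.1) (.cons (encNat p.2.1) p.2.2)
    have hs : PolyTimeComputable ctx (fun p => encNat p.2.1) := (refl ctx).tail.head
    exact hs.add (const ctx (encNat 1))
  · obtain ⟨P, hP⟩ := h.size_le
    refine ⟨4 * P + 1, fun i j hj => ?_⟩
    have h1 := hP i
    rw [CTECS.unary_size] at h1
    simp only [List.length_replicate] at hj
    have h2 : j < 2 ^ (P.eval (inp i).size) := by
      have := Nat.lt_two_pow_self (n := P.eval (inp i).size)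
      omega
    simpa [foldl_const_eq_iterate, Nat.succ_iterate, hj] using encNat_size_le h2

/-! ### Integers -/

theorem int_natAbs {a : ι → ℤ} (h : PolyTimeComputable inp (fun i => encInt (a i))) :
    PolyTimeComputable inp (fun i => encNat (a i).natAbs) := h.tail

theorem int_neg_lt {a : ι → ℤ} (h : PolyTimeComputable inp (fun i => encInt (a i))) :
    PolyTimeComputable inp (fun i => encBool (decide (a i < 0))) := h.head

theorem int_toNat {a : ι → ℤ} (h : PolyTimeComputable inp (fun i => encInt (a i))) :
    PolyTimeComputable inp (fun i => encNat (a i).toNat) := by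
  convert h.int_neg_lt.ite (const inp (encNat 0)) h.int_natAbs using 2 with i
  rcases lt_or_ge (a i) 0 with h | h
  · simp [h, Int.toNat_of_nonpos h.le]
  · simp only [not_lt.2 h, decide_false, Bool.false_eq_true, if_false]
    congr 1
    omega

theorem int_of_diff {a b : ι → ℕ} (ha : PolyTimeComputable inp (fun i => encNat (a i)))
    (hb : PolyTimeComputable inp (fun i => encNat (b i))) :
    PolyTimeComputable inp (fun i => encInt ((a i : ℤ) - b i)) := by
  convert (ha.lt hb).pair ((ha.sub hb).add (hb.sub ha)) using 2 with i
  rw [encInt]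
  congr 2
  · exact decide_eq_decide.2 (by omega)
  · omega

theorem int_neg {a : ι → ℤ} (h : PolyTimeComputable inp (fun i => encInt (a i))) :
    PolyTimeComputable inp (fun i => encInt (-a i)) := by
  have h0 : PolyTimeComputable inp (fun i => encNat (-a i).toNat) := by
    convert h.int_neg_lt.ite h.int_natAbs (const inp (encNat 0)) using 2 with i
    rcases lt_or_ge (a i) 0 with h | h
    · simp only [h, decide_true, if_true]
      congr 1
      omega
    · simp [not_lt.2 h, Int.toNat_of_nonpos (neg_nonpos.2 h)]
  convert h0.int_of_diff h.int_toNat using 3 with i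
  omega

theorem int_add {a b : ι → ℤ} (ha : PolyTimeComputable inp (fun i => encInt (a i)))
    (hb : PolyTimeComputable inp (fun i => encInt (b i))) :
    PolyTimeComputable inp (fun i => encInt (a i + b i)) := by
  convert (ha.int_toNat.add hb.int_toNat).int_of_diff
    (ha.int_neg.int_toNat.add hb.int_neg.int_toNat) using 3 with i
  omega

theorem int_sub {a b : ι → ℤ} (ha : PolyTimeComputable inp (fun i => encInt (a i)))
    (hb : PolyTimeComputable inp (fun i => encInt (b i))) :
    PolyTimeComputable inp (fun i => encInt (a i - b i)) := by
  simpa only [sub_eq_add_neg] using ha.int_add hb.int_neg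

theorem int_mul {a b : ι → ℤ} (ha : PolyTimeComputable inp (fun i => encInt (a i)))
    (hb : PolyTimeComputable inp (fun i => encInt (b i))) :
    PolyTimeComputable inp (fun i => encInt (a i * b i)) := by
  convert ((ha.int_toNat.mul hb.int_toNat).add (ha.int_neg.int_toNat.mul hb.int_neg.int_toNat)).int_of_diff
    ((ha.int_toNat.mul hb.int_neg.int_toNat).add (ha.int_neg.int_toNat.mul hb.int_toNat))
    using 3 with i
  push_cast
  have h1 : ∀ z : ℤ, z = (z.toNat : ℤ) - ((-z).toNat : ℤ) := fun z => by omega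
  conv_lhs => rw [h1 (a i), h1 (b i)]
  simp only [Int.toNat_eq_max]
  ring

theorem int_of_nat {a : ι → ℕ} (h : PolyTimeComputable inp (fun i => encNat (a i))) :
    PolyTimeComputable inp (fun i => encInt (a i)) := by
  simpa using h.int_of_diff (const inp (encNat 0))

/-- Division of an integer by a natural number, rounded towards zero. -/
theorem int_tdiv {a : ι → ℤ} {b : ι → ℕ} (ha : PolyTimeComputable inp (fun i => encInt (a i)))
    (hb : PolyTimeComputable inp (fun i => encNat (b i))) :
    PolyTimeComputable inp (fun i => encInt ((a i).tdiv (b i))) := by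
  convert (ha.int_toNat.div hb).int_of_diff (ha.int_neg.int_toNat.div hb) using 3 with i
  rcases le_total 0 (a i) with h | h
  · obtain ⟨k, hk⟩ := Int.eq_ofNat_of_zero_le h
    rw [hk]
    simp [Int.tdiv_eq_ediv_of_nonneg]
  · obtain ⟨k, hk⟩ := Int.eq_ofNat_of_zero_le (neg_nonneg.2 h)
    rw [show a i = -(k : ℤ) by omega]
    simp [Int.neg_tdiv, Int.tdiv_eq_ediv_of_nonneg]

theorem int_lt {a b : ι → ℤ} (ha : PolyTimeComputable inp (fun i => encInt (a i)))
    (hb : PolyTimeComputable inp (fun i => encInt (b i))) :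
    PolyTimeComputable inp (fun i => encBool (decide (a i < b i))) := by
  convert (ha.int_sub hb).int_neg_lt using 3 with i
  simp

theorem encInt_sum_size_le (l : List ℤ) :
    (encInt l.sum).size ≤ 4 * (encList (l.map encInt)).size + 5 := by
  have h : l.sum.natAbs < 2 ^ (encList (l.map encInt)).size := by
    induction l with
    | nil => simp
    | cons a l ih =>
      have h1 := lt_two_pow_encNat_size a.natAbs
      simp only [List.sum_cons, List.map_cons, encList, Data.size, encInt]
      refine (Int.natAbs_add_le _ _).trans_lt ?_
      have h2 : 2 ^ (encNat a.natAbs).size ≤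
          2 ^ ((encNat a.natAbs).size + (encList (l.map encInt)).size) :=
        Nat.pow_le_pow_right (by simp) (by omega)
      have h3 : 2 ^ (encList (l.map encInt)).size ≤
          2 ^ ((encNat a.natAbs).size + (encList (l.map encInt)).size) :=
        Nat.pow_le_pow_right (by simp) (by omega)
      have h4 : 2 ^ ((encNat a.natAbs).size + (encList (l.map encInt)).size + 1) ≤
          2 ^ ((encBool (decide (a < 0))).size + (encNat a.natAbs).size + 1 +
            (encList (l.map encInt)).size + 1) :=
        Nat.pow_le_pow_right (by simp) (by omega)
      rw [pow_succ] at h4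
      omega
  have h1 := encNat_size_le h
  have h2 := encBool_size_le (decide (l.sum < 0))
  simp only [encInt, Data.size]
  omega

theorem int_sum {l : ι → List ℤ} (h : PolyTimeComputable inp (fun i => encList ((l i).map encInt))) :
    PolyTimeComputable inp (fun i => encInt (l i).sum) := by
  have hf : ∀ l : List ℤ, l.foldl (fun s a => s + a) 0 = l.sum := fun l => by
    rw [List.sum_eq_foldl]
  have h1 := foldl (κ := fun _ => ℤ) (ek := fun _ => encInt) (σ := fun _ => ℤ)
    (es := fun _ => encInt) (init := fun _ => 0)
    (step := fun _ s a => s + a) h (const inp _) ?_ ?_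
  · simpa only [hf] using h1
  · let ctx : ((_ : ι) × ℤ × ℤ) → Data :=
      fun p => .cons (inp p.1) (.cons (encInt p.2.1) (encInt p.2.2))
    have hs : PolyTimeComputable ctx (fun p => encInt p.2.1) := (refl ctx).tail.head
    have ha : PolyTimeComputable ctx (fun p => encInt p.2.2) := (refl ctx).tail.tail
    exact hs.int_add ha
  · obtain ⟨P, hP⟩ := h.size_le
    refine ⟨4 * P + 5, fun i j hj => ?_⟩
    rw [hf]
    have h2 := encInt_sum_size_le ((l i).take j)
    have h3 := encList_take_size_le ((l i).map encInt) j
    have h4 := hP i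
    rw [← List.map_take] at h3
    simp only [Polynomial.eval_add, Polynomial.eval_mul, Polynomial.eval_ofNat]
    omega

end PolyTimeComputable

/-! ### The estimator of the Walsh coefficients as a program -/

/-- Encoding of a Gaussian integer. -/
def encGauss (z : GaussianInt) : Data := .cons (encInt z.re) (encInt z.im)

/-- Encoding of a list of qubits. -/
def encQubits {n : ℕ} (s : List (Fin n)) : Data := encList (s.map fun j : Fin n => unary (j : ℕ))

/-- Encoding of a basis state with a Gaussian integer weight. -/
def encPath {n : ℕ} (p : Bits n × GaussianInt) : Data := .cons (encBits p.1) (encGauss p.2)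

/-- A column-sparse matrix `row`, `val` for every qubit is given: the `r`-th entry of the
column `x` is `val j r x`, in row `row j r x`. These are the walks `x → x₁ → … → x_k` through the
matrices of the qubits of a list (the last one first): the end point of each
walk and the product of the matrix entries along it. -/
def paths {R : Type} [One R] [Mul R] {n S : ℕ} (row : Fin n → Fin S → Bits n → Bits n)
    (val : Fin n → Fin S → Bits n → R) (x : Bits n) :
    List (Fin n) → List (Bits n × R)
  | [] => [(x, 1)]
  | j :: s => (paths row val x s).flatMap fun p =>
      (List.finRange S).map fun r => (row j r p.1, val j r p.1 * p.2)

/-- `J · 2 Re (Ȳ z X) / (D (|X|² + |Y|²))`, rounded to an integer. -/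
def walkTerm (J D : ℕ) (X Y z : GaussianInt) : ℤ :=
  (J * (2 * (star Y * z * X).re)).tdiv
    ((D * ((X.re * X.re + X.im * X.im).natAbs + (Y.re * Y.re + Y.im * Y.im).natAbs) : ℕ))

/-- The estimate for the list `s` of qubits from one sample `x`: the sum over all walks from `x`,
where every matrix entry is scaled by `2 ^ h` and the result by `J`. -/
def walkSum {n S : ℕ} (row : Fin n → Fin S → Bits n → Bits n)
    (val : Fin n → Fin S → Bits n → GaussianInt) (amp : Bits n → GaussianInt) (J h : ℕ)
    (x : Bits n) (s : List (Fin n)) : ℤ :=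
  ((paths row val x s).map fun p => walkTerm J (2 ^ (h * s.length)) (amp x) (amp p.1) p.2).sum

/-- The lists, in decreasing order, of at most `l` qubits among the first `m`. -/
def subs {n : ℕ} : ℕ → (m : ℕ) → m ≤ n → List (List (Fin n))
  | 0, _, _ => [[]]
  | l + 1, m, h => [] :: (List.finRange m).flatMap fun j : Fin m =>
      (subs l j (j.2.le.trans h)).map fun s => Fin.castLE h j :: s

theorem length_le_of_mem_subs {n l m : ℕ} {h : m ≤ n} {s : List (Fin n)} (hs : s ∈ subs l m h) :
    s.length ≤ l := by
  induction l generalizing m s with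
  | zero => simp_all [subs]
  | succ l ih =>
    simp only [subs, List.mem_cons, List.mem_flatMap, List.mem_map] at hs
    rcases hs with rfl | ⟨j, -, s', hs', rfl⟩
    · simp
    · simpa using ih hs'

namespace PolyTimeComputable

variable {ι : Type} {ctx : ι → Data} {n : ι → ℕ+}

theorem gauss_mul {a b : ι → GaussianInt} (ha : PolyTimeComputable ctx (fun i => encGauss (a i)))
    (hb : PolyTimeComputable ctx (fun i => encGauss (b i))) :
    PolyTimeComputable ctx (fun i => encGauss (a i * b i)) := by
  have har : PolyTimeComputable ctx (fun i => encInt (a i).re) := ha.head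
  have hai : PolyTimeComputable ctx (fun i => encInt (a i).im) := ha.tail
  have hbr : PolyTimeComputable ctx (fun i => encInt (b i).re) := hb.head
  have hbi : PolyTimeComputable ctx (fun i => encInt (b i).im) := hb.tail
  convert ((har.int_mul hbr).int_sub (hai.int_mul hbi)).pair
    ((har.int_mul hbi).int_add (hai.int_mul hbr)) using 2 with i
  simp [encGauss, sub_eq_add_neg]

theorem gauss_star {a : ι → GaussianInt} (ha : PolyTimeComputable ctx (fun i => encGauss (a i))) :
    PolyTimeComputable ctx (fun i => encGauss (star (a i))) := by
  have har : PolyTimeComputable ctx (fun i => encInt (a i).re) := ha.head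
  have hai : PolyTimeComputable ctx (fun i => encInt (a i).im) := ha.tail
  exact har.pair hai.int_neg

theorem walkTerm {J D : ι → ℕ} {X Y z : ι → GaussianInt}
    (hJ : PolyTimeComputable ctx (fun i => encNat (J i)))
    (hD : PolyTimeComputable ctx (fun i => encNat (D i)))
    (hX : PolyTimeComputable ctx (fun i => encGauss (X i)))
    (hY : PolyTimeComputable ctx (fun i => encGauss (Y i)))
    (hz : PolyTimeComputable ctx (fun i => encGauss (z i))) :
    PolyTimeComputable ctx (fun i => encInt (walkTerm (J i) (D i) (X i) (Y i) (z i))) := by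
  have hN : ∀ {a : ι → GaussianInt}, PolyTimeComputable ctx (fun i => encGauss (a i)) →
      PolyTimeComputable ctx
        (fun i => encNat ((a i).re * (a i).re + (a i).im * (a i).im).natAbs) := by
    intro a ha
    have har : PolyTimeComputable ctx (fun i => encInt (a i).re) := ha.head
    have hai : PolyTimeComputable ctx (fun i => encInt (a i).im) := ha.tail
    exact ((har.int_mul har).int_add (hai.int_mul hai)).int_natAbs
  have hre : PolyTimeComputable ctx (fun i => encInt (star (Y i) * z i * X i).re) :=
    ((hY.gauss_star.gauss_mul hz).gauss_mul hX).head
  exact (hJ.int_of_nat.int_mul ((const ctx (encInt 2)).int_mul hre)).int_tdiv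
    (hD.mul ((hN hX).add (hN hY)))

variable {S : ℕ+ → ℕ} {row : (n : ℕ+) → Fin n → Fin (S n) → Bits n → Bits n}
  {val : (n : ℕ+) → Fin n → Fin (S n) → Bits n → GaussianInt}
  {amp : (n : ℕ+) → Bits n → GaussianInt}

theorem paths (l : ℕ)
    (hS : PolyTimeComputable (fun n : ℕ+ => unary n) (fun n => unary (S n)))
    (hrow : PolyTimeComputable
      (fun i : (n : ℕ+) × Fin n × Fin (S n) × Bits n =>
        encList [unary i.1, unary i.2.1, unary i.2.2.1, encBits i.2.2.2])
      (fun i => encBits (row i.1 i.2.1 i.2.2.1 i.2.2.2)))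
    (hval : PolyTimeComputable
      (fun i : (n : ℕ+) × Fin n × Fin (S n) × Bits n =>
        encList [unary i.1, unary i.2.1, unary i.2.2.1, encBits i.2.2.2])
      (fun i => encGauss (val i.1 i.2.1 i.2.2.1 i.2.2.2)))
    {x : (i : ι) → Bits (n i)} {s : (i : ι) → List (Fin (n i))} (hs : ∀ i, (s i).length ≤ l)
    (hn : PolyTimeComputable ctx (fun i => unary (n i)))
    (hx : PolyTimeComputable ctx (fun i => encBits (x i)))
    (hsc : PolyTimeComputable ctx (fun i => encQubits (s i))) :
    PolyTimeComputable ctx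
      (fun i => encList ((paths (row (n i)) (val (n i)) (x i) (s i)).map encPath)) := by
  induction l generalizing ι with
  | zero =>
    have h0 : ∀ i, s i = [] := fun i => List.eq_nil_of_length_eq_zero (Nat.le_zero.1 (hs i))
    simp only [h0, CTECS.paths, List.map_cons, List.map_nil, encList, encPath]
    exact (hx.pair (const ctx (encGauss 1))).pair (const_nil ctx)
  | succ l ih =>
    refine cases hsc ?_ ?_
    · have h0 : ∀ i : {i // encQubits (s i) = .nil}, s i = [] := by
        rintro ⟨i, hi⟩
        cases h : s i with
        | nil => rfl
        | cons a t =>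
          rw [h] at hi
          exact Data.noConfusion hi
      simp only [h0, CTECS.paths, List.map_cons, List.map_nil, encList, encPath]
      exact ((hx.reindex _).pair (const _ (encGauss 1))).pair (const_nil _)
    · let κ := {i // encQubits (s i) ≠ .nil}
      have h0 : ∀ i : κ, s i.1 ≠ [] := by
        rintro ⟨i, hi⟩ h
        exact hi (by rw [h]; rfl)
      let j : (i : κ) → Fin (n i.1) := fun i => (s i.1).head (h0 i)
      let t : (i : κ) → List (Fin (n i.1)) := fun i => (s i.1).tail
      have hst : ∀ i : κ, s i.1 = j i :: t i := fun i => (List.cons_head_tail (h0 i)).symm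
      let ctx1 : κ → Data := fun i => ctx i.1
      have hn1 : PolyTimeComputable ctx1 (fun i => unary (n i.1)) := hn.reindex _
      have hj : PolyTimeComputable ctx1 (fun i => unary (j i)) := by
        have h := (hsc.reindex (Subtype.val : κ → ι)).head
        simp only [hst] at h
        exact h
      have ht : PolyTimeComputable ctx1 (fun i => encQubits (t i)) := by
        have h := (hsc.reindex (Subtype.val : κ → ι)).tail
        simp only [hst] at h
        exact h
      have hp := ih (n := fun i : κ => n i.1) (x := fun i => x i.1) (s := t)
        (fun i => by have := hs i.1; rw [hst i] at this; simpa using this) hn1 (hx.reindex _) ht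
      have hmain : PolyTimeComputable ctx1 (fun i => encList
          ((CTECS.paths (row (n i.1)) (val (n i.1)) (x i.1) (t i)).flatMap fun p =>
            (List.finRange (S (n i.1))).map fun r => encPath
              (row (n i.1) (j i) r p.1, val (n i.1) (j i) r p.1 * p.2))) := by
        refine flatMap hp ?_
        let ctx2 : ((i : κ) × (Bits (n i.1) × GaussianInt)) → Data :=
          fun p => .cons (ctx1 p.1) (encPath p.2)
        have hn2 : PolyTimeComputable ctx2 (fun p => unary (n p.1.1)) := hn1.weak
        have hj2 : PolyTimeComputable ctx2 (fun p => unary (j p.1)) := hj.weak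
        have hp2 : PolyTimeComputable ctx2 (fun p => encPath p.2) := var _ _
        have hS2 : PolyTimeComputable ctx2 (fun p => unary (S (n p.1.1))) :=
          hn2.trans (hS.reindex _)
        refine map (ek := fun (p : (i : κ) × (Bits (n i.1) × GaussianInt))
          (r : Fin (S (n p.1.1))) => unary (r : ℕ)) hS2.finRange ?_
        let ctx3 : ((p : (i : κ) × (Bits (n i.1) × GaussianInt)) × Fin (S (n p.1.1))) → Data :=
          fun q => .cons (ctx2 q.1) (unary (q.2 : ℕ))
        have hn3 : PolyTimeComputable ctx3 (fun q => unary (n q.1.1.1)) := hn2.weak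
        have hj3 : PolyTimeComputable ctx3 (fun q => unary (j q.1.1)) := hj2.weak
        have hr3 : PolyTimeComputable ctx3 (fun q => unary (q.2 : ℕ)) := var _ _
        have hp3 : PolyTimeComputable ctx3 (fun q => encPath q.1.2) := hp2.weak
        have hy3 : PolyTimeComputable ctx3 (fun q => encBits q.1.2.1) := hp3.head
        have hz3 : PolyTimeComputable ctx3 (fun q => encGauss q.1.2.2) := hp3.tail
        have harg := hn3.pair (hj3.pair (hr3.pair (hy3.pair (const_nil _))))
        let f : ((p : (i : κ) × (Bits (n i.1) × GaussianInt)) × Fin (S (n p.1.1))) →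
          (n : ℕ+) × Fin n × Fin (S n) × Bits n := fun q => ⟨n q.1.1.1, j q.1.1, q.2, q.1.2.1⟩
        exact (harg.trans (hrow.reindex f)).pair ((harg.trans (hval.reindex f)).gauss_mul hz3)
      have he : ∀ i : κ, (CTECS.paths (row (n i.1)) (val (n i.1)) (x i.1) (s i.1)).map encPath =
          (CTECS.paths (row (n i.1)) (val (n i.1)) (x i.1) (t i)).flatMap fun p =>
            (List.finRange (S (n i.1))).map fun r => encPath
              (row (n i.1) (j i) r p.1, val (n i.1) (j i) r p.1 * p.2) := by
        intro i
        rw [hst i]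
        simp [CTECS.paths, List.map_flatMap, Function.comp_def]
      simpa only [he] using hmain

theorem walkSum (l : ℕ) {J h : ℕ+ → ℕ}
    (hS : PolyTimeComputable (fun n : ℕ+ => unary n) (fun n => unary (S n)))
    (hJ : PolyTimeComputable (fun n : ℕ+ => unary n) (fun n => encNat (J n)))
    (hh : PolyTimeComputable (fun n : ℕ+ => unary n) (fun n => unary (h n)))
    (hrow : PolyTimeComputable
      (fun i : (n : ℕ+) × Fin n × Fin (S n) × Bits n =>
        encList [unary i.1, unary i.2.1, unary i.2.2.1, encBits i.2.2.2])
      (fun i => encBits (row i.1 i.2.1 i.2.2.1 i.2.2.2)))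
    (hval : PolyTimeComputable
      (fun i : (n : ℕ+) × Fin n × Fin (S n) × Bits n =>
        encList [unary i.1, unary i.2.1, unary i.2.2.1, encBits i.2.2.2])
      (fun i => encGauss (val i.1 i.2.1 i.2.2.1 i.2.2.2)))
    (hamp : PolyTimeComputable
      (fun i : (n : ℕ+) × Bits n => .cons (unary i.1) (encBits i.2))
      (fun i => encGauss (amp i.1 i.2)))
    {x : (i : ι) → Bits (n i)} {s : (i : ι) → List (Fin (n i))} (hs : ∀ i, (s i).length ≤ l)
    (hn : PolyTimeComputable ctx (fun i => unary (n i)))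
    (hx : PolyTimeComputable ctx (fun i => encBits (x i)))
    (hsc : PolyTimeComputable ctx (fun i => encQubits (s i))) :
    PolyTimeComputable ctx (fun i => encInt
      (walkSum (row (n i)) (val (n i)) (amp (n i)) (J (n i)) (h (n i)) (x i) (s i))) := by
  refine int_sum ?_
  have hp := paths l hS hrow hval hs hn hx hsc
  simp only [List.map_map]
  refine map hp ?_
  let ctx2 : ((i : ι) × (Bits (n i) × GaussianInt)) → Data :=
    fun p => .cons (ctx p.1) (encPath p.2)
  have hn2 : PolyTimeComputable ctx2 (fun p => unary (n p.1)) := hn.weak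
  have hx2 : PolyTimeComputable ctx2 (fun p => encBits (x p.1)) := hx.weak
  have hs2 : PolyTimeComputable ctx2 (fun p => encQubits (s p.1)) := hsc.weak
  have hp2 : PolyTimeComputable ctx2 (fun p => encPath p.2) := var _ _
  have hl2 : PolyTimeComputable ctx2 (fun p => unary (s p.1).length) := by
    simpa [encQubits] using hs2.unary_length
  have hX : PolyTimeComputable ctx2 (fun p => encGauss (amp (n p.1) (x p.1))) :=
    (hn2.pair hx2).trans (hamp.reindex fun p : (i : ι) × (Bits (n i) × GaussianInt) =>
      ⟨n p.1, x p.1⟩)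
  have hY : PolyTimeComputable ctx2 (fun p => encGauss (amp (n p.1) p.2.1)) :=
    (hn2.pair hp2.head).trans (hamp.reindex fun p : (i : ι) × (Bits (n i) × GaussianInt) =>
      ⟨n p.1, p.2.1⟩)
  exact walkTerm (hn2.trans (hJ.reindex _))
    ((hn2.trans (hh.reindex fun p : (i : ι) × (Bits (n i) × GaussianInt) => n p.1)).unary_mul
      hl2).nat_two_pow hX hY hp2.tail

theorem subs (l : ℕ) {N m : ι → ℕ} (h : ∀ i, m i ≤ N i)
    (hm : PolyTimeComputable ctx (fun i => unary (m i))) :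
    PolyTimeComputable ctx
      (fun i => encList ((subs l (m i) (h i)).map encQubits)) := by
  induction l generalizing ι with
  | zero =>
    simpa [CTECS.subs, encQubits] using const ctx (encList [encList []])
  | succ l ih =>
    have hf : PolyTimeComputable ctx (fun i => encList ((List.finRange (m i)).flatMap fun j : Fin (m i) =>
        (CTECS.subs l j (j.2.le.trans (h i))).map fun s =>
          encQubits (Fin.castLE (h i) j :: s))) := by
      refine flatMap hm.finRange ?_
      let ctx2 : ((i : ι) × Fin (m i)) → Data := fun p => .cons (ctx p.1) (unary (p.2 : ℕ))
      have hj : PolyTimeComputable ctx2 (fun p => unary (p.2 : ℕ)) := var _ _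
      have h2 := ih (N := fun p : (i : ι) × Fin (m i) => N p.1)
        (fun p : (i : ι) × Fin (m i) => p.2.2.le.trans (h p.1)) hj
      refine map h2 ?_
      let ctx3 : ((p : (i : ι) × Fin (m i)) × List (Fin (N p.1))) → Data :=
        fun q => .cons (ctx2 q.1) (encQubits q.2)
      have hj3 : PolyTimeComputable ctx3 (fun q => unary (q.1.2 : ℕ)) := hj.weak
      have hs3 : PolyTimeComputable ctx3 (fun q => encQubits q.2) := var _ _
      exact hj3.pair hs3
    have h1 := (const ctx (encQubits (n := 0) [])).pair hf
    convert h1 using 2 with i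
    simp [CTECS.subs, encList, List.map_flatMap, Function.comp_def, encQubits]

end PolyTimeComputable

/-! ### The two programs -/

/-- Cuts a string of coin tosses into `T` blocks of length `L`. -/
def splitCoins {T L R : ℕ} (h : T * L ≤ R) (r : Bits R) (t : Fin T) : Bits L := fun j =>
  r ⟨t * L + j, by
    have h1 : (t + 1) * L ≤ T * L := Nat.mul_le_mul_right _ t.2
    have h2 := j.2
    rw [add_mul, one_mul] at h1
    omega⟩

/-- The sum of the estimates for the list `s` of qubits over samples drawn with independent
blocks of coin tosses. -/
def sampleSum {n S L T : ℕ} (row : Fin n → Fin S → Bits n → Bits n)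
    (val : Fin n → Fin S → Bits n → GaussianInt) (amp : Bits n → GaussianInt) (J h : ℕ)
    (sam : Bits L → Bits n) (ω : Fin T → Bits L) (s : List (Fin n)) : ℤ :=
  ((List.finRange T).map fun t => walkSum row val amp J h (sam (ω t)) s).sum

/-- The parity of the bits of `x` at the positions in `s`. -/
def parity {n : ℕ} (s : List (Fin n)) (x : Bits n) : Bool := s.foldl (fun b j => b ^^ x j) false

/-- `2ⁿ` times the value at `x` of the function with Walsh coefficients `c`. -/
def walshSum {n : ℕ} (c : List (List (Fin n) × ℤ)) (x : Bits n) : ℤ :=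
  (c.map fun p => if parity p.1 x then -p.2 else p.2).sum

/-- The candidate proposed by one trial of rejection sampling. -/
def candidate {n K : ℕ} (w : Bits (n + K)) : Bits n := fun j => w (Fin.castAdd K j)

/-- The number below `2 ^ K` that decides about the acceptance of the candidate. -/
def threshold {n K : ℕ} (w : Bits (n + K)) : ℕ := ofDigits (List.ofFn fun j => w (Fin.natAdd n j))

/-- Acceptance of the candidate `x`, with probability `max 0 (walshSum c x) / 2 ^ K` if this is at
most `1`. -/
def accepts {n K : ℕ} (c : List (List (Fin n) × ℤ)) (w : Bits (n + K)) : Bool :=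
  decide ((threshold w : ℤ) < walshSum c (candidate w))

/-- Rejection sampling: the first accepted candidate, or `0ⁿ` if there is none. -/
def rejection {n K T : ℕ} (c : List (List (Fin n) × ℤ)) (ω : Fin T → Bits (n + K)) : Bits n :=
  (List.ofFn ω).foldr (fun w y => if accepts c w then candidate w else y) (zeros n)

/-- Encoding of a list of Walsh coefficients. -/
def encCoeffs {n : ℕ} (c : List (List (Fin n) × ℤ)) : Data :=
  encList (c.map fun p => .cons (encQubits p.1) (encInt p.2))

theorem encBits_size_le {n : ℕ} (x : Bits n) : (encBits x).size ≤ 4 * n + 1 := by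
  have := encList_bool_size_le (List.ofFn x)
  rwa [List.length_ofFn] at this

namespace PolyTimeComputable

variable {ι : Type} {ctx : ι → Data}

theorem splitCoins {T L R : ι → ℕ} {h : ∀ i, T i * L i ≤ R i} {r : (i : ι) → Bits (R i)}
    {t : (i : ι) → Fin (T i)} (hL : PolyTimeComputable ctx (fun i => unary (L i)))
    (hr : PolyTimeComputable ctx (fun i => encBits (r i)))
    (ht : PolyTimeComputable ctx (fun i => unary (t i : ℕ))) :
    PolyTimeComputable ctx (fun i => encBits (splitCoins (h i) (r i) (t i))) := by
  refine bits hL ?_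
  have hr2 := hr.weak (κ := fun i => Fin (L i)) (e := fun p => unary (p.2 : ℕ))
  have hj := var ctx (κ := fun i => Fin (L i)) (fun p => unary (p.2 : ℕ))
  exact getBit (k := fun p : (i : ι) × Fin (L i) => ⟨t p.1 * L p.1 + p.2, _⟩) hr2
    ((ht.weak.unary_mul hL.weak).unary_add hj)

theorem parity {n : ι → ℕ} {s : (i : ι) → List (Fin (n i))} {x : (i : ι) → Bits (n i)}
    (hs : PolyTimeComputable ctx (fun i => encQubits (s i)))
    (hx : PolyTimeComputable ctx (fun i => encBits (x i))) :
    PolyTimeComputable ctx (fun i => encBool (parity (s i) (x i))) := by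
  refine foldl (κ := fun i => Fin (n i)) (ek := fun i (j : Fin (n i)) => unary (j : ℕ))
    (l := s) (σ := fun _ => Bool)
    (es := fun _ => encBool) (init := fun _ => false) (step := fun i b j => b ^^ x i j)
    hs (const _ _) ?_ ⟨3, fun i j _ => by simpa using encBool_size_le _⟩
  let ctx2 : ((i : ι) × Bool × Fin (n i)) → Data :=
    fun p => .cons (ctx p.1) (.cons (encBool p.2.1) (unary (p.2.2 : ℕ)))
  have hb : PolyTimeComputable ctx2 (fun p => encBool p.2.1) := (refl ctx2).tail.head
  have hj : PolyTimeComputable ctx2 (fun p => unary (p.2.2 : ℕ)) := (refl ctx2).tail.tail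
  have hx2 : PolyTimeComputable ctx2 (fun p => encBits (x p.1)) := hx.weak
  exact hb.encBool_xor (getBit (k := fun p : (i : ι) × Bool × Fin (n i) => p.2.2) hx2 hj)

theorem walshSum {n : ι → ℕ} {c : (i : ι) → List (List (Fin (n i)) × ℤ)}
    {x : (i : ι) → Bits (n i)}
    (hc : PolyTimeComputable ctx (fun i => encCoeffs (c i)))
    (hx : PolyTimeComputable ctx (fun i => encBits (x i))) :
    PolyTimeComputable ctx (fun i => encInt (walshSum (c i) (x i))) := by
  refine int_sum ?_
  simp only [List.map_map]
  refine map hc ?_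
  let ctx2 : ((i : ι) × List (Fin (n i)) × ℤ) → Data :=
    fun p => .cons (ctx p.1) (.cons (encQubits p.2.1) (encInt p.2.2))
  have hs : PolyTimeComputable ctx2 (fun p => encQubits p.2.1) := (refl ctx2).tail.head
  have hE : PolyTimeComputable ctx2 (fun p => encInt p.2.2) := (refl ctx2).tail.tail
  have hx2 : PolyTimeComputable ctx2 (fun p => encBits (x p.1)) := hx.weak
  convert (parity hs hx2).ite hE.int_neg hE using 2 with p
  simp only [Function.comp]
  split <;> rfl

theorem candidate {n K : ι → ℕ} {w : (i : ι) → Bits (n i + K i)}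
    (hn : PolyTimeComputable ctx (fun i => unary (n i)))
    (hw : PolyTimeComputable ctx (fun i => encBits (w i))) :
    PolyTimeComputable ctx (fun i => encBits (candidate (w i))) :=
  bits hn (getBit (k := fun p : (i : ι) × Fin (n i) => Fin.castAdd (K p.1) p.2)
    hw.weak (var _ _))

theorem threshold {n K : ι → ℕ} {w : (i : ι) → Bits (n i + K i)}
    (hn : PolyTimeComputable ctx (fun i => unary (n i)))
    (hK : PolyTimeComputable ctx (fun i => unary (K i)))
    (hw : PolyTimeComputable ctx (fun i => encBits (w i))) :
    PolyTimeComputable ctx (fun i => encNat (threshold (w i))) :=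
  nat_ofDigits (bits hK (getBit (k := fun p : (i : ι) × Fin (K i) => Fin.natAdd (n p.1) p.2)
    hw.weak (hn.weak.unary_add (var _ _))))

theorem rejection {n K T : ι → ℕ} {c : (i : ι) → List (List (Fin (n i)) × ℤ)}
    {ω : (i : ι) → Fin (T i) → Bits (n i + K i)}
    (hn : PolyTimeComputable ctx (fun i => unary (n i)))
    (hK : PolyTimeComputable ctx (fun i => unary (K i)))
    (hT : PolyTimeComputable ctx (fun i => unary (T i)))
    (hc : PolyTimeComputable ctx (fun i => encCoeffs (c i)))
    (hω : PolyTimeComputable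
      (fun p : (i : ι) × Fin (T i) => .cons (ctx p.1) (unary (p.2 : ℕ)))
      (fun p => encBits (ω p.1 p.2))) :
    PolyTimeComputable ctx (fun i => encBits (rejection (c i) (ω i))) := by
  have hr : PolyTimeComputable ctx
      (fun i => encList ((List.finRange (T i)).reverse.map fun j : Fin (T i) => unary (j : ℕ))) :=
    hT.finRange.map_reverse (ek := fun i (j : Fin (T i)) => unary (j : ℕ)) (var _ _)
  have h := foldl (κ := fun i => Fin (T i)) (ek := fun i (j : Fin (T i)) => unary (j : ℕ))
    (σ := fun i => Bits (n i)) (es := fun _ => encBits) (init := fun i => zeros (n i))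
    (step := fun i y t => if accepts (c i) (ω i t) then CTECS.candidate (ω i t) else y)
    hr (bits hn (const _ _)) ?_ ?_
  · convert h using 3 with i
    rw [CTECS.rejection, List.ofFn_eq_map, List.foldr_map, List.foldl_reverse]
  · let ctx2 : ((i : ι) × Bits (n i) × Fin (T i)) → Data :=
      fun p => .cons (ctx p.1) (.cons (encBits p.2.1) (unary (p.2.2 : ℕ)))
    have hI : PolyTimeComputable ctx2 (fun p => ctx p.1) := (refl ctx2).head
    have hy : PolyTimeComputable ctx2 (fun p => encBits p.2.1) := (refl ctx2).tail.head
    have ht : PolyTimeComputable ctx2 (fun p => unary (p.2.2 : ℕ)) := (refl ctx2).tail.tail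
    have hw : PolyTimeComputable ctx2 (fun p => encBits (ω p.1 p.2.2)) :=
      (hI.pair ht).trans (hω.reindex fun p : (i : ι) × Bits (n i) × Fin (T i) => ⟨p.1, p.2.2⟩)
    have hn2 : PolyTimeComputable ctx2 (fun p => unary (n p.1)) := hn.weak
    have hK2 : PolyTimeComputable ctx2 (fun p => unary (K p.1)) := hK.weak
    have hc2 : PolyTimeComputable ctx2 (fun p => encCoeffs (c p.1)) := hc.weak
    have hcand := candidate hn2 hw
    have hacc : PolyTimeComputable ctx2 (fun p => encBool (accepts (c p.1) (ω p.1 p.2.2))) :=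
      (threshold hn2 hK2 hw).int_of_nat.int_lt (walshSum hc2 hcand)
    convert hacc.ite hcand hy using 2 with p
    split <;> rfl
  · obtain ⟨P, hP⟩ := hn.size_le
    refine ⟨4 * P + 1, fun i j _ => (encBits_size_le _).trans ?_⟩
    have := hP i
    rw [CTECS.unary_size] at this
    simp only [Polynomial.eval_add, Polynomial.eval_mul, Polynomial.eval_one,
      Polynomial.eval_ofNat]
    omega

variable {n : ι → ℕ+} {S L T R J h : ℕ+ → ℕ}
  {row : (n : ℕ+) → Fin n → Fin (S n) → Bits n → Bits n}
  {val : (n : ℕ+) → Fin n → Fin (S n) → Bits n → GaussianInt}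
  {amp : (n : ℕ+) → Bits n → GaussianInt} {sam : (n : ℕ+) → Bits (L n) → Bits n}

/-- The estimates for all lists of at most `l` qubits are computable from the coin tosses. -/
theorem coeffs (l : ℕ) (hR : ∀ n, T n * L n ≤ R n)
    (hS : PolyTimeComputable (fun n : ℕ+ => unary n) (fun n => unary (S n)))
    (hL : PolyTimeComputable (fun n : ℕ+ => unary n) (fun n => unary (L n)))
    (hT : PolyTimeComputable (fun n : ℕ+ => unary n) (fun n => unary (T n)))
    (hJ : PolyTimeComputable (fun n : ℕ+ => unary n) (fun n => encNat (J n)))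
    (hh : PolyTimeComputable (fun n : ℕ+ => unary n) (fun n => unary (h n)))
    (hrow : PolyTimeComputable
      (fun i : (n : ℕ+) × Fin n × Fin (S n) × Bits n =>
        encList [unary i.1, unary i.2.1, unary i.2.2.1, encBits i.2.2.2])
      (fun i => encBits (row i.1 i.2.1 i.2.2.1 i.2.2.2)))
    (hval : PolyTimeComputable
      (fun i : (n : ℕ+) × Fin n × Fin (S n) × Bits n =>
        encList [unary i.1, unary i.2.1, unary i.2.2.1, encBits i.2.2.2])
      (fun i => encGauss (val i.1 i.2.1 i.2.2.1 i.2.2.2)))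
    (hamp : PolyTimeComputable
      (fun i : (n : ℕ+) × Bits n => .cons (unary i.1) (encBits i.2))
      (fun i => encGauss (amp i.1 i.2)))
    (hsam : PolyTimeComputable
      (fun i : (n : ℕ+) × Bits (L n) => .cons (unary i.1) (encBits i.2))
      (fun i => encBits (sam i.1 i.2))) :
    PolyTimeComputable (fun i : (n : ℕ+) × Bits (R n) => .cons (unary i.1) (encBits i.2))
      (fun i => encCoeffs ((CTECS.subs l (i.1 : ℕ) le_rfl).map fun s =>
        (s, sampleSum (row i.1) (val i.1) (amp i.1) (J i.1) (h i.1) (sam i.1)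
          (CTECS.splitCoins (hR i.1) i.2) s))) := by
  let ctx : ((n : ℕ+) × Bits (R n)) → Data := fun i => .cons (unary i.1) (encBits i.2)
  have hn : PolyTimeComputable ctx (fun i => unary i.1) := (refl ctx).head
  have hr : PolyTimeComputable ctx (fun i => encBits i.2) := (refl ctx).tail
  have hsub := subs l (fun i : (n : ℕ+) × Bits (R n) => le_refl (i.1 : ℕ)) hn
  simp only [encCoeffs, List.map_map]
  -- the program only has to work on lists of at most `l` qubits
  let κ : ((n : ℕ+) × Bits (R n)) → Type := fun i => {s : List (Fin i.1) // s.length ≤ l}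
  have hatt : ∀ i : (n : ℕ+) × Bits (R n), ∀ {β : Type} (f : List (Fin i.1) → β),
      (CTECS.subs l (i.1 : ℕ) le_rfl).map f =
        ((CTECS.subs l (i.1 : ℕ) le_rfl).attach.map
          fun s => (⟨s.1, length_le_of_mem_subs s.2⟩ : κ i)).map fun s => f s.1 := by
    intro i β f
    rw [List.map_map]
    conv_lhs => rw [← List.attach_map_subtype_val (CTECS.subs l (i.1 : ℕ) le_rfl), List.map_map]
    rfl
  have hsub' : PolyTimeComputable ctx (fun i => encList
      (((CTECS.subs l (i.1 : ℕ) le_rfl).attach.map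
          fun s => (⟨s.1, length_le_of_mem_subs s.2⟩ : κ i)).map fun s => encQubits s.1)) := by
    simp only [← hatt]
    exact hsub
  simp only [hatt]
  refine map hsub' ?_
  let ctx2 : ((i : (n : ℕ+) × Bits (R n)) × κ i) → Data :=
    fun p => .cons (ctx p.1) (encQubits p.2.1)
  have hn2 : PolyTimeComputable ctx2 (fun p => unary p.1.1) := hn.weak
  have hr2 : PolyTimeComputable ctx2 (fun p => encBits p.1.2) := hr.weak
  have hs2 : PolyTimeComputable ctx2 (fun p => encQubits p.2.1) := var _ _
  refine hs2.pair (int_sum ?_)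
  simp only [List.map_map]
  refine map (ek := fun (p : (i : (n : ℕ+) × Bits (R n)) × κ i) (t : Fin (T p.1.1)) =>
    unary (t : ℕ)) (hn2.trans (hT.reindex _)).finRange ?_
  let ctx3 : ((p : (i : (n : ℕ+) × Bits (R n)) × κ i) × Fin (T p.1.1)) → Data :=
    fun q => .cons (ctx2 q.1) (unary (q.2 : ℕ))
  have hn3 : PolyTimeComputable ctx3 (fun q => unary q.1.1.1) := hn2.weak
  have hr3 : PolyTimeComputable ctx3 (fun q => encBits q.1.1.2) := hr2.weak
  have hs3 : PolyTimeComputable ctx3 (fun q => encQubits q.1.2.1) := hs2.weak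
  have ht3 : PolyTimeComputable ctx3 (fun q => unary (q.2 : ℕ)) := var _ _
  have hω : PolyTimeComputable ctx3
      (fun q => encBits (CTECS.splitCoins (hR q.1.1.1) q.1.1.2 q.2)) :=
    splitCoins (hn3.trans (hL.reindex _)) hr3 ht3
  have hx : PolyTimeComputable ctx3
      (fun q => encBits (sam q.1.1.1 (CTECS.splitCoins (hR q.1.1.1) q.1.1.2 q.2))) :=
    (hn3.pair hω).trans (hsam.reindex
      fun q : (p : (i : (n : ℕ+) × Bits (R n)) × κ i) × Fin (T p.1.1) =>
        ⟨q.1.1.1, CTECS.splitCoins (hR q.1.1.1) q.1.1.2 q.2⟩)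
  exact walkSum l hS hJ hh hrow hval hamp (fun q => q.1.2.2) hn3 hx hs3

end PolyTimeComputable

/-! ### Fair coins and finite averages -/

theorem coins_map_apply {R n : ℕ} (S : Bits R → Bits n) (x : Bits n) :
    ((coins R).map S x).toReal = 𝔼 r : Bits R, if S r = x then (1 : ℝ) else 0 := by
  rw [PMF.map_apply, tsum_fintype, ENNReal.toReal_sum (by
    intro r _; split <;> simp [coins, PMF.uniformOfFintype_apply]),
    Fintype.expect_eq_sum_div_card, Finset.sum_div]
  refine Finset.sum_congr rfl fun r _ => ?_
  by_cases h : S r = x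
  · simp [h, coins, PMF.uniformOfFintype_apply]
  · simp [h, Ne.symm h]

theorem coins_toOuterMeasure {R : ℕ} (p : Bits R → Prop) [DecidablePred p] :
    ((coins R).toOuterMeasure {r | p r}).toReal = 𝔼 r : Bits R, if p r then (1 : ℝ) else 0 := by
  rw [coins, PMF.toOuterMeasure_uniformOfFintype_apply, Fintype.expect_eq_sum_div_card,
    Finset.sum_boole, Fintype.card_subtype, ENNReal.toReal_div]
  simp

theorem expect_equiv_prod {α β γ : Type*} [Fintype α] [Fintype β] [Fintype γ] (e : α ≃ β × γ)
    (f : β → γ → ℝ) : 𝔼 a, f (e a).1 (e a).2 = 𝔼 b, 𝔼 c, f b c := by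
  simp only [Fintype.expect_eq_sum_div_card]
  rw [← Finset.sum_div, Fintype.card_congr e, Fintype.card_prod, div_div, Nat.cast_mul,
    mul_comm (Fintype.card γ : ℝ), ← Fintype.sum_prod_type', ← e.sum_comp]

/-- Distinct coins are independent and fair. -/
theorem expect_comp_injective {R : ℕ} {κ : Type*} [Fintype κ] [DecidableEq κ] {e : κ → Fin R}
    (he : Function.Injective e) (f : (κ → Bool) → ℝ) :
    𝔼 r : Bits R, f (fun k => r (e k)) = 𝔼 u, f u := by
  classical
  let E := (Equiv.piEquivPiSubtypeProd (fun i => i ∈ Set.range e) (fun _ : Fin R => Bool)).trans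
    (Equiv.prodCongr (Equiv.arrowCongr (Equiv.ofInjective e he).symm (Equiv.refl Bool))
      (Equiv.refl _))
  have h := expect_equiv_prod E (fun u _ => f u)
  simp only [Fintype.expect_const] at h
  exact h

theorem expect_splitCoins {T L R : ℕ} (h : T * L ≤ R) (f : (Fin T → Bits L) → ℝ) :
    𝔼 r : Bits R, f (splitCoins h r) = 𝔼 ω, f ω := by
  have hlt : ∀ p : Fin T × Fin L, (p.1 : ℕ) * L + p.2 < R := by
    rintro ⟨t, j⟩
    have h1 : (t + 1) * L ≤ T * L := Nat.mul_le_mul_right _ t.2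
    have h2 := j.2
    rw [add_mul, one_mul] at h1
    dsimp only
    omega
  have hinj : Function.Injective (fun p : Fin T × Fin L => (⟨(p.1 : ℕ) * L + p.2, hlt p⟩ : Fin R)) := by
    rintro ⟨t, j⟩ ⟨t', j'⟩ heq
    simp only [Fin.mk.injEq] at heq
    have hL : 0 < L := j.pos
    have h1 : (t * L + j : ℕ) / L = (t' * L + j' : ℕ) / L := by rw [heq]
    have h2 : (t * L + j : ℕ) % L = (t' * L + j' : ℕ) % L := by rw [heq]
    rw [mul_comm, mul_comm (t' : ℕ), Nat.mul_add_div hL, Nat.mul_add_div hL,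
      Nat.div_eq_of_lt j.2, Nat.div_eq_of_lt j'.2] at h1
    rw [mul_comm, mul_comm (t' : ℕ), Nat.mul_add_mod, Nat.mul_add_mod,
      Nat.mod_eq_of_lt j.2, Nat.mod_eq_of_lt j'.2] at h2
    exact Prod.ext (Fin.ext h1) (Fin.ext h2)
  have h1 := expect_comp_injective hinj (fun u => f (fun t j => u (t, j)))
  have h2 := Fintype.expect_equiv (Equiv.curry (Fin T) (Fin L) Bool)
    (fun u => f (fun t j => u (t, j))) f (fun u => rfl)
  exact h1.trans h2

theorem expect_cons {T : ℕ} {W : Type*} [Fintype W] (f : (Fin (T + 1) → W) → ℝ) :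
    𝔼 ω, f ω = 𝔼 w, 𝔼 ω : Fin T → W, f (Fin.cons w ω) := by
  rw [← expect_equiv_prod (Fin.consEquiv fun _ => W).symm fun w ω => f (Fin.cons w ω)]
  refine Finset.expect_congr rfl fun ω _ => ?_
  congr 1
  exact ((Fin.consEquiv fun _ => W).apply_symm_apply ω).symm

/-! ### A concentration inequality -/

theorem expect_prod_pow {T : ℕ} {Ω : Type*} [Fintype Ω] (f : Ω → ℝ) :
    𝔼 ω : Fin T → Ω, ∏ t, f (ω t) = (𝔼 w, f w) ^ T := by
  rw [Fintype.expect_eq_sum_div_card, Fintype.expect_eq_sum_div_card, div_pow, Fintype.sum_pow]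
  simp

theorem expect_exp_le {Ω : Type*} [Fintype Ω] [Nonempty Ω] {g : Ω → ℝ} {B a : ℝ}
    (hg : ∀ w, |g w| ≤ B) (h0 : 𝔼 w, g w = 0) (ha : 0 ≤ a) (haB : a * B ≤ 1) :
    𝔼 w, Real.exp (a * g w) ≤ Real.exp (a ^ 2 * B ^ 2) := by
  have h1 : ∀ w, Real.exp (a * g w) ≤ 1 + a * g w + a ^ 2 * B ^ 2 := by
    intro w
    have h2 : |a * g w| ≤ a * B := by
      rw [abs_mul, abs_of_nonneg ha]
      exact mul_le_mul_of_nonneg_left (hg w) ha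
    have h3 := (abs_le.1 (Real.abs_exp_sub_one_sub_id_le (h2.trans haB))).2
    have h4 : (a * g w) ^ 2 ≤ (a * B) ^ 2 := sq_le_sq' (by linarith [(abs_le.1 h2).1]) (abs_le.1 h2).2
    nlinarith
  calc 𝔼 w, Real.exp (a * g w) ≤ 𝔼 w, (1 + a * g w + a ^ 2 * B ^ 2) :=
        Finset.expect_le_expect fun w _ => h1 w
    _ = 1 + a ^ 2 * B ^ 2 := by
        rw [Finset.expect_add_distrib, Finset.expect_add_distrib, ← Finset.mul_expect, h0]
        simp
    _ ≤ Real.exp (a ^ 2 * B ^ 2) := by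
        have := Real.add_one_le_exp (a ^ 2 * B ^ 2)
        linarith

theorem expect_tail_le {Ω : Type*} [Fintype Ω] [Nonempty Ω] {T : ℕ} {g : Ω → ℝ} {B τ : ℝ}
    (hg : ∀ w, |g w| ≤ B) (h0 : 𝔼 w, g w = 0) (hB : 0 < B) (hτ : 0 ≤ τ) (hτB : τ ≤ 2 * B) :
    (𝔼 ω : Fin T → Ω, if T * τ < ∑ t, g (ω t) then (1 : ℝ) else 0) ≤
      Real.exp (-(T * τ ^ 2 / (4 * B ^ 2))) := by
  set a := τ / (2 * B ^ 2) with ha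
  have ha0 : 0 ≤ a := by positivity
  have haB : a * B ≤ 1 := by
    rw [ha, div_mul_eq_mul_div, div_le_one (by positivity)]
    nlinarith
  calc (𝔼 ω : Fin T → Ω, if T * τ < ∑ t, g (ω t) then (1 : ℝ) else 0)
      ≤ 𝔼 ω : Fin T → Ω, Real.exp (-(a * (T * τ))) * ∏ t, Real.exp (a * g (ω t)) := by
        refine Finset.expect_le_expect fun ω _ => ?_
        rw [← Real.exp_sum, ← Real.exp_add, ← Finset.mul_sum]
        split
        · rename_i h
          exact Real.one_le_exp (by nlinarith)
        · positivity
    _ = Real.exp (-(a * (T * τ))) * (𝔼 w, Real.exp (a * g w)) ^ T := by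
        rw [← Finset.mul_expect, expect_prod_pow fun w => Real.exp (a * g w)]
    _ ≤ Real.exp (-(a * (T * τ))) * Real.exp (a ^ 2 * B ^ 2) ^ T := by
        refine mul_le_mul_of_nonneg_left (pow_le_pow_left₀ ?_ (expect_exp_le hg h0 ha0 haB) T)
          (Real.exp_pos _).le
        exact Finset.expect_nonneg fun w _ => (Real.exp_pos _).le
    _ = Real.exp (-(T * τ ^ 2 / (4 * B ^ 2))) := by
        rw [← Real.exp_nat_mul, ← Real.exp_add]
        congr 1
        rw [ha]
        field_simp
        ring

/-- A Hoeffding-type inequality for the mean of independent samples. -/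
theorem expect_deviation_le {Ω : Type*} [Fintype Ω] [Nonempty Ω] {T : ℕ} {f : Ω → ℝ} {B τ : ℝ}
    (hf : ∀ w, |f w| ≤ B) (hB : 0 < B) (hτ : 0 ≤ τ) (hτB : τ ≤ 4 * B) :
    (𝔼 ω : Fin T → Ω, if T * τ < |∑ t, f (ω t) - T * 𝔼 w, f w| then (1 : ℝ) else 0) ≤
      2 * Real.exp (-(T * τ ^ 2 / (16 * B ^ 2))) := by
  set μ := 𝔼 w, f w with hμ
  have hμB : |μ| ≤ B := by
    refine abs_le.2 ⟨?_, ?_⟩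
    · have := Finset.expect_le_expect (s := Finset.univ) (f := fun _ : Ω => -B) (g := f)
        fun w _ => (abs_le.1 (hf w)).1
      simpa using this
    · have := Finset.expect_le_expect (s := Finset.univ) (f := f) (g := fun _ : Ω => B)
        fun w _ => (abs_le.1 (hf w)).2
      simpa using this
  have hg : ∀ w, |f w - μ| ≤ 2 * B := fun w =>
    (abs_sub _ _).trans (by linarith [hf w])
  have hg' : ∀ w, |μ - f w| ≤ 2 * B := fun w => by rw [abs_sub_comm]; exact hg w
  have h0 : 𝔼 w, (f w - μ) = 0 := by rw [Finset.expect_sub_distrib]; simp [hμ]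
  have h0' : 𝔼 w, (μ - f w) = 0 := by rw [Finset.expect_sub_distrib]; simp [hμ]
  have h1 := expect_tail_le (T := T) hg h0 (by positivity) hτ (by linarith)
  have h2 := expect_tail_le (T := T) hg' h0' (by positivity) hτ (by linarith)
  have he : 4 * (2 * B) ^ 2 = 16 * B ^ 2 := by ring
  rw [he] at h1 h2
  calc _ ≤ 𝔼 ω : Fin T → Ω, ((if T * τ < ∑ t, (f (ω t) - μ) then (1 : ℝ) else 0) +
        if T * τ < ∑ t, (μ - f (ω t)) then (1 : ℝ) else 0) := by
        refine Finset.expect_le_expect fun ω _ => ?_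
        simp only [Finset.sum_sub_distrib, Finset.sum_const, Finset.card_univ, Fintype.card_fin,
          nsmul_eq_mul]
        split
        · rename_i h
          rcases lt_abs.1 h with h | h
          · rw [if_pos h]; split <;> norm_num
          · rw [neg_sub] at h; rw [if_pos h]; split <;> norm_num
        · split <;> split <;> norm_num
    _ ≤ _ := by rw [Finset.expect_add_distrib]; linarith

/-! ### Rejection sampling -/

/-- The distribution after `T` trials of rejection sampling approaches the law of an accepted
candidate geometrically: a further trial multiplies the distance by the probability of rejection. -/
theorem rejection_law {W X : Type*} [Fintype W] [Nonempty W] [Fintype X] [DecidableEq X]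
    (acc : W → Bool) (out : W → X) (x0 : X) (T : ℕ) {p : X → ℝ} {a : ℝ} (ha : 0 < a)
    (hp : ∀ x, p x = 𝔼 w, if acc w ∧ out w = x then (1 : ℝ) else 0)
    (hpa : ∑ x, p x = a) :
    ∑ x, |(𝔼 ω : Fin T → W,
      if (List.ofFn ω).foldr (fun w y => if acc w then out w else y) x0 = x then (1 : ℝ) else 0)
        - p x / a| ≤ 2 * (1 - a) ^ T := by
  have hp0 : ∀ x, 0 ≤ p x := fun x => by
    rw [hp]; exact Finset.expect_nonneg fun w _ => by split <;> norm_num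
  have hrej : 𝔼 w, (if acc w then (0 : ℝ) else 1) = 1 - a := by
    rw [← hpa]
    simp only [hp]
    rw [← Finset.expect_sum_comm, eq_sub_iff_add_eq, ← Finset.expect_add_distrib]
    have : ∀ w, ((if acc w then (0 : ℝ) else 1) +
        ∑ x, if acc w ∧ out w = x then (1 : ℝ) else 0) = 1 := by
      intro w
      cases acc w <;> simp
    rw [Finset.expect_congr rfl fun w _ => this w]
    simp
  have ha1 : 0 ≤ 1 - a := by
    rw [← hrej]; exact Finset.expect_nonneg fun w _ => by split <;> norm_num
  induction T with
  | zero =>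
    simp only [List.ofFn_zero, List.foldr_nil, pow_zero, mul_one]
    calc _ ≤ ∑ x, ((if x0 = x then (1 : ℝ) else 0) + p x / a) := by
          refine Finset.sum_le_sum fun x _ => ?_
          rw [Fintype.expect_const]
          have := div_nonneg (hp0 x) ha.le
          split <;> rw [abs_le] <;> constructor <;> linarith
      _ = 2 := by
          rw [Finset.sum_add_distrib, ← Finset.sum_div, hpa, div_self ha.ne']
          simp
          norm_num
  | succ T ih =>
    have hstep : ∀ x, (𝔼 ω : Fin (T + 1) → W, if (List.ofFn ω).foldr
        (fun w y => if acc w then out w else y) x0 = x then (1 : ℝ) else 0) =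
        p x + (1 - a) * 𝔼 ω : Fin T → W, if (List.ofFn ω).foldr
          (fun w y => if acc w then out w else y) x0 = x then (1 : ℝ) else 0 := by
      intro x
      rw [expect_cons, hp, ← hrej, Finset.expect_mul, ← Finset.expect_add_distrib]
      refine Finset.expect_congr rfl fun w _ => ?_
      simp only [List.ofFn_succ, Fin.cons_zero, Fin.cons_succ, List.foldr_cons]
      cases acc w
      · simp
      · simp
    calc _ = ∑ x, (1 - a) * |(𝔼 ω : Fin T → W, if (List.ofFn ω).foldr
          (fun w y => if acc w then out w else y) x0 = x then (1 : ℝ) else 0) - p x / a| := by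
          refine Finset.sum_congr rfl fun x _ => ?_
          rw [hstep, ← abs_of_nonneg ha1, ← abs_mul, abs_of_nonneg ha1]
          congr 1
          field_simp
          ring
      _ ≤ 2 * (1 - a) ^ (T + 1) := by
          rw [← Finset.mul_sum, pow_succ]
          nlinarith

theorem ofDigits_ofFn_injective (K : ℕ) :
    Function.Injective fun u : Bits K => ofDigits (List.ofFn u) := by
  have key : ∀ l l' : List Bool, l.length = l'.length → ofDigits l = ofDigits l' → l = l' := by
    intro l
    induction l with
    | nil => intro l' h _; exact (List.eq_nil_of_length_eq_zero h.symm).symm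
    | cons b l ih =>
      intro l' h h'
      cases l' with
      | nil => simp at h
      | cons b' l' =>
        simp only [List.length_cons, Nat.add_right_cancel_iff] at h
        rw [ofDigits_cons, ofDigits_cons, h] at h'
        have h1 := ofDigits_lt l
        have h2 := ofDigits_lt l'
        rw [h] at h1
        cases b <;> cases b' <;> simp at h' ⊢
        · exact ih _ h h'
        · omega
        · omega
        · exact ih _ h h'
  intro u v h
  exact List.ofFn_injective (key _ _ (by simp) h)

theorem expect_threshold_lt {K : ℕ} {g : ℤ} (hg : g ≤ 2 ^ K) :
    (𝔼 u : Bits K, if (ofDigits (List.ofFn u) : ℤ) < g then (1 : ℝ) else 0) =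
      max 0 (g : ℝ) / 2 ^ K := by
  have hbij : Function.Bijective fun u : Bits K =>
      (⟨ofDigits (List.ofFn u), by simpa using ofDigits_lt (List.ofFn u)⟩ : Fin (2 ^ K)) := by
    rw [Fintype.bijective_iff_injective_and_card]
    refine ⟨fun u v h => ofDigits_ofFn_injective K (by simpa using h), by simp⟩
  have h1 := Fintype.expect_equiv (Equiv.ofBijective _ hbij)
    (fun u => if (ofDigits (List.ofFn u) : ℤ) < g then (1 : ℝ) else 0)
    (fun i => if ((i : ℕ) : ℤ) < g then (1 : ℝ) else 0) (fun u => rfl)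
  rw [h1, Fintype.expect_eq_sum_div_card, Fintype.card_fin, Finset.sum_boole]
  push_cast
  congr 1
  have h2 : (Finset.univ.filter fun i : Fin (2 ^ K) => ((i : ℕ) : ℤ) < g).card = g.toNat := by
    have h4 : g.toNat ≤ 2 ^ K := Int.toNat_le.2 (by push_cast; exact hg)
    have h3 : (Finset.univ.filter fun i : Fin (2 ^ K) => ((i : ℕ) : ℤ) < g) =
        Finset.univ.filter fun i : Fin (2 ^ K) => (i : ℕ) < g.toNat := by
      ext i; simp only [Finset.mem_filter, Finset.mem_univ, true_and]; omega
    rw [h3, Fin.card_filter_val_lt, min_eq_right h4]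
  rw [h2]
  rcases le_total 0 g with h | h
  · rw [max_eq_right (by exact_mod_cast h)]
    exact_mod_cast Int.toNat_of_nonneg h
  · rw [max_eq_left (by exact_mod_cast h), Int.toNat_of_nonpos h]
    simp

/-- The probability that a trial proposes `x` and accepts it. -/
theorem expect_accepts {n K : ℕ} (c : List (List (Fin n) × ℤ)) (x : Bits n)
    (hg : walshSum c x ≤ 2 ^ K) :
    (𝔼 w : Bits (n + K), if accepts c w ∧ candidate w = x then (1 : ℝ) else 0) =
      max 0 (walshSum c x : ℝ) / (2 ^ n * 2 ^ K) := by
  have h1 := expect_equiv_prod (Fin.appendEquiv (α := Bool) n K).symm fun y u =>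
    if (ofDigits (List.ofFn u) : ℤ) < walshSum c y ∧ y = x then (1 : ℝ) else 0
  have h2 : ∀ w : Bits (n + K), ((Fin.appendEquiv (α := Bool) n K).symm w) =
      (candidate w, fun j => w (Fin.natAdd n j)) := fun w => rfl
  simp only [h2] at h1
  have h3 : ∀ w : Bits (n + K), (accepts c w = true ∧ candidate w = x) ↔
      ((ofDigits (List.ofFn fun j => w (Fin.natAdd n j)) : ℤ) < walshSum c (candidate w) ∧
        candidate w = x) := by
    intro w
    rw [accepts, decide_eq_true_eq, threshold]
  simp only [h3]
  rw [h1]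
  have h4 : ∀ y : Bits n, (𝔼 u : Bits K, if (ofDigits (List.ofFn u) : ℤ) < walshSum c y ∧ y = x
      then (1 : ℝ) else 0) = if y = x then max 0 (walshSum c x : ℝ) / 2 ^ K else 0 := by
    intro y
    by_cases h : y = x
    · subst h
      simp only [and_true, if_true]
      exact expect_threshold_lt hg
    · simp [h]
  simp only [h4]
  rw [Fintype.expect_eq_sum_div_card]
  simp
  field_simp

/-! ### Walsh expansion -/

/-- The sign `(-1)ᵇ`. -/
def sgn (b : Bool) : ℝ := if b then -1 else 1

/-- The character `(-1)^(s·x)` of `x`, where `s` is a set of positions. -/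
def walsh {n : ℕ} (s : Finset (Fin n)) (x : Bits n) : ℝ := ∏ j ∈ s, sgn (x j)

/-- The Walsh coefficient `∑ₓ p(x) (-1)^(s·x)`. -/
def walshCoeff {n : ℕ} (p : Bits n → ℝ) (s : Finset (Fin n)) : ℝ := ∑ x, p x * walsh s x

theorem abs_walsh {n : ℕ} (s : Finset (Fin n)) (x : Bits n) : |walsh s x| = 1 := by
  rw [walsh, Finset.abs_prod]
  refine Finset.prod_eq_one fun j _ => ?_
  unfold sgn
  split <;> simp

theorem sum_walsh_mul_walsh {n : ℕ} (s t : Finset (Fin n)) :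
    ∑ x, walsh s x * walsh t x = if s = t then 2 ^ n else 0 := by
  classical
  have h1 : ∀ x : Bits n, walsh s x * walsh t x =
      ∏ j, (if j ∈ s then sgn (x j) else 1) * (if j ∈ t then sgn (x j) else 1) := by
    intro x
    rw [Finset.prod_mul_distrib, Finset.prod_ite_mem, Finset.prod_ite_mem]
    simp [walsh]
  simp only [h1]
  have h2 := Finset.prod_univ_sum (fun _ : Fin n => (Finset.univ : Finset Bool))
    (fun j b => (if j ∈ s then sgn b else 1) * (if j ∈ t then sgn b else 1))
  rw [Fintype.piFinset_univ] at h2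
  rw [← h2]
  have h3 : ∀ j, ∑ b, (if j ∈ s then sgn b else 1) * (if j ∈ t then sgn b else 1) =
      if (j ∈ s ↔ j ∈ t) then (2 : ℝ) else 0 := by
    intro j
    by_cases hs : j ∈ s <;> by_cases ht : j ∈ t <;> norm_num [hs, ht, sgn]
  simp only [h3]
  by_cases hst : s = t
  · subst hst; simp
  · rw [if_neg hst]
    obtain ⟨j, hj⟩ : ∃ j, ¬ (j ∈ s ↔ j ∈ t) := by
      by_contra hcon
      push Not at hcon
      exact hst (Finset.ext hcon)
    exact Finset.prod_eq_zero (Finset.mem_univ j) (if_neg hj)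

theorem sum_walsh_walsh {n : ℕ} (x y : Bits n) :
    ∑ s, walsh s x * walsh s y = if x = y then 2 ^ n else 0 := by
  classical
  simp only [walsh, ← Finset.prod_mul_distrib]
  have h := Finset.prod_one_add (f := fun j => sgn (x j) * sgn (y j)) Finset.univ
  rw [Finset.powerset_univ] at h
  rw [← h]
  have h3 : ∀ j, 1 + sgn (x j) * sgn (y j) = if x j = y j then (2 : ℝ) else 0 := by
    intro j
    cases x j <;> cases y j <;> norm_num [sgn]
  simp only [h3]
  by_cases hxy : x = y
  · subst hxy; simp
  · rw [if_neg hxy]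
    obtain ⟨j, hj⟩ := Function.ne_iff.1 hxy
    exact Finset.prod_eq_zero (Finset.mem_univ j) (if_neg hj)

theorem walsh_inversion {n : ℕ} (p : Bits n → ℝ) (x : Bits n) :
    p x = (∑ s, walshCoeff p s * walsh s x) / 2 ^ n := by
  simp only [walshCoeff, Finset.sum_mul]
  rw [Finset.sum_comm]
  simp only [mul_assoc, ← Finset.mul_sum, sum_walsh_walsh]
  simp

theorem sum_walshCoeff_sq {n : ℕ} (p : Bits n → ℝ) :
    ∑ s, walshCoeff p s ^ 2 = 2 ^ n * ∑ x, p x ^ 2 := by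
  have h : ∀ s, walshCoeff p s ^ 2 = ∑ x, ∑ y, p x * p y * (walsh s x * walsh s y) := by
    intro s
    rw [sq, walshCoeff, Finset.sum_mul_sum]
    exact Finset.sum_congr rfl fun x _ => Finset.sum_congr rfl fun y _ => by ring
  simp only [h]
  rw [Finset.sum_comm, Finset.mul_sum]
  refine Finset.sum_congr rfl fun x _ => ?_
  rw [Finset.sum_comm]
  simp only [← Finset.mul_sum, sum_walsh_walsh]
  simp
  ring

theorem sum_sq_walsh {n : ℕ} (c : Finset (Fin n) → ℝ) :
    ∑ x, (∑ s, c s * walsh s x) ^ 2 = 2 ^ n * ∑ s, c s ^ 2 := by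
  have h : ∀ x, (∑ s, c s * walsh s x) ^ 2 =
      ∑ s, ∑ t, c s * c t * (walsh s x * walsh t x) := by
    intro x
    rw [sq, Finset.sum_mul_sum]
    exact Finset.sum_congr rfl fun x _ => Finset.sum_congr rfl fun y _ => by ring
  simp only [h]
  rw [Finset.sum_comm, Finset.mul_sum]
  refine Finset.sum_congr rfl fun s _ => ?_
  rw [Finset.sum_comm]
  simp only [← Finset.mul_sum, sum_walsh_mul_walsh]
  simp
  ring

/-- The `l₁` norm of a function is at most the `l₂` norm of its Walsh coefficients. -/
theorem l1_walsh_le {n : ℕ} (c : Finset (Fin n) → ℝ) :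
    ∑ x, |(∑ s, c s * walsh s x) / 2 ^ n| ≤ √(∑ s, c s ^ 2) := by
  refine Real.le_sqrt_of_sq_le ?_
  have h1 := Finset.sum_mul_sq_le_sq_mul_sq Finset.univ (fun _ : Bits n => (1 : ℝ))
    (fun x => |(∑ s, c s * walsh s x) / 2 ^ n|)
  simp only [one_mul, one_pow, Finset.sum_const, Finset.card_univ, Fintype.card_pi,
    Fintype.card_bool, Finset.prod_const, Fintype.card_fin, nsmul_eq_mul, sq_abs, div_pow,
    mul_one] at h1
  refine h1.trans (le_of_eq ?_)
  rw [← Finset.sum_div, sum_sq_walsh]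
  push_cast
  field_simp

/-! ### Depolarizing noise damps the Walsh coefficients -/

theorem sum_walsh_update {n : ℕ} (s : Finset (Fin n)) (x : Bits n) (j : Fin n) :
    ∑ b, walsh s (Function.update x j b) = if j ∈ s then 0 else 2 * walsh s x := by
  have h : ∀ b, j ∈ s → walsh s (Function.update x j b) = sgn b * ∏ k ∈ s.erase j, sgn (x k) := by
    intro b hj
    rw [walsh, ← Finset.mul_prod_erase _ _ hj, Function.update_self]
    congr 1
    refine Finset.prod_congr rfl fun k hk => ?_
    rw [Function.update_of_ne (Finset.ne_of_mem_erase hk)]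
  by_cases hj : j ∈ s
  · rw [if_pos hj, Fintype.sum_bool, h _ hj, h _ hj]
    simp [sgn]
  · rw [if_neg hj]
    have h' : ∀ b, walsh s (Function.update x j b) = walsh s x := by
      intro b
      refine Finset.prod_congr rfl fun k hk => ?_
      rw [Function.update_of_ne (by rintro rfl; exact hj hk)]
    simp [h']

theorem depolarize_foldl_apply {n : ℕ} (ε : ℝ) (l : List (Fin n)) (ρ : Op n)
    (c : Finset (Fin n) → ℝ) (hρ : ∀ x, ρ x x = ((∑ s, c s * walsh s x : ℝ) : ℂ)) (x : Bits n) :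
    (l.foldl (fun ρ j => depolarize ε j ρ) ρ) x x =
      ((∑ s, (l.map fun j => if j ∈ s then 1 - ε else 1).prod * c s * walsh s x : ℝ) : ℂ) := by
  induction l generalizing ρ c with
  | nil => simpa using hρ x
  | cons j l ih =>
    rw [List.foldl_cons, ih (depolarize ε j ρ) (fun s => (if j ∈ s then 1 - ε else 1) * c s)]
    · congr 1
      refine Finset.sum_congr rfl fun s _ => ?_
      rw [List.map_cons, List.prod_cons]
      ring
    · intro y
      simp only [depolarize, mixQubit, Matrix.add_apply, Matrix.smul_apply, Matrix.of_apply,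
        if_true, smul_eq_mul, hρ]
      rw [← Complex.ofReal_sum, Finset.sum_comm]
      simp only [← Finset.mul_sum, sum_walsh_update]
      push_cast
      rw [Finset.mul_sum, Finset.mul_sum, Finset.mul_sum, ← Finset.sum_add_distrib]
      refine Finset.sum_congr rfl fun s _ => ?_
      split
      · push_cast; ring
      · push_cast; ring

theorem noisyDist_eq {n : ℕ} (C : Circuit n) (ε : ℝ) (x : Bits n) :
    C.noisyDist ε x =
      (∑ s, (1 - ε) ^ s.card * walshCoeff C.outputDist s * walsh s x) / 2 ^ n := by
  rw [Circuit.noisyDist, Circuit.noisyState,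
    depolarize_foldl_apply ε _ _ (fun s => walshCoeff C.outputDist s / 2 ^ n), Complex.ofReal_re,
    Finset.sum_div]
  · refine Finset.sum_congr rfl fun s _ => ?_
    have : ((List.finRange n).map fun j => if j ∈ s then 1 - ε else 1).prod = (1 - ε) ^ s.card := by
      rw [← List.ofFn_eq_map, List.prod_ofFn, Finset.prod_ite_mem]
      simp
    rw [this]
    ring
  · intro y
    have h := walsh_inversion C.outputDist y
    rw [Finset.sum_div] at h
    have h2 : ∀ s, walshCoeff C.outputDist s / 2 ^ n * walsh s y =
        walshCoeff C.outputDist s * walsh s y / 2 ^ n := fun s => by ring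
    simp only [h2]
    rw [← h, Circuit.outputDist, Matrix.vecMulVec_apply, Pi.star_apply, RCLike.star_def,
      Complex.mul_conj, Complex.normSq_eq_norm_sq]

/-! ### Low-weight sets of qubits -/

theorem subs_pairwise {n l m : ℕ} {h : m ≤ n} {s : List (Fin n)} (hs : s ∈ subs l m h) :
    s.Nodup ∧ ∀ j ∈ s, (j : ℕ) < m := by
  induction l generalizing m s with
  | zero => simp_all [subs]
  | succ l ih =>
    simp only [subs, List.mem_cons, List.mem_flatMap, List.mem_map] at hs
    rcases hs with rfl | ⟨j, -, s', hs', rfl⟩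
    · simp
    · obtain ⟨h1, h2⟩ := ih hs'
      refine ⟨List.nodup_cons.2 ⟨fun hj => ?_, h1⟩, ?_⟩
      · exact absurd (h2 _ hj) (by simp)
      · intro k hk
        rcases List.mem_cons.1 hk with rfl | hk
        · exact j.2
        · exact (h2 k hk).trans j.2

theorem subs_length_le {n l m : ℕ} (h : m ≤ n) :
    (subs l m h).length ≤ (m + 1) ^ l := by
  induction l generalizing m with
  | zero => simp [subs]
  | succ l ih =>
    simp only [subs, List.length_cons, List.length_flatMap, List.length_map]
    have h1 : ((List.finRange m).map fun j : Fin m =>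
        (subs l (j : ℕ) (j.2.le.trans h)).length).sum ≤ m * (m + 1) ^ l := by
      refine (List.sum_le_card_nsmul _ ((m + 1) ^ l) ?_).trans (by simp)
      intro a ha
      obtain ⟨j, -, rfl⟩ := List.mem_map.1 ha
      exact (ih _).trans (Nat.pow_le_pow_left (by omega) _)
    have h2 : 0 < (m + 1) ^ l := by positivity
    rw [pow_succ]
    have h3 : (m + 1) ^ l * (m + 1) = m * (m + 1) ^ l + (m + 1) ^ l := by ring
    omega

theorem sum_subs_aux {n : ℕ} (l m : ℕ) (h : m ≤ n) (F : Finset (Fin n) → ℝ) :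
    ((subs l m h).map fun s => F s.toFinset).sum =
      ∑ S ∈ Finset.univ.filter (fun S : Finset (Fin n) => (∀ j ∈ S, (j : ℕ) < m) ∧ S.card ≤ l),
        F S := by
  classical
  induction l generalizing m F with
  | zero =>
    have : (Finset.univ.filter fun S : Finset (Fin n) => (∀ j ∈ S, (j : ℕ) < m) ∧ S.card ≤ 0) =
        {∅} := by
      ext S
      simp only [Finset.mem_filter, Finset.mem_univ, true_and, Nat.le_zero, Finset.card_eq_zero,
        Finset.mem_singleton]
      refine ⟨fun h => h.2, ?_⟩
      rintro rfl
      simp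
    rw [this]
    simp [subs]
  | succ l ihl =>
    induction m with
    | zero =>
      have : (Finset.univ.filter fun S : Finset (Fin n) => (∀ j ∈ S, (j : ℕ) < 0) ∧
          S.card ≤ l + 1) = {∅} := by
        ext S
        simp only [Finset.mem_filter, Finset.mem_univ, true_and, Finset.mem_singleton]
        refine ⟨fun h => Finset.eq_empty_of_forall_notMem fun j hj => absurd (h.1 j hj) (by simp), ?_⟩
        rintro rfl
        simp
      rw [this]
      simp [subs]
    | succ m ihm =>
      have hm : m < n := h
      have h1 : ((subs (l + 1) (m + 1) h).map fun s => F s.toFinset).sum =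
          ((subs (l + 1) m hm.le).map fun s => F s.toFinset).sum +
            ((subs l m hm.le).map fun s => F (insert ⟨m, hm⟩ s.toFinset)).sum := by
        simp only [subs, List.map_cons, List.sum_cons, List.finRange_succ_last, List.flatMap_append,
          List.map_append, List.sum_append, List.flatMap_map, List.flatMap_singleton,
          List.map_map, Function.comp_def, List.toFinset_cons]
        rw [add_assoc]
        rfl
      rw [h1, ihm hm.le, ihl m hm.le fun S => F (insert ⟨m, hm⟩ S)]
      have hnot : ∀ S : Finset (Fin n), (∀ j ∈ S, (j : ℕ) < m) → (⟨m, hm⟩ : Fin n) ∉ S :=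
        fun S hS hmem => absurd (hS _ hmem) (by simp)
      have hinj : Set.InjOn (fun S : Finset (Fin n) => insert (⟨m, hm⟩ : Fin n) S)
          (Finset.univ.filter fun S : Finset (Fin n) => (∀ j ∈ S, (j : ℕ) < m) ∧ S.card ≤ l) := by
        intro S hS T hT hST
        simp only [Finset.coe_filter, Finset.mem_univ, true_and, Set.mem_ofPred_eq] at hS hT
        have := congrArg (fun U => Finset.erase U (⟨m, hm⟩ : Fin n)) hST
        simpa [Finset.erase_insert (hnot _ hS.1), Finset.erase_insert (hnot _ hT.1)] using this
      rw [← Finset.sum_image hinj (f := F), ← Finset.sum_union]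
      · refine Finset.sum_congr ?_ fun _ _ => rfl
        ext S
        simp only [Finset.mem_union, Finset.mem_filter, Finset.mem_univ, true_and,
          Finset.mem_image]
        constructor
        · rintro (⟨hS, hc⟩ | ⟨T, ⟨hT, hc⟩, rfl⟩)
          · exact ⟨fun j hj => (hS j hj).trans (by omega), hc⟩
          · refine ⟨fun j hj => ?_, ?_⟩
            · rcases Finset.mem_insert.1 hj with rfl | hj
              · simp
              · exact (hT j hj).trans (by omega)
            · rw [Finset.card_insert_of_notMem (hnot T hT)]; omega
        · rintro ⟨hS, hc⟩
          by_cases hmem : (⟨m, hm⟩ : Fin n) ∈ S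
          · right
            refine ⟨S.erase ⟨m, hm⟩, ⟨fun j hj => ?_, ?_⟩, Finset.insert_erase hmem⟩
            · have h3 := hS j (Finset.mem_of_mem_erase hj)
              have h4 := Finset.ne_of_mem_erase hj
              have h5 : (j : ℕ) ≠ m := fun h => h4 (Fin.ext h)
              omega
            · rw [Finset.card_erase_of_mem hmem]; omega
          · left
            refine ⟨fun j hj => ?_, hc⟩
            have h3 := hS j hj
            have h5 : (j : ℕ) ≠ m := fun h => hmem (by convert hj; exact h.symm)
            omega
      · rw [Finset.disjoint_left]
        intro S hS hS'
        simp only [Finset.mem_filter, Finset.mem_univ, true_and, Finset.mem_image] at hS hS'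
        obtain ⟨T, -, rfl⟩ := hS'
        exact hnot _ hS.1 (Finset.mem_insert_self _ _)

theorem sum_subs {n : ℕ} (l : ℕ) (F : Finset (Fin n) → ℝ) :
    ((subs l n le_rfl).map fun s => F s.toFinset).sum =
      ∑ S ∈ Finset.univ.filter (fun S : Finset (Fin n) => S.card ≤ l), F S := by
  rw [sum_subs_aux]
  refine Finset.sum_congr ?_ fun _ _ => rfl
  ext S
  simp

theorem sgn_parity {n : ℕ} {s : List (Fin n)} (hs : s.Nodup) (x : Bits n) :
    sgn (parity s x) = walsh s.toFinset x := by
  have h : ∀ (l : List (Fin n)) (b : Bool), sgn (l.foldl (fun b j => b ^^ x j) b) =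
      sgn b * (l.map fun j => sgn (x j)).prod := by
    intro l
    induction l with
    | nil => simp
    | cons j l ih =>
      intro b
      rw [List.foldl_cons, ih, List.map_cons, List.prod_cons, ← mul_assoc]
      congr 1
      cases b <;> cases x j <;> simp [sgn]
  rw [parity, h, walsh, List.prod_toFinset _ hs]
  simp [sgn]

/-! ### Unitarity of circuits -/

theorem onQubit_mul {n : ℕ} (j : Fin n) (M N : Matrix Bool Bool ℂ) :
    onQubit j (M * N) = onQubit j M * onQubit j N := by
  ext x y
  rw [Matrix.mul_apply]
  have h := Finset.sum_of_injOn (s := Finset.univ) (t := Finset.univ)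
    (f := fun b : Bool => onQubit j M x (Function.update x j b) *
      onQubit j N (Function.update x j b) y)
    (g := fun z => onQubit j M x z * onQubit j N z y) (fun b => Function.update x j b)
    (fun b _ b' _ h => by simpa using congrFun h j) (fun _ _ => by simp) ?_ (fun _ _ => rfl)
  · rw [← h]
    simp only [onQubit, Matrix.of_apply, Function.update_self, Matrix.mul_apply]
    have h1 : ∀ b, ∀ k, k ≠ j → x k = Function.update x j b k := fun b k hk => by
      rw [Function.update_of_ne hk]
    have h2 : ∀ b, (∀ k, k ≠ j → Function.update x j b k = y k) ↔ ∀ k, k ≠ j → x k = y k :=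
      fun b => forall₂_congr fun k hk => by rw [Function.update_of_ne hk]
    simp only [h2]
    by_cases hxy : ∀ k, k ≠ j → x k = y k
    · rw [if_pos hxy]
      refine Finset.sum_congr rfl fun b _ => ?_
      rw [if_pos (h1 b), if_pos hxy]
    · simp [hxy]
  · intro z _ hz
    have : ¬ ∀ k, k ≠ j → x k = z k := by
      intro hk
      refine hz ⟨z j, by simp, ?_⟩
      ext k
      by_cases hkj : k = j
      · subst hkj; simp
      · simp [Function.update_of_ne hkj, hk k hkj]
    simp [onQubit, this]

theorem onQubit_one {n : ℕ} (j : Fin n) : onQubit j (1 : Matrix Bool Bool ℂ) = 1 := by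
  ext x y
  simp only [onQubit, Matrix.of_apply, Matrix.one_apply]
  by_cases h : x = y
  · subst h; simp
  · rw [if_neg h]
    split
    · rename_i hk
      refine if_neg fun hj => h (funext fun k => ?_)
      by_cases hkj : k = j
      · rw [hkj, hj]
      · exact hk k hkj
    · rfl

theorem onQubit_conjTranspose {n : ℕ} (j : Fin n) (M : Matrix Bool Bool ℂ) :
    (onQubit j M)ᴴ = onQubit j Mᴴ := by
  ext x y
  simp only [onQubit, Matrix.conjTranspose_apply, Matrix.of_apply]
  have : (∀ k, k ≠ j → y k = x k) ↔ ∀ k, k ≠ j → x k = y k :=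
    forall₂_congr fun k _ => eq_comm
  simp only [this]
  split <;> simp

theorem onQubit_unitary {n : ℕ} (j : Fin n) {M : Matrix Bool Bool ℂ} (hM : M * Mᴴ = 1) :
    onQubit j M * (onQubit j M)ᴴ = 1 := by
  rw [onQubit_conjTranspose, ← onQubit_mul, hM, onQubit_one]

theorem rotX_unitary (θ : ℝ) : rotX θ * (rotX θ)ᴴ = 1 := by
  have h : (Real.cos (θ / 2) : ℂ) ^ 2 + (Real.sin (θ / 2) : ℂ) ^ 2 = 1 := by
    exact_mod_cast Real.cos_sq_add_sin_sq (θ / 2)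
  simp only [rotX]
  generalize Real.cos (θ / 2) = c at h ⊢
  generalize Real.sin (θ / 2) = d at h ⊢
  ext a b
  rw [Matrix.mul_apply, Fintype.sum_bool]
  cases a <;> cases b <;>
    simp only [pauliX, Matrix.sub_apply, Matrix.smul_apply, Matrix.one_apply,
      Matrix.of_apply, Matrix.conjTranspose_apply, smul_eq_mul, star_sub, star_mul',
      RCLike.star_def, Complex.conj_ofReal, Complex.conj_I] <;>
    simp only [reduceCtorEq, if_true, if_false, map_one, map_zero] <;>
    ring_nf <;> simp only [Complex.I_sq] <;> linear_combination h

theorem rotZ_unitary (θ : ℝ) : rotZ θ * (rotZ θ)ᴴ = 1 := by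
  have h : (Real.cos (θ / 2) : ℂ) ^ 2 + (Real.sin (θ / 2) : ℂ) ^ 2 = 1 := by
    exact_mod_cast Real.cos_sq_add_sin_sq (θ / 2)
  simp only [rotZ]
  generalize Real.cos (θ / 2) = c at h ⊢
  generalize Real.sin (θ / 2) = d at h ⊢
  ext a b
  rw [Matrix.mul_apply, Fintype.sum_bool]
  cases a <;> cases b <;>
    simp only [pauliZ, Matrix.sub_apply, Matrix.smul_apply, Matrix.one_apply,
      Matrix.of_apply, Matrix.conjTranspose_apply, smul_eq_mul, star_sub, star_mul',
      RCLike.star_def, Complex.conj_ofReal, Complex.conj_I] <;>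
    simp only [reduceCtorEq, if_true, if_false, map_one, map_zero, map_neg, Bool.false_eq_true] <;>
    ring_nf <;> simp only [Complex.I_sq] <;> linear_combination h

theorem Gate.matrix_unitary {n : ℕ} (g : Gate n) : g.matrix * g.matrixᴴ = 1 := by
  cases g with
  | rx j neg t => exact onQubit_unitary j (rotX_unitary _)
  | rz j neg t => exact onQubit_unitary j (rotZ_unitary _)
  | cz i j hij =>
    rw [Gate.matrix, controlledZ, Matrix.diagonal_conjTranspose, Matrix.diagonal_mul_diagonal,
      ← Matrix.diagonal_one]
    congr 1
    ext x
    simp only [Pi.star_apply]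
    split <;> simp

theorem Circuit.matrix_unitary {n : ℕ} (C : Circuit n) :
    Circuit.matrix C * (Circuit.matrix C)ᴴ = 1 := by
  induction C with
  | nil => simp [Circuit.matrix]
  | cons g C ih =>
    rw [Circuit.matrix, Matrix.conjTranspose_mul, Matrix.mul_assoc, ← Matrix.mul_assoc g.matrix,
      g.matrix_unitary, Matrix.one_mul, ih]

theorem Circuit.matrix_append {n : ℕ} (C D : Circuit n) :
    Circuit.matrix (C ++ D) = Circuit.matrix D * Circuit.matrix C := by
  induction C with
  | nil => simp [Circuit.matrix]
  | cons g C ih => rw [List.cons_append, Circuit.matrix, ih, Circuit.matrix, Matrix.mul_assoc]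

theorem Circuit.state_append {n : ℕ} (C D : Circuit n) :
    Circuit.state (C ++ D) = Circuit.matrix D *ᵥ Circuit.state C := by
  ext x
  rw [Circuit.state, Circuit.matrix_append, Matrix.mul_apply]
  rfl

theorem Circuit.sum_norm_sq_state {n : ℕ} (C : Circuit n) : ∑ x, ‖C.state x‖ ^ 2 = 1 := by
  have hU := mul_eq_one_comm.1 (Circuit.matrix_unitary C)
  have h := congrFun (congrFun hU (zeros n)) (zeros n)
  rw [Matrix.mul_apply, Matrix.one_apply_eq] at h
  have h2 : ∀ x, (Circuit.matrix C)ᴴ (zeros n) x * Circuit.matrix C x (zeros n) =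
      ((‖C.state x‖ ^ 2 : ℝ) : ℂ) := by
    intro x
    rw [Matrix.conjTranspose_apply, RCLike.star_def, mul_comm, Complex.mul_conj,
      Complex.normSq_eq_norm_sq]
    rfl
  simp only [h2] at h
  exact_mod_cast h

/-! ### Walsh coefficients as expectation values -/

/-- The product of the operators `A j` over a list of qubits. -/
def opProd {n : ℕ} (A : Fin n → Op n) : List (Fin n) → Op n
  | [] => 1
  | j :: s => A j * opProd A s

theorem onQubit_pauliZ {n : ℕ} (j : Fin n) :
    onQubit j pauliZ = Matrix.diagonal fun x => ((sgn (x j) : ℝ) : ℂ) := by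
  ext x y
  simp only [onQubit, pauliZ, Matrix.of_apply, Matrix.diagonal_apply]
  by_cases h : x = y
  · subst h
    cases hx : x j <;> simp [sgn]
  · rw [if_neg h]
    split
    · rename_i hk
      refine if_neg fun hj => h (funext fun k => ?_)
      by_cases hkj : k = j
      · rw [hkj, hj]
      · exact hk k hkj
    · rfl

theorem opProd_conj {n : ℕ} {V : Op n} (hV : V * Vᴴ = 1) {s : List (Fin n)} (hs : s.Nodup) :
    opProd (fun j => Vᴴ * onQubit j pauliZ * V) s =
      Vᴴ * Matrix.diagonal (fun x => ((walsh s.toFinset x : ℝ) : ℂ)) * V := by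
  induction s with
  | nil =>
    have : Matrix.diagonal (fun x : Bits n => ((walsh (∅ : Finset (Fin n)) x : ℝ) : ℂ)) = 1 := by
      rw [← Matrix.diagonal_one]; congr 1
    simp only [opProd, List.toFinset_nil, this, Matrix.mul_one]
    exact (mul_eq_one_comm.1 hV).symm
  | cons j s ih =>
    obtain ⟨hj, hs⟩ := List.nodup_cons.1 hs
    rw [opProd, ih hs, onQubit_pauliZ]
    have h1 : ∀ D E : Op n, Vᴴ * D * V * (Vᴴ * E * V) = Vᴴ * (D * E) * V := by
      intro D E
      calc Vᴴ * D * V * (Vᴴ * E * V) = Vᴴ * D * (V * Vᴴ) * E * V := by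
            simp only [Matrix.mul_assoc]
        _ = _ := by rw [hV]; simp only [Matrix.mul_one, Matrix.mul_assoc]
    rw [h1, Matrix.diagonal_mul_diagonal]
    congr 3
    ext x
    rw [List.toFinset_cons, walsh, walsh, Finset.prod_insert (by simpa using hj)]
    push_cast
    rfl

/-- The expectation value `⟨φ|B|φ⟩`. -/
def expVal {n : ℕ} (φ : Bits n → ℂ) (B : Op n) : ℂ := ∑ x, ∑ y, star (φ y) * B y x * φ x

theorem walshCoeff_outputDist {n : ℕ} (U V : Circuit n) (s : Finset (Fin n)) :
    ((walshCoeff (Circuit.outputDist (U ++ V)) s : ℝ) : ℂ) = expVal U.state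
      ((Circuit.matrix V)ᴴ * Matrix.diagonal (fun x => ((walsh s x : ℝ) : ℂ)) * Circuit.matrix V) := by
  have h : ∀ (φ : Bits n → ℂ) (B : Op n), expVal φ B = star φ ⬝ᵥ (B *ᵥ φ) := by
    intro φ B
    simp only [expVal, dotProduct, Matrix.mulVec, Pi.star_apply, Finset.mul_sum]
    rw [Finset.sum_comm]
    simp only [mul_assoc]
  rw [h, ← Matrix.mulVec_mulVec, ← Matrix.mulVec_mulVec, Matrix.dotProduct_mulVec,
    ← Matrix.star_mulVec, ← Circuit.state_append, walshCoeff, dotProduct]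
  push_cast
  refine Finset.sum_congr rfl fun x _ => ?_
  rw [Matrix.mulVec_diagonal, Circuit.outputDist, Pi.star_apply]
  have : star (Circuit.state (U ++ V) x) * Circuit.state (U ++ V) x =
      ((‖Circuit.state (U ++ V) x‖ ^ 2 : ℝ) : ℂ) := by
    rw [RCLike.star_def, mul_comm, Complex.mul_conj, Complex.normSq_eq_norm_sq]
  rw [mul_left_comm, this]
  push_cast
  ring

/-! ### Sparse columns -/

theorem binaryString_injOn (n : ℕ) {i k : ℕ} (hi : i < 2 ^ n) (hk : k < 2 ^ n)
    (h : binaryString n i = binaryString n k) : i = k := by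
  refine Nat.eq_of_testBit_eq fun t => ?_
  rcases lt_or_ge t n with ht | ht
  · have := congrFun h ⟨n - 1 - t, by omega⟩
    simp only [binaryString] at this
    rwa [show n - 1 - (n - 1 - t) = t by omega] at this
  · rw [Nat.testBit_lt_two_pow (hi.trans_le (Nat.pow_le_pow_right (by simp) ht)),
      Nat.testBit_lt_two_pow (hk.trans_le (Nat.pow_le_pow_right (by simp) ht))]

theorem allBits_nodup (n : ℕ) : (allBits n).Nodup := by
  refine List.Nodup.map_on ?_ List.nodup_range
  intro i hi k hk h
  exact binaryString_injOn n (List.mem_range.1 hi) (List.mem_range.1 hk) h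

theorem mem_allBits {n : ℕ} (x : Bits n) : x ∈ allBits n := by
  have h : (allBits n).toFinset = Finset.univ := by
    rw [← Finset.card_eq_iff_eq_univ, List.toFinset_card_of_nodup (allBits_nodup n)]
    simp [allBits]
  rw [← List.mem_toFinset, h]
  exact Finset.mem_univ x

theorem sum_entryVal {n S : ℕ} (A : Op n) (x : Bits n) (hS : (nonzeroRows A x).length ≤ S)
    (f : Bits n → ℂ) :
    ∑ r : Fin S, entryVal A r x * f (entryRow A r x) = ∑ y, A y x * f y := by
  set l := nonzeroRows A x with hl
  have h1 : ∑ y, A y x * f y = (l.map fun y => A y x * f y).sum := by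
    rw [hl, nonzeroRows, ← List.sum_toFinset _ ((allBits_nodup n).filter _)]
    symm
    refine Finset.sum_subset (Finset.subset_univ _) fun y _ hy => ?_
    have : A y x = 0 := by
      by_contra hne
      exact hy (by simp [mem_allBits, hne])
    rw [this, zero_mul]
  have h2 : (l.map fun y => A y x * f y).sum =
      ∑ k ∈ Finset.range l.length, A (l.getD k (zeros n)) x * f (l.getD k (zeros n)) := by
    generalize l = l
    induction l with
    | nil => simp
    | cons a l ih =>
      rw [List.map_cons, List.sum_cons, ih, List.length_cons, Finset.sum_range_succ', add_comm]
      simp only [List.getD_cons_succ, List.getD_cons_zero]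
  rw [h1, h2, Fin.sum_univ_eq_sum_range (fun k => entryVal A k x * f (entryRow A k x)) S]
  symm
  refine Finset.sum_subset_zero_on_sdiff (Finset.range_subset_range.2 hS) ?_ ?_
  · intro k hk
    simp only [Finset.mem_sdiff, Finset.mem_range] at hk
    rw [entryVal, ← hl, if_neg hk.2, zero_mul]
  · intro k hk
    rw [entryVal, ← hl, if_pos (Finset.mem_range.1 hk), entryRow]

/-! ### Accuracy of the estimator -/

theorem length_paths {R : Type} [One R] [Mul R] {n S : ℕ} (row : Fin n → Fin S → Bits n → Bits n)
    (val : Fin n → Fin S → Bits n → R) (x : Bits n) (s : List (Fin n)) :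
    (paths row val x s).length = S ^ s.length := by
  induction s with
  | nil => simp [paths]
  | cons j s ih =>
    simp only [paths, List.length_flatMap, List.length_map, List.length_finRange,
      List.map_const', List.sum_replicate, ih, smul_eq_mul, List.length_cons, pow_succ]

theorem paths_map {R R' : Type} [MulOneClass R] [MulOneClass R'] (f : R →* R') {n S : ℕ}
    (row : Fin n → Fin S → Bits n → Bits n) (val : Fin n → Fin S → Bits n → R) (x : Bits n)
    (s : List (Fin n)) :
    paths row (fun j r y => f (val j r y)) x s =
      (paths row val x s).map fun p => (p.1, f p.2) := by
  induction s with
  | nil => simp [paths]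
  | cons j s ih =>
    simp [paths, ih, List.flatMap_map, List.map_flatMap, Function.comp_def]

/-- Summing over walks multiplies the matrices. -/
theorem sum_paths {n S : ℕ} {row : Fin n → Fin S → Bits n → Bits n}
    {val : Fin n → Fin S → Bits n → ℂ} {A : Fin n → Op n}
    (hA : ∀ j x (f : Bits n → ℂ), ∑ r, val j r x * f (row j r x) = ∑ y, A j y x * f y)
    (x : Bits n) (s : List (Fin n)) (f : Bits n → ℂ) :
    ((paths row val x s).map fun p => p.2 * f p.1).sum = ∑ y, opProd A s y x * f y := by
  induction s generalizing f with
  | nil => simp [paths, opProd, Matrix.one_apply]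
  | cons j s ih =>
    have h1 : ((paths row val x (j :: s)).map fun p => p.2 * f p.1).sum =
        ((paths row val x s).map fun p => p.2 * ∑ y, A j y p.1 * f y).sum := by
      simp only [paths, List.flatMap_def, List.map_flatten, List.sum_flatten, List.map_map,
        Function.comp_def]
      congr 1
      refine List.map_congr_left fun p _ => ?_
      rw [← hA, Finset.mul_sum, ← List.ofFn_eq_map, List.sum_ofFn]
      exact Finset.sum_congr rfl fun r _ => by ring
    rw [h1, ih fun z => ∑ y, A j y z * f y]
    simp only [opProd, Matrix.mul_apply, Finset.mul_sum, Finset.sum_mul]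
    rw [Finset.sum_comm]
    exact Finset.sum_congr rfl fun y _ => Finset.sum_congr rfl fun z _ => by ring

/-- Along every walk, the scaled product of approximate matrix entries stays close to the exact
one. -/
theorem paths_error {n S : ℕ} {row : Fin n → Fin S → Bits n → Bits n}
    {val : Fin n → Fin S → Bits n → GaussianInt} {val' : Fin n → Fin S → Bits n → ℂ} {h : ℕ}
    {η : ℝ} (hη0 : 0 ≤ η) (hη : η ≤ 1) (h1 : ∀ j r y, ‖val' j r y‖ ≤ 1)
    (h2 : ∀ j r y, ‖(val j r y).toComplex / 2 ^ h - val' j r y‖ ≤ η)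
    (x : Bits n) (s : List (Fin n)) :
    ∀ p ∈ paths row (fun j r y => (val j r y, val' j r y)) x s,
      ‖p.2.1.toComplex / 2 ^ (h * s.length) - p.2.2‖ ≤ (2 ^ s.length - 1) * η ∧ ‖p.2.2‖ ≤ 1 := by
  induction s with
  | nil => simp [paths]
  | cons j s ih =>
    intro p hp
    simp only [paths, List.mem_flatMap, List.mem_map] at hp
    obtain ⟨q, hq, r, -, rfl⟩ := hp
    obtain ⟨e1, e2⟩ := ih q hq
    have e3 := h1 j r q.1
    have e4 := h2 j r q.1
    simp only [Prod.fst_mul, Prod.snd_mul, List.length_cons, map_mul]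
    have e5 : ‖val' j r q.1 * q.2.2‖ ≤ 1 := by
      rw [norm_mul]
      exact mul_le_one₀ e3 (norm_nonneg _) e2
    refine ⟨?_, e5⟩
    set a' := (val j r q.1).toComplex / 2 ^ h with ha'
    set z' := q.2.1.toComplex / 2 ^ (h * s.length) with hz'
    have e6 : (val j r q.1).toComplex * q.2.1.toComplex / 2 ^ (h * (s.length + 1)) = a' * z' := by
      rw [ha', hz', mul_add, mul_one, pow_add]
      field_simp
    rw [e6]
    have e7 : a' * z' - val' j r q.1 * q.2.2 =
        (a' - val' j r q.1) * z' + val' j r q.1 * (z' - q.2.2) := by ring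
    have e8 : ‖z'‖ ≤ (2 ^ s.length - 1) * η + 1 := by
      have := norm_add_le (z' - q.2.2) q.2.2
      rw [sub_add_cancel] at this
      linarith
    have e9 : (0 : ℝ) ≤ 2 ^ s.length - 1 := by
      have : (1 : ℝ) ≤ 2 ^ s.length := one_le_pow₀ (by norm_num)
      linarith
    rw [e7]
    refine (norm_add_le _ _).trans ?_
    rw [norm_mul, norm_mul]
    calc _ ≤ η * ((2 ^ s.length - 1) * η + 1) + 1 * ((2 ^ s.length - 1) * η) := by gcongr
      _ ≤ (2 ^ (s.length + 1) - 1) * η := by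
        rw [pow_succ]
        nlinarith [mul_nonneg e9 (mul_nonneg hη0 (sub_nonneg.2 hη))]

/-- The weight with which an entry of the operator enters the estimator. It does not exceed `1` in
absolute value, however small the amplitudes are. -/
noncomputable def walkWeight (X Y : ℂ) : ℂ := 2 * (star Y * X) / ((‖X‖ ^ 2 + ‖Y‖ ^ 2 : ℝ) : ℂ)

theorem norm_walkWeight_le (X Y : ℂ) : ‖walkWeight X Y‖ ≤ 1 := by
  rw [walkWeight, norm_div, norm_mul, norm_mul, norm_star, Complex.norm_real, Real.norm_eq_abs,
    abs_of_nonneg (by positivity)]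
  refine div_le_one_of_le₀ ?_ (by positivity)
  simp only [Complex.norm_ofNat]
  nlinarith [sq_nonneg (‖X‖ - ‖Y‖)]

theorem walkWeight_smul (X Y : ℂ) {c : ℝ} (hc : 0 < c) :
    walkWeight (X / c) (Y / c) = walkWeight X Y := by
  have hc' : (c : ℂ) ≠ 0 := by exact_mod_cast hc.ne'
  rw [walkWeight, walkWeight, norm_div, norm_div, Complex.norm_real, Real.norm_eq_abs,
    abs_of_pos hc, star_div₀, RCLike.star_def, Complex.conj_ofReal]
  have : ((‖X‖ / c) ^ 2 + (‖Y‖ / c) ^ 2 : ℝ) = (‖X‖ ^ 2 + ‖Y‖ ^ 2) / c ^ 2 := by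
    field_simp
  rw [this]
  push_cast
  rcases eq_or_ne ((‖X‖ : ℂ) ^ 2 + (‖Y‖ : ℂ) ^ 2) 0 with h0 | h0
  · simp [h0]
  · field_simp

theorem walkWeight_comm (X Y : ℂ) : walkWeight Y X = star (walkWeight X Y) := by
  simp only [walkWeight, star_div₀, star_mul', star_star]
  have h2 : star (2 : ℂ) = 2 := by simp
  have h3 : ∀ r : ℝ, star (r : ℂ) = r := fun r => Complex.conj_ofReal r
  rw [h2, h3, add_comm, mul_comm (star X)]

theorem normSq_mul_walkWeight (X Y : ℂ) :
    ((‖X‖ ^ 2 + ‖Y‖ ^ 2 : ℝ) : ℂ) * walkWeight X Y = 2 * (star Y * X) := by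
  rw [walkWeight]
  rcases eq_or_ne (‖X‖ ^ 2 + ‖Y‖ ^ 2) 0 with h0 | h0
  · have hX : X = 0 := by
      have : ‖X‖ ^ 2 = 0 := by nlinarith [sq_nonneg ‖X‖, sq_nonneg ‖Y‖]
      simpa using this
    simp [hX]
  · rw [mul_div_cancel₀]
    exact_mod_cast h0

/-- Symmetrization: averaging the weighted entries over `|φ|²` gives the expectation value. -/
theorem sum_normSq_mul_walkWeight {n : ℕ} (φ : Bits n → ℂ) {B : Op n} (hB : B.IsHermitian) :
    ∑ x, ‖φ x‖ ^ 2 * (∑ y, B y x * walkWeight (φ x) (φ y)).re = (expVal φ B).re := by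
  have hsymm : ∀ x y, (B x y * walkWeight (φ y) (φ x)).re = (B y x * walkWeight (φ x) (φ y)).re := by
    intro x y
    rw [walkWeight_comm, ← hB.apply x y, ← star_mul', RCLike.star_def, Complex.conj_re]
  have h1 : ∑ x, ‖φ x‖ ^ 2 * (∑ y, B y x * walkWeight (φ x) (φ y)).re =
      ∑ x, ∑ y, ‖φ x‖ ^ 2 * (B y x * walkWeight (φ x) (φ y)).re := by
    simp only [Complex.re_sum, Finset.mul_sum]
  have h2 : ∑ x, ∑ y, ‖φ x‖ ^ 2 * (B y x * walkWeight (φ x) (φ y)).re =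
      ∑ x, ∑ y, ‖φ y‖ ^ 2 * (B y x * walkWeight (φ x) (φ y)).re := by
    rw [Finset.sum_comm]
    exact Finset.sum_congr rfl fun x _ => Finset.sum_congr rfl fun y _ => by rw [hsymm]
  have h3 : ∑ x, ∑ y, ‖φ x‖ ^ 2 * (B y x * walkWeight (φ x) (φ y)).re +
      ∑ x, ∑ y, ‖φ y‖ ^ 2 * (B y x * walkWeight (φ x) (φ y)).re = 2 * (expVal φ B).re := by
    simp only [← Finset.sum_add_distrib, expVal, Complex.re_sum, Finset.mul_sum]
    refine Finset.sum_congr rfl fun x _ => Finset.sum_congr rfl fun y _ => ?_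
    rw [← add_mul, ← Complex.re_ofReal_mul, mul_left_comm, normSq_mul_walkWeight]
    rw [show B y x * (2 * (star (φ y) * φ x)) = ((2 : ℝ) : ℂ) * (star (φ y) * B y x * φ x) by
      push_cast; ring, Complex.re_ofReal_mul]
  linarith

theorem abs_tdiv_sub_le (a : ℤ) (b : ℕ) : |((a.tdiv b : ℤ) : ℝ) - a / b| ≤ 1 := by
  rcases Nat.eq_zero_or_pos b with rfl | hb
  · simp
  have hb' : (0 : ℝ) < b := by exact_mod_cast hb
  have h1 := Int.tmod_add_mul_tdiv a b
  have h2 : |a.tmod b| < b := by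
    rw [Int.abs_eq_natAbs, Int.natAbs_tmod, Int.natAbs_natCast]
    exact_mod_cast Nat.mod_lt _ hb
  have h3 : ((a.tdiv b : ℤ) : ℝ) - a / b = -((a.tmod b : ℤ) : ℝ) / b := by
    rw [eq_div_iff hb'.ne', sub_mul, div_mul_cancel₀ _ hb'.ne']
    have h4 : ((a.tmod b : ℤ) : ℝ) + b * ((a.tdiv b : ℤ) : ℝ) = a := by exact_mod_cast h1
    linarith
  rw [h3, abs_div, abs_neg, abs_of_pos hb', div_le_one hb']
  exact_mod_cast h2.le

theorem abs_walkTerm_sub_le (J D : ℕ) (X Y z : GaussianInt) :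
    |(walkTerm J D X Y z : ℝ) - J * (z.toComplex / D * walkWeight X.toComplex Y.toComplex).re| ≤
      1 := by
  have hN : ∀ a : GaussianInt, ((a.re * a.re + a.im * a.im).natAbs : ℝ) = ‖a.toComplex‖ ^ 2 := by
    intro a
    have h0 : 0 ≤ a.re * a.re + a.im * a.im := add_nonneg (mul_self_nonneg _) (mul_self_nonneg _)
    have h1 : ((a.re * a.re + a.im * a.im).natAbs : ℤ) = a.re * a.re + a.im * a.im :=
      Int.natAbs_of_nonneg h0
    have h2 : ((a.re * a.re + a.im * a.im).natAbs : ℝ) =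
        ((a.re * a.re + a.im * a.im : ℤ) : ℝ) := by
      rw [← Int.cast_natCast, h1]
    rw [h2, ← Complex.normSq_eq_norm_sq, Complex.normSq_apply, ← GaussianInt.intCast_re,
      ← GaussianInt.intCast_im]
    push_cast
    ring
  have h := abs_tdiv_sub_le (J * (2 * (star Y * z * X).re))
    (D * ((X.re * X.re + X.im * X.im).natAbs + (Y.re * Y.re + Y.im * Y.im).natAbs))
  rw [walkTerm]
  convert h using 3
  push_cast
  rw [hN, hN]
  have hre : (((star Y * z * X).re : ℤ) : ℝ) =
      (star Y.toComplex * z.toComplex * X.toComplex).re := by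
    rw [GaussianInt.intCast_re, map_mul, map_mul, GaussianInt.toComplex_star]
    rfl
  rw [hre, walkWeight]
  rw [show z.toComplex / (D : ℂ) * (2 * (star Y.toComplex * X.toComplex) /
      ((‖X.toComplex‖ ^ 2 + ‖Y.toComplex‖ ^ 2 : ℝ) : ℂ)) =
      ((2 / (D * (‖X.toComplex‖ ^ 2 + ‖Y.toComplex‖ ^ 2)) : ℝ) : ℂ) *
        (star Y.toComplex * z.toComplex * X.toComplex) by
    push_cast
    rw [div_mul_div_comm, div_mul_eq_mul_div]
    congr 1
    ring, Complex.re_ofReal_mul]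
  ring

theorem abs_list_sum_le {α : Type*} (l : List α) (f : α → ℝ) {c : ℝ} (h : ∀ a ∈ l, |f a| ≤ c) :
    |(l.map f).sum| ≤ l.length * c := by
  induction l with
  | nil => simp
  | cons a l ih =>
    have h1 := h a (by simp)
    have h2 := ih fun b hb => h b (by simp [hb])
    simp only [List.map_cons, List.sum_cons, List.length_cons]
    push_cast
    linarith [abs_add_le (f a) (l.map f).sum]

section

variable {n S : ℕ} {row : Fin n → Fin S → Bits n → Bits n}
  {val : Fin n → Fin S → Bits n → GaussianInt} {val' : Fin n → Fin S → Bits n → ℂ}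
  {A : Fin n → Op n} {amp : Bits n → GaussianInt} {J h : ℕ} {η : ℝ}

/-- The estimate from one sample is close to the exact weighted column sum. -/
theorem abs_walkSum_sub_le (hη0 : 0 ≤ η) (hη : η ≤ 1) (h1 : ∀ j r y, ‖val' j r y‖ ≤ 1)
    (h2 : ∀ j r y, ‖(val j r y).toComplex / 2 ^ h - val' j r y‖ ≤ η)
    (hA : ∀ j x (f : Bits n → ℂ), ∑ r, val' j r x * f (row j r x) = ∑ y, A j y x * f y)
    (x : Bits n) (s : List (Fin n)) :
    |(walkSum row val amp J h x s : ℝ) - J * (∑ y, opProd A s y x *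
      walkWeight (amp x).toComplex (amp y).toComplex).re| ≤
        S ^ s.length * (1 + J * (2 ^ s.length * η)) ∧
    |(∑ y, opProd A s y x * walkWeight (amp x).toComplex (amp y).toComplex).re| ≤
        S ^ s.length := by
  set Q := paths row (fun j r y => (val j r y, val' j r y)) x s with hQ
  have hl : Q.length = S ^ s.length := length_paths _ _ _ _
  have hQ1 : paths row val x s = Q.map fun p => (p.1, p.2.1) :=
    paths_map (MonoidHom.fst GaussianInt ℂ) row (fun j r y => (val j r y, val' j r y)) x s
  have hQ2 : paths row val' x s = Q.map fun p => (p.1, p.2.2) :=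
    paths_map (MonoidHom.snd GaussianInt ℂ) row (fun j r y => (val j r y, val' j r y)) x s
  have herr := paths_error (row := row) hη0 hη h1 h2 x s
  rw [← hQ] at herr
  let w : Bits n → ℂ := fun y => walkWeight (amp x).toComplex (amp y).toComplex
  have hw : ∀ y, ‖w y‖ ≤ 1 := fun y => norm_walkWeight_le _ _
  have hexact : (∑ y, opProd A s y x * w y).re = (Q.map fun p => (p.2.2 * w p.1).re).sum := by
    rw [← sum_paths hA x s w, hQ2, List.map_map]
    generalize Q = Q
    induction Q with
    | nil => simp
    | cons p Q ih => simpa using ih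
  have hwalk : (walkSum row val amp J h x s : ℝ) = (Q.map fun p =>
      (walkTerm J (2 ^ (h * s.length)) (amp x) (amp p.1) p.2.1 : ℝ)).sum := by
    rw [walkSum, hQ1, List.map_map]
    generalize Q = Q
    induction Q with
    | nil => simp
    | cons p Q ih => simpa using ih
  constructor
  · have hdiff : (walkSum row val amp J h x s : ℝ) - J * (∑ y, opProd A s y x * w y).re =
        (Q.map fun p => (walkTerm J (2 ^ (h * s.length)) (amp x) (amp p.1) p.2.1 : ℝ) -
          J * (p.2.2 * w p.1).re).sum := by
      rw [hwalk, hexact]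
      generalize Q = Q
      induction Q with
      | nil => simp
      | cons p Q ih =>
        simp only [List.map_cons, List.sum_cons, ← ih]
        ring
    have hb := abs_list_sum_le Q (fun p =>
      (walkTerm J (2 ^ (h * s.length)) (amp x) (amp p.1) p.2.1 : ℝ) - J * (p.2.2 * w p.1).re)
      (c := 1 + J * (2 ^ s.length * η)) ?_
    · rw [hl] at hb
      rw [hdiff]
      push_cast at hb
      exact hb
    · intro p hp
      have e1 := abs_walkTerm_sub_le J (2 ^ (h * s.length)) (amp x) (amp p.1) p.2.1
      obtain ⟨e2, -⟩ := herr p hp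
      push_cast at e1
      have e3 : |(p.2.1.toComplex / 2 ^ (h * s.length) * w p.1).re - (p.2.2 * w p.1).re| ≤
          2 ^ s.length * η := by
        rw [← Complex.sub_re, ← sub_mul]
        refine (Complex.abs_re_le_norm _).trans ?_
        rw [norm_mul]
        calc _ ≤ (2 ^ s.length - 1) * η * 1 := by
              gcongr
              · exact (norm_nonneg _).trans e2
              · exact hw _
          _ ≤ _ := by linarith
      calc _ ≤ |(walkTerm J (2 ^ (h * s.length)) (amp x) (amp p.1) p.2.1 : ℝ) -
            J * (p.2.1.toComplex / 2 ^ (h * s.length) * w p.1).re| +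
            |J * ((p.2.1.toComplex / 2 ^ (h * s.length) * w p.1).re - (p.2.2 * w p.1).re)| := by
            refine (le_of_eq ?_).trans (abs_add_le _ _)
            congr 1
            ring
        _ ≤ _ := by
            rw [abs_mul, Nat.abs_cast]
            gcongr
  · have hb := abs_list_sum_le Q (fun p => (p.2.2 * w p.1).re) (c := 1) (fun p hp => by
      refine (Complex.abs_re_le_norm _).trans ?_
      rw [norm_mul]
      exact mul_le_one₀ (herr p hp).2 (norm_nonneg _) (hw _))
    rw [hl, mul_one, ← hexact] at hb
    push_cast at hb
    exact hb

end

theorem abs_expVal_sub_le {n : ℕ} {φ φ' : Bits n → ℂ} {B : Op n} {η : ℝ} (hη : η ≤ 1)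
    (hB : ∀ x y, ‖B x y‖ ≤ 1) (hφ : ∀ x, ‖φ x‖ ≤ 1) (h : ∀ x, ‖φ' x - φ x‖ ≤ η) :
    |(expVal φ' B).re - (expVal φ B).re| ≤ 4 ^ n * (3 * η) := by
  rw [← Complex.sub_re]
  refine (Complex.abs_re_le_norm _).trans ?_
  simp only [expVal, ← Finset.sum_sub_distrib]
  refine (norm_sum_le_of_le (f := fun x => ∑ y, (star (φ' y) * B y x * φ' x - star (φ y) * B y x * φ x))
    Finset.univ (n := fun _ => 2 ^ n * (3 * η)) fun x _ => ?_).trans (le_of_eq ?_)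
  · refine (norm_sum_le_of_le Finset.univ (n := fun _ => 3 * η) fun y _ => ?_).trans (le_of_eq ?_)
    · have h0 : 0 ≤ η := (norm_nonneg _).trans (h x)
      have h1 : star (φ' y) * B y x * φ' x - star (φ y) * B y x * φ x =
          B y x * (star (φ' y) * (φ' x - φ x) + star (φ' y - φ y) * φ x) := by
        rw [star_sub]; ring
      have h2 : ‖φ' y‖ ≤ 2 := by
        have := norm_add_le (φ' y - φ y) (φ y)
        rw [sub_add_cancel] at this
        linarith [h y, hφ y]
      rw [h1, norm_mul]
      calc _ ≤ 1 * (‖star (φ' y) * (φ' x - φ x)‖ + ‖star (φ' y - φ y) * φ x‖) := by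
            gcongr
            · exact hB _ _
            · exact norm_add_le _ _
        _ ≤ 1 * (2 * η + η * 1) := by
            rw [norm_mul, norm_mul, norm_star, norm_star]
            gcongr
            · exact h x
            · exact h y
            · exact hφ x
        _ = 3 * η := by ring
    · simp
  · simp only [Finset.sum_const, Finset.card_univ, Fintype.card_pi, Fintype.card_bool,
      Finset.prod_const, Fintype.card_fin, nsmul_eq_mul]
    push_cast
    rw [← mul_assoc, ← mul_pow]
    norm_num

theorem abs_normSq_sub_le {a b : ℂ} {η : ℝ} (hη : η ≤ 1) (hb : ‖b‖ ≤ 1) (h : ‖a - b‖ ≤ η) :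
    |‖a‖ ^ 2 - ‖b‖ ^ 2| ≤ 3 * η := by
  have h1 := abs_norm_sub_norm_le a b
  have h2 : ‖a‖ ≤ 2 := by
    have := norm_add_le (a - b) b
    rw [sub_add_cancel] at this
    linarith
  rw [sq_sub_sq, abs_mul, abs_of_nonneg (by positivity : 0 ≤ ‖a‖ + ‖b‖)]
  calc (‖a‖ + ‖b‖) * |‖a‖ - ‖b‖| ≤ (2 + 1) * η := by
        gcongr
        exact h1.trans h
    _ = 3 * η := by ring

/-! ### Mean and concentration of the estimates -/

section

variable {n S : ℕ} {row : Fin n → Fin S → Bits n → Bits n}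
  {val : Fin n → Fin S → Bits n → GaussianInt} {val' : Fin n → Fin S → Bits n → ℂ}
  {A : Fin n → Op n} {amp : Bits n → GaussianInt} {M h : ℕ}

/-- The mean of the estimator, for samples drawn approximately from `|φ|²`. -/
theorem abs_mean_walkSum_sub_le (h1 : ∀ j r y, ‖val' j r y‖ ≤ 1)
    (h2 : ∀ j r y, ‖(val j r y).toComplex / 2 ^ h - val' j r y‖ ≤ (1 / 2) ^ M)
    (hA : ∀ j x (f : Bits n → ℂ), ∑ r, val' j r x * f (row j r x) = ∑ y, A j y x * f y)
    {φ : Bits n → ℂ} (hφ : ∀ x, ‖φ x‖ ≤ 1)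
    (hamp : ∀ x, ‖(amp x).toComplex / 2 ^ M - φ x‖ ≤ (1 / 2) ^ M)
    {q : Bits n → ℝ} (hq0 : ∀ x, 0 ≤ q x) (hq1 : ∑ x, q x = 1)
    (hq : ∑ x, |‖φ x‖ ^ 2 - q x| ≤ (1 / 2) ^ M)
    {s : List (Fin n)} (hB : (opProd A s).IsHermitian) (hB1 : ∀ x y, ‖opProd A s x y‖ ≤ 1) :
    |∑ x, q x * (walkSum row val amp (2 ^ M) h x s / 2 ^ M) - (expVal φ (opProd A s)).re| ≤
      9 * 4 ^ n * (2 * S + 2) ^ s.length * (1 / 2) ^ M := by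
  set η : ℝ := (1 / 2) ^ M with hη
  have hη0 : 0 < η := by positivity
  have hη1 : η ≤ 1 := pow_le_one₀ (by norm_num) (by norm_num)
  have hM : (0 : ℝ) < 2 ^ M := by positivity
  have hMη : (2 : ℝ) ^ M * η = 1 := by rw [hη, ← mul_pow]; norm_num
  set k := s.length
  set P : ℝ := (S : ℝ) ^ k with hP
  have hP0 : 0 ≤ P := by positivity
  set φ' : Bits n → ℂ := fun x => (amp x).toComplex / 2 ^ M with hφ'
  set Ψ : Bits n → ℝ := fun x => (∑ y, opProd A s y x *
      walkWeight (amp x).toComplex (amp y).toComplex).re with hΨ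
  have hw := fun x => abs_walkSum_sub_le (amp := amp) (J := 2 ^ M) hη0.le hη1 h1 h2 hA x s
  have hΨ1 : ∀ x, |Ψ x| ≤ P := fun x => (hw x).2
  -- rounding and the errors of the matrix entries
  have e1 : |∑ x, q x * (walkSum row val amp (2 ^ M) h x s / 2 ^ M) - ∑ x, q x * Ψ x| ≤
      P * (1 + 2 ^ k) * η := by
    rw [← Finset.sum_sub_distrib]
    calc _ ≤ ∑ x, q x * (P * (1 + 2 ^ k) * η) := by
          refine (Finset.abs_sum_le_sum_abs _ _).trans (Finset.sum_le_sum fun x _ => ?_)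
          rw [← mul_sub, abs_mul, abs_of_nonneg (hq0 x)]
          refine mul_le_mul_of_nonneg_left ?_ (hq0 x)
          have e := (hw x).1
          push_cast at e
          rw [← mul_assoc, mul_comm ((2 : ℝ) ^ M) (2 ^ s.length), mul_assoc ((2 : ℝ) ^ s.length),
            hMη, mul_one] at e
          have : (walkSum row val amp (2 ^ M) h x s : ℝ) / 2 ^ M - Ψ x =
              (walkSum row val amp (2 ^ M) h x s - 2 ^ M * Ψ x) * η := by
            rw [sub_mul, mul_right_comm, hMη, one_mul, hη, one_div, inv_pow, div_eq_mul_inv]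
          rw [this, abs_mul, abs_of_pos hη0]
          exact mul_le_mul_of_nonneg_right e hη0.le
      _ = _ := by rw [← Finset.sum_mul, hq1, one_mul]
  -- the errors of the sampled distribution and of the amplitudes
  have e2 : |∑ x, q x * Ψ x - ∑ x, ‖φ' x‖ ^ 2 * Ψ x| ≤ P * (1 + 3 * 2 ^ n) * η := by
    rw [← Finset.sum_sub_distrib]
    calc _ ≤ ∑ x, (|‖φ x‖ ^ 2 - q x| + 3 * η) * P := by
          refine (Finset.abs_sum_le_sum_abs _ _).trans (Finset.sum_le_sum fun x _ => ?_)
          rw [← sub_mul, abs_mul]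
          refine mul_le_mul ?_ (hΨ1 x) (abs_nonneg _) (by positivity)
          have e3 := abs_normSq_sub_le hη1 (hφ x) (hamp x)
          calc |q x - ‖φ' x‖ ^ 2| ≤ |q x - ‖φ x‖ ^ 2| + |‖φ x‖ ^ 2 - ‖φ' x‖ ^ 2| :=
                abs_sub_le _ _ _
            _ ≤ _ := by
                rw [abs_sub_comm (q x), abs_sub_comm (‖φ x‖ ^ 2) (‖φ' x‖ ^ 2)]
                exact add_le_add_right e3 _
      _ ≤ (η + 2 ^ n * (3 * η)) * P := by
          rw [← Finset.sum_mul, Finset.sum_add_distrib]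
          refine mul_le_mul_of_nonneg_right (add_le_add hq (le_of_eq ?_)) hP0
          simp
      _ = _ := by ring
  have e3 : ∑ x, ‖φ' x‖ ^ 2 * Ψ x = (expVal φ' (opProd A s)).re := by
    rw [← sum_normSq_mul_walkWeight φ' hB]
    refine Finset.sum_congr rfl fun x _ => ?_
    rw [hΨ]
    dsimp only
    congr 3
    ext y
    have := walkWeight_smul (amp x).toComplex (amp y).toComplex hM
    push_cast at this
    rw [← this]
  have e4 := abs_expVal_sub_le (φ' := φ') hη1 hB1 hφ hamp
  rw [← e3] at e4
  have hPY : P * 2 ^ k ≤ (2 * S + 2) ^ k := by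
    rw [hP, ← mul_pow]
    exact pow_le_pow_left₀ (by positivity) (by linarith) _
  have hPY' : P ≤ (2 * S + 2) ^ k := by
    rw [hP]
    exact pow_le_pow_left₀ (by positivity) (by linarith [(Nat.cast_nonneg S : (0 : ℝ) ≤ S)]) _
  have hY1 : (1 : ℝ) ≤ (2 * S + 2) ^ k :=
    one_le_pow₀ (by linarith [(Nat.cast_nonneg S : (0 : ℝ) ≤ S)])
  have h24 : (2 : ℝ) ^ n ≤ 4 ^ n := pow_le_pow_left₀ (by norm_num) (by norm_num) _
  have h4 : (1 : ℝ) ≤ 4 ^ n := one_le_pow₀ (by norm_num)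
  set Y : ℝ := (2 * S + 2) ^ k
  have e5 : |∑ x, q x * (walkSum row val amp (2 ^ M) h x s / 2 ^ M) -
      (expVal φ (opProd A s)).re| ≤
      P * (1 + 2 ^ k) * η + P * (1 + 3 * 2 ^ n) * η + 4 ^ n * (3 * η) := by
    have f1 := abs_sub_le (∑ x, q x * (walkSum row val amp (2 ^ M) h x s / 2 ^ M))
      (∑ x, q x * Ψ x) (expVal φ (opProd A s)).re
    have f2 := abs_sub_le (∑ x, q x * Ψ x) (∑ x, ‖φ' x‖ ^ 2 * Ψ x) (expVal φ (opProd A s)).re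
    linarith
  refine e5.trans ?_
  have hYY : Y ≤ 4 ^ n * Y := le_mul_of_one_le_left (by linarith) h4
  have hPn : P * 2 ^ n ≤ 4 ^ n * Y := by
    rw [mul_comm]
    exact mul_le_mul h24 hPY' hP0 (by positivity)
  have h4Y : (4 : ℝ) ^ n ≤ 4 ^ n * Y := le_mul_of_one_le_right (by positivity) hY1
  calc _ = (P + P * 2 ^ k + P + 3 * (P * 2 ^ n) + 3 * 4 ^ n) * η := by ring
    _ ≤ (9 * (4 ^ n * Y)) * η := by
        refine mul_le_mul_of_nonneg_right ?_ hη0.le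
        linarith
    _ = _ := by ring

theorem abs_walkSum_le (h1 : ∀ j r y, ‖val' j r y‖ ≤ 1)
    (h2 : ∀ j r y, ‖(val j r y).toComplex / 2 ^ h - val' j r y‖ ≤ (1 / 2) ^ M)
    (hA : ∀ j x (f : Bits n → ℂ), ∑ r, val' j r x * f (row j r x) = ∑ y, A j y x * f y)
    (x : Bits n) (s : List (Fin n)) :
    |(walkSum row val amp (2 ^ M) h x s : ℝ) / 2 ^ M| ≤ 3 * (2 * S + 2) ^ s.length := by
  set η : ℝ := (1 / 2) ^ M with hη
  have hη0 : 0 < η := by positivity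
  have hη1 : η ≤ 1 := pow_le_one₀ (by norm_num) (by norm_num)
  have hM : (0 : ℝ) < 2 ^ M := by positivity
  have hM1 : (1 : ℝ) ≤ 2 ^ M := one_le_pow₀ (by norm_num)
  obtain ⟨e1, e2⟩ := abs_walkSum_sub_le (amp := amp) (J := 2 ^ M) hη0.le hη1 h1 h2 hA x s
  set Ψ := (∑ y, opProd A s y x * walkWeight (amp x).toComplex (amp y).toComplex).re
  rw [abs_div, abs_of_pos hM, div_le_iff₀ hM]
  push_cast at e1
  have e3 : |(walkSum row val amp (2 ^ M) h x s : ℝ)| ≤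
      (S : ℝ) ^ s.length * (1 + 2 ^ M * (2 ^ s.length * η)) + 2 ^ M * (S : ℝ) ^ s.length := by
    have f1 := abs_add_le ((walkSum row val amp (2 ^ M) h x s : ℝ) - 2 ^ M * Ψ) (2 ^ M * Ψ)
    rw [sub_add_cancel, abs_mul, abs_of_pos hM] at f1
    have f2 := mul_le_mul_of_nonneg_left e2 hM.le
    linarith
  refine e3.trans ?_
  have hPY : (S : ℝ) ^ s.length * 2 ^ s.length ≤ (2 * S + 2) ^ s.length := by
    rw [← mul_pow]
    exact pow_le_pow_left₀ (by positivity) (by linarith) _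
  have hPY' : (S : ℝ) ^ s.length ≤ (2 * S + 2) ^ s.length :=
    pow_le_pow_left₀ (by positivity) (by linarith [(Nat.cast_nonneg S : (0 : ℝ) ≤ S)]) _
  set P := (S : ℝ) ^ s.length
  have hP0 : 0 ≤ P := by positivity
  have g1 : P ≤ P * 2 ^ M := le_mul_of_one_le_right hP0 hM1
  have g2 : P * (2 ^ M * (2 ^ s.length * η)) ≤ P * 2 ^ s.length * 2 ^ M := by
    have : P * (2 ^ M * (2 ^ s.length * η)) = P * 2 ^ s.length * 2 ^ M * η := by ring
    rw [this]
    exact mul_le_of_le_one_right (by positivity) hη1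
  have g3 := mul_le_mul_of_nonneg_right hPY hM.le
  have g4 := mul_le_mul_of_nonneg_right hPY' hM.le
  calc _ = P + P * (2 ^ M * (2 ^ s.length * η)) + P * 2 ^ M := by ring
    _ ≤ _ := by linarith

theorem expect_eq_sum_law {Ω : Type*} [Fintype Ω] (f : Ω → Bits n) (F : Bits n → ℝ) :
    𝔼 ω, F (f ω) = ∑ x, (𝔼 ω, if f ω = x then (1 : ℝ) else 0) * F x := by
  simp only [Fintype.expect_eq_sum_div_card, div_mul_eq_mul_div, ← Finset.sum_div]
  congr 1
  simp only [Finset.sum_mul]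
  rw [Finset.sum_comm]
  simp

/-- With high probability all coefficients are estimated accurately at once. -/
theorem expect_not_accurate_le {L T l : ℕ} (h1 : ∀ j r y, ‖val' j r y‖ ≤ 1)
    (h2 : ∀ j r y, ‖(val j r y).toComplex / 2 ^ h - val' j r y‖ ≤ (1 / 2) ^ M)
    (hA : ∀ j x (f : Bits n → ℂ), ∑ r, val' j r x * f (row j r x) = ∑ y, A j y x * f y)
    {φ : Bits n → ℂ} (hφ : ∀ x, ‖φ x‖ ≤ 1)
    (hamp : ∀ x, ‖(amp x).toComplex / 2 ^ M - φ x‖ ≤ (1 / 2) ^ M)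
    (sam : Bits L → Bits n)
    (hq : ∑ x, |‖φ x‖ ^ 2 - 𝔼 ω, if sam ω = x then (1 : ℝ) else 0| ≤ (1 / 2) ^ M)
    (hB : ∀ s ∈ subs l n le_rfl, (opProd A s).IsHermitian ∧ ∀ x y, ‖opProd A s x y‖ ≤ 1)
    {τ : ℝ} (hτ0 : 0 < τ) (hτ1 : τ ≤ 1) (hT0 : 0 < T)
    (hτ : 9 * 4 ^ n * (2 * S + 2) ^ l * (1 / 2) ^ M ≤ τ / 2)
    (hT : (n + 2 * (n + 1) ^ l) * (576 * ((2 * S + 2) ^ l) ^ 2) ≤ T * τ ^ 2) :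
    (𝔼 ω : Fin T → Bits L, if ∀ s ∈ subs l n le_rfl,
      |(sampleSum row val amp (2 ^ M) h sam ω s : ℝ) / (T * 2 ^ M) -
        (expVal φ (opProd A s)).re| ≤ τ then (0 : ℝ) else 1) ≤ Real.exp (-n) := by
  classical
  set Y : ℝ := (2 * S + 2) ^ l with hY
  have hS0 : (0 : ℝ) ≤ S := Nat.cast_nonneg S
  have hY1 : 1 ≤ Y := one_le_pow₀ (by linarith)
  have hYs : ∀ s ∈ subs l n le_rfl, (2 * (S : ℝ) + 2) ^ s.length ≤ Y := fun s hs =>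
    pow_le_pow_right₀ (by linarith) (length_le_of_mem_subs hs)
  have hT0' : (0 : ℝ) < T := by exact_mod_cast hT0
  let f : List (Fin n) → Bits L → ℝ := fun s ω => walkSum row val amp (2 ^ M) h (sam ω) s / 2 ^ M
  have hsum : ∀ s (ω : Fin T → Bits L),
      (sampleSum row val amp (2 ^ M) h sam ω s : ℝ) / (T * 2 ^ M) = (∑ t, f s (ω t)) / T := by
    intro s ω
    rw [sampleSum, ← List.ofFn_eq_map, List.sum_ofFn]
    push_cast
    rw [← Finset.sum_div, div_div, mul_comm]
  have hmean : ∀ s ∈ subs l n le_rfl, |(𝔼 ω, f s ω) - (expVal φ (opProd A s)).re| ≤ τ / 2 := by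
    intro s hs
    have e := abs_mean_walkSum_sub_le h1 h2 hA hφ hamp
      (q := fun x => 𝔼 ω, if sam ω = x then (1 : ℝ) else 0)
      (fun x => Finset.expect_nonneg fun ω _ => by split <;> norm_num)
      (by
        have := expect_eq_sum_law sam (fun _ => (1 : ℝ))
        simpa using this.symm) hq (hB s hs).1 (hB s hs).2
    rw [expect_eq_sum_law sam fun x => (walkSum row val amp (2 ^ M) h x s : ℝ) / 2 ^ M]
    refine (e.trans ?_).trans hτ
    gcongr
    exact hYs s hs
  have hdev : ∀ s ∈ subs l n le_rfl,
      (𝔼 ω : Fin T → Bits L, if T * (τ / 2) < |∑ t, f s (ω t) - T * 𝔼 w, f s w|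
        then (1 : ℝ) else 0) ≤ 2 * Real.exp (-(n + 2 * (n + 1) ^ l)) := by
    intro s hs
    have e := expect_deviation_le (T := T) (f := f s) (B := 3 * Y) (τ := τ / 2)
      (fun ω => (abs_walkSum_le h1 h2 hA (sam ω) s).trans (by gcongr; exact hYs s hs))
      (by linarith) (by linarith) (by linarith)
    refine e.trans ?_
    gcongr
    rw [le_div_iff₀ (by positivity)]
    nlinarith
  have hunion : ∀ ω : Fin T → Bits L, (if ∀ s ∈ subs l n le_rfl,
      |(sampleSum row val amp (2 ^ M) h sam ω s : ℝ) / (T * 2 ^ M) -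
        (expVal φ (opProd A s)).re| ≤ τ then (0 : ℝ) else 1) ≤
      ((subs l n le_rfl).map fun s =>
        if T * (τ / 2) < |∑ t, f s (ω t) - T * 𝔼 w, f s w| then (1 : ℝ) else 0).sum := by
    intro ω
    have hnn : ∀ a ∈ (subs l n le_rfl).map fun s =>
        if T * (τ / 2) < |∑ t, f s (ω t) - T * 𝔼 w, f s w| then (1 : ℝ) else 0, 0 ≤ a := by
      intro a ha
      obtain ⟨s, -, rfl⟩ := List.mem_map.1 ha
      split <;> norm_num
    split
    · exact List.sum_nonneg hnn
    · rename_i hbad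
      push Not at hbad
      obtain ⟨s, hs, hbad⟩ := hbad
      refine le_trans ?_ (List.single_le_sum hnn _ (List.mem_map_of_mem hs))
      rw [if_pos]
      by_contra hcon
      rw [not_lt] at hcon
      refine absurd hbad (not_lt.2 ?_)
      rw [hsum]
      have g1 : |(∑ t, f s (ω t)) / T - 𝔼 w, f s w| ≤ τ / 2 := by
        rw [show (∑ t, f s (ω t)) / T - 𝔼 w, f s w = (∑ t, f s (ω t) - T * 𝔼 w, f s w) / T by
          field_simp, abs_div, abs_of_pos hT0', div_le_iff₀ hT0']
        linarith
      have g2 := abs_sub_le ((∑ t, f s (ω t)) / T) (𝔼 w, f s w) (expVal φ (opProd A s)).re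
      linarith [hmean s hs]
  have hcomm : ∀ l' : List (List (Fin n)), (∀ s ∈ l', s ∈ subs l n le_rfl) →
      (𝔼 ω : Fin T → Bits L, (l'.map fun s =>
        if T * (τ / 2) < |∑ t, f s (ω t) - T * 𝔼 w, f s w| then (1 : ℝ) else 0).sum) ≤
      l'.length * (2 * Real.exp (-(n + 2 * (n + 1) ^ l))) := by
    intro l'
    induction l' with
    | nil => intro _; simp
    | cons s l' ih =>
      intro hl
      simp only [List.map_cons, List.sum_cons, List.length_cons]
      rw [Finset.expect_add_distrib]
      have e1 := hdev s (hl s (by simp))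
      have e2 := ih fun s' hs' => hl s' (by simp [hs'])
      push_cast
      linarith
  refine (Finset.expect_le_expect fun ω _ => hunion ω).trans ((hcomm _ fun s hs => hs).trans ?_)
  have hlen : ((subs l n (le_refl n)).length : ℝ) ≤ (n + 1) ^ l := by
    exact_mod_cast subs_length_le (le_refl n)
  have hexp : Real.exp (-(n + 2 * (n + 1) ^ l)) =
      Real.exp (-n) * Real.exp (-(2 * ((n : ℝ) + 1) ^ l)) := by
    rw [← Real.exp_add]; ring_nf
  have hy : 2 * ((n : ℝ) + 1) ^ l * Real.exp (-(2 * ((n : ℝ) + 1) ^ l)) ≤ 1 := by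
    rw [Real.exp_neg, ← div_eq_mul_inv, div_le_one (Real.exp_pos _)]
    linarith [Real.add_one_le_exp (2 * ((n : ℝ) + 1) ^ l)]
  rw [hexp]
  calc _ ≤ ((n : ℝ) + 1) ^ l * (2 * (Real.exp (-n) * Real.exp (-(2 * ((n : ℝ) + 1) ^ l)))) := by
        gcongr
    _ = Real.exp (-n) * (2 * ((n : ℝ) + 1) ^ l * Real.exp (-(2 * ((n : ℝ) + 1) ^ l))) := by ring
    _ ≤ Real.exp (-n) * 1 := by gcongr
    _ = _ := mul_one _

end

/-! ### Damping factors -/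

theorem pow_succ_sub_pow_succ_le {a b : ℝ} (hb : 0 ≤ b) (hab : b ≤ a) (k : ℕ) :
    a ^ (k + 1) - b ^ (k + 1) ≤ (k + 1) * (a - b) * a ^ k := by
  induction k with
  | zero => simp
  | succ k ih =>
    have h1 : b ^ (k + 1) ≤ a ^ (k + 1) := pow_le_pow_left₀ hb hab _
    have h2 := mul_le_mul_of_nonneg_left ih (hb.trans hab)
    have h3 := mul_le_mul_of_nonneg_left h1 (sub_nonneg.2 hab)
    push_cast
    calc a ^ (k + 1 + 1) - b ^ (k + 1 + 1)
        = a * (a ^ (k + 1) - b ^ (k + 1)) + (a - b) * b ^ (k + 1) := by ring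
      _ ≤ a * ((k + 1) * (a - b) * a ^ k) + (a - b) * a ^ (k + 1) := add_le_add h2 h3
      _ = _ := by ring

theorem succ_mul_mul_pow_le_one {t : ℝ} (h0 : 0 ≤ t) (h1 : t ≤ 1) (k : ℕ) :
    (k + 1) * t * (1 - t) ^ k ≤ 1 := by
  have h : (k + 1) * t * (1 - t) ^ k + (1 - t) ^ (k + 1) ≤ 1 := by
    induction k with
    | zero => simp
    | succ k ih =>
      have e1 := mul_le_mul_of_nonneg_left ih (sub_nonneg.2 h1)
      have e2 : (1 - t) ^ (k + 1) ≤ 1 := pow_le_one₀ (sub_nonneg.2 h1) (by linarith)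
      have e3 := mul_le_mul_of_nonneg_left e2 h0
      push_cast
      calc ((k : ℝ) + 1 + 1) * t * (1 - t) ^ (k + 1) + (1 - t) ^ (k + 1 + 1)
          = (1 - t) * ((k + 1) * t * (1 - t) ^ k + (1 - t) ^ (k + 1)) +
              t * (1 - t) ^ (k + 1) := by ring
        _ ≤ (1 - t) * 1 + t * 1 := add_le_add e1 e3
        _ = 1 := by ring
  have : 0 ≤ (1 - t) ^ (k + 1) := pow_nonneg (sub_nonneg.2 h1) _
  linarith

/-- The truncated factors `v^k`, with `v` close to `1 - t`, approximate the factors `(1 - ε)^k` of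
the noise: the relative error of the rate costs `k t (1 - t)^(k-1) ≤ 1` times itself, uniformly
in `k`. -/
theorem abs_truncated_pow_sub_le {t ε v B : ℝ} {l : ℕ} (hB : 0 < B) (ht : 0 < t) (htε : t ≤ ε)
    (hε1 : ε ≤ 1) (hε : ε - t ≤ t / B) (hv0 : 0 ≤ v) (hv1 : v ≤ 1)
    (hv : l * |v - (1 - t)| ≤ 1 / (2 * B)) (hl : (1 - t) ^ (l + 1) ≤ 1 / B) (k : ℕ) :
    |(if k ≤ l then v ^ k else 0) - (1 - ε) ^ k| ≤ 3 / (2 * B) := by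
  have ht1 : 0 ≤ 1 - t := by linarith
  have hεk : 0 ≤ (1 - ε) ^ k := pow_nonneg (by linarith) _
  split
  · rename_i hk
    have e1 : |v ^ k - (1 - t) ^ k| ≤ l * |v - (1 - t)| := by
      rcases k with _ | k
      · simp only [pow_zero, sub_self, abs_zero]; positivity
      have h : ∀ a b : ℝ, 0 ≤ b → b ≤ a → a ≤ 1 →
          a ^ (k + 1) - b ^ (k + 1) ≤ l * (a - b) := by
        intro a b hb hab ha
        refine (pow_succ_sub_pow_succ_le hb hab k).trans ?_
        have h1 : a ^ k ≤ 1 := pow_le_one₀ (hb.trans hab) ha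
        have h2 : ((k : ℝ) + 1) ≤ l := by exact_mod_cast hk
        calc ((k : ℝ) + 1) * (a - b) * a ^ k ≤ ((k : ℝ) + 1) * (a - b) * 1 := by
              gcongr
          _ ≤ l * (a - b) := by
              rw [mul_one]
              exact mul_le_mul_of_nonneg_right h2 (sub_nonneg.2 hab)
      rcases le_total (1 - t) v with hle | hle
      · rw [abs_of_nonneg (sub_nonneg.2 hle),
          abs_of_nonneg (sub_nonneg.2 (pow_le_pow_left₀ ht1 hle _))]
        exact h _ _ ht1 hle hv1
      · rw [abs_of_nonpos (sub_nonpos.2 hle),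
          abs_of_nonpos (sub_nonpos.2 (pow_le_pow_left₀ hv0 hle _)), neg_sub, neg_sub]
        exact h _ _ hv0 hle (by linarith)
    have e2 : |(1 - t) ^ k - (1 - ε) ^ k| ≤ 1 / B := by
      rw [abs_of_nonneg (sub_nonneg.2 (pow_le_pow_left₀ (by linarith) (by linarith) _))]
      rcases k with _ | k
      · simp only [pow_zero, sub_self]; positivity
      refine (pow_succ_sub_pow_succ_le (by linarith) (by linarith) k).trans ?_
      calc ((k : ℝ) + 1) * (1 - t - (1 - ε)) * (1 - t) ^ k
          = (ε - t) * (((k : ℝ) + 1) * (1 - t) ^ k) := by ring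
        _ ≤ t / B * (((k : ℝ) + 1) * (1 - t) ^ k) := by gcongr
        _ = ((k + 1) * t * (1 - t) ^ k) / B := by ring
        _ ≤ 1 / B := by
            gcongr
            exact succ_mul_mul_pow_le_one ht.le (by linarith) k
    calc |v ^ k - (1 - ε) ^ k| ≤ |v ^ k - (1 - t) ^ k| + |(1 - t) ^ k - (1 - ε) ^ k| :=
          abs_sub_le _ _ _
      _ ≤ 1 / (2 * B) + 1 / B := add_le_add (e1.trans hv) e2
      _ = 3 / (2 * B) := by field_simp; norm_num
  · rename_i hk
    rw [zero_sub, abs_neg, abs_of_nonneg hεk]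
    calc (1 - ε) ^ k ≤ (1 - t) ^ k := pow_le_pow_left₀ (by linarith) (by linarith) _
      _ ≤ (1 - t) ^ (l + 1) := pow_le_pow_of_le_one ht1 (by linarith) (by omega)
      _ ≤ 1 / B := hl
      _ ≤ 3 / (2 * B) := by
          rw [div_le_div_iff₀ hB (by positivity)]
          linarith

/-! ### The noisy distribution -/

theorem Circuit.sum_outputDist {n : ℕ} (C : Circuit n) : ∑ x, C.outputDist x = 1 :=
  C.sum_norm_sq_state

theorem Circuit.abs_walshCoeff_outputDist_le {n : ℕ} (C : Circuit n) (s : Finset (Fin n)) :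
    |walshCoeff C.outputDist s| ≤ 1 := by
  rw [← C.sum_outputDist]
  refine (Finset.abs_sum_le_sum_abs _ _).trans (le_of_eq ?_)
  refine Finset.sum_congr rfl fun x _ => ?_
  rw [abs_mul, abs_walsh, mul_one, abs_of_nonneg]
  exact sq_nonneg _

theorem Circuit.sum_noisyDist {n : ℕ} (C : Circuit n) (ε : ℝ) : ∑ x, C.noisyDist ε x = 1 := by
  have h1 : ∀ s : Finset (Fin n), ∑ x, walsh s x = if s = ∅ then 2 ^ n else 0 := by
    intro s
    rw [← sum_walsh_mul_walsh s ∅]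
    exact Finset.sum_congr rfl fun x _ => by simp [walsh]
  simp only [noisyDist_eq, ← Finset.sum_div]
  rw [Finset.sum_comm]
  simp only [← Finset.mul_sum, h1, mul_ite, mul_zero, Finset.sum_ite_eq', Finset.mem_univ, if_true,
    Finset.card_empty, pow_zero, one_mul]
  rw [mul_div_assoc, div_self (by positivity), mul_one, ← C.sum_outputDist]
  exact Finset.sum_congr rfl fun x _ => by simp [walsh]

theorem Circuit.noisyDist_nonneg {n : ℕ} (C : Circuit n) {ε : ℝ} (h0 : 0 ≤ ε) (h1 : ε ≤ 1)
    (x : Bits n) : 0 ≤ C.noisyDist ε x := by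
  have h : ∀ (l : List (Fin n)) (ρ : Op n), (∀ x, 0 ≤ (ρ x x).re) →
      ∀ x, 0 ≤ ((l.foldl (fun ρ j => depolarize ε j ρ) ρ) x x).re := by
    intro l
    induction l with
    | nil => exact fun ρ hρ => hρ
    | cons j l ih =>
      intro ρ hρ
      rw [List.foldl_cons]
      refine ih _ fun y => ?_
      have e1 : (depolarize ε j ρ y y).re = (1 - ε) * (ρ y y).re +
          ε * (1 / 2 * ∑ b, (ρ (Function.update y j b) (Function.update y j b)).re) := by
        simp only [depolarize, mixQubit, Matrix.add_apply, Matrix.smul_apply, Matrix.of_apply,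
          if_true, smul_eq_mul, Complex.add_re, Complex.re_ofReal_mul]
        rw [show (1 / 2 : ℂ) = ((1 / 2 : ℝ) : ℂ) by norm_num, Complex.re_ofReal_mul,
          Complex.re_sum]
      rw [e1]
      have e2 : 0 ≤ ∑ b, (ρ (Function.update y j b) (Function.update y j b)).re :=
        Finset.sum_nonneg fun b _ => hρ _
      have e3 := hρ y
      have e4 : 0 ≤ 1 - ε := by linarith
      positivity
  refine h _ _ (fun y => ?_) x
  rw [Matrix.vecMulVec_apply, Pi.star_apply, RCLike.star_def, Complex.mul_conj, Complex.ofReal_re]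
  exact Complex.normSq_nonneg _

/-- Truncated damping approximates the noise in `l₁`, with an error controlled by the collision
probability. -/
theorem Circuit.l1_noisyDist_sub_le {n : ℕ} (C : Circuit n) {ε κ α : ℝ} (hκ : 0 ≤ κ)
    (hα : ∑ x, C.outputDist x ^ 2 ≤ α / 2 ^ n) {m : ℕ → ℝ} (hm : ∀ k, |m k - (1 - ε) ^ k| ≤ κ) :
    ∑ x, |(∑ s, m s.card * walshCoeff C.outputDist s * walsh s x) / 2 ^ n - C.noisyDist ε x| ≤
      κ * √α := by
  have h1 : ∀ x, (∑ s, m s.card * walshCoeff C.outputDist s * walsh s x) / 2 ^ n -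
      C.noisyDist ε x = (∑ s, (m s.card - (1 - ε) ^ s.card) * walshCoeff C.outputDist s *
        walsh s x) / 2 ^ n := by
    intro x
    rw [noisyDist_eq, ← sub_div, ← Finset.sum_sub_distrib]
    congr 1
    exact Finset.sum_congr rfl fun s _ => by ring
  simp only [h1]
  refine (l1_walsh_le _).trans ?_
  rw [← Real.sqrt_sq hκ, ← Real.sqrt_mul (sq_nonneg κ)]
  refine Real.sqrt_le_sqrt ?_
  calc ∑ s, ((m s.card - (1 - ε) ^ s.card) * walshCoeff C.outputDist s) ^ 2
      ≤ ∑ s, κ ^ 2 * walshCoeff C.outputDist s ^ 2 := by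
        refine Finset.sum_le_sum fun s _ => ?_
        rw [mul_pow]
        exact mul_le_mul_of_nonneg_right (sq_le_sq' (neg_le_of_abs_le (hm _))
          (le_of_abs_le (hm _))) (sq_nonneg _)
    _ = κ ^ 2 * (2 ^ n * ∑ x, C.outputDist x ^ 2) := by rw [← Finset.mul_sum, sum_walshCoeff_sq]
    _ ≤ κ ^ 2 * (2 ^ n * (α / 2 ^ n)) := by gcongr
    _ = κ ^ 2 * α := by field_simp

/-! ### Accuracy of the sampler -/

theorem abs_walshSum_sub_le {n l : ℕ} {E : List (Fin n) → ℤ} {Z τ : ℝ} {e : Finset (Fin n) → ℝ}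
    (hE : ∀ s ∈ subs l n le_rfl, |E s / Z - e s.toFinset| ≤ τ) (hτ : 0 ≤ τ) (x : Bits n) :
    |(walshSum ((subs l n le_rfl).map fun s => (s, E s)) x : ℝ) / Z -
      ∑ S ∈ Finset.univ.filter (fun S : Finset (Fin n) => S.card ≤ l), e S * walsh S x| ≤
        (n + 1) ^ l * τ := by
  have h1 : (walshSum ((subs l n le_rfl).map fun s => (s, E s)) x : ℝ) / Z =
      ((subs l n le_rfl).map fun s => E s / Z * walsh s.toFinset x).sum := by
    rw [walshSum, List.map_map, Int.cast_list_sum, List.map_map, div_eq_mul_inv,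
      ← List.sum_map_mul_right]
    congr 1
    refine List.map_congr_left fun s hs => ?_
    rw [← sgn_parity (subs_pairwise hs).1]
    simp only [Function.comp_apply, sgn]
    split <;> simp <;> ring
  rw [h1, ← sum_subs l (fun S => e S * walsh S x), ← Multiset.sum_coe, ← Multiset.sum_coe,
    ← Multiset.map_coe, ← Multiset.map_coe, ← Multiset.sum_map_sub, Multiset.map_coe,
    Multiset.sum_coe]
  refine (abs_list_sum_le _ _ (c := τ) fun s hs => ?_).trans ?_
  · rw [← sub_mul, abs_mul, abs_walsh, mul_one]
    exact hE s hs
  · gcongr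
    exact_mod_cast subs_length_le _

/-- If the coefficients are accurate, rejection sampling produces the noisy distribution up to
`l₁` distance `δ`. The signed function `g` defined by the coefficients has `l₁` distance at most
`δ / 5` from the noisy distribution, so clipping it at `0` and normalizing costs at most `δ / 5`
more. The last term is the failure of all trials, each accepting with probability at least
`2 / (5 ((n + 1)^l + 1))`. -/
theorem sum_abs_noisyDist_sub_rejection_le {n l Z K T : ℕ} (C : Circuit n) {ε κ α τ δ v : ℝ}
    {E : List (Fin n) → ℤ} (hε0 : 0 ≤ ε) (hε1 : ε ≤ 1) (hδ0 : 0 < δ) (hδ1 : δ ≤ 1) (hκ : 0 ≤ κ)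
    (hα : ∑ x, C.outputDist x ^ 2 ≤ α / 2 ^ n)
    (hm : ∀ k, |(if k ≤ l then v ^ k else 0) - (1 - ε) ^ k| ≤ κ)
    (hv0 : 0 ≤ v) (hv1 : v ≤ 1) (hτ : 0 ≤ τ) (hη : κ * √α + (n + 1) ^ l * τ ≤ δ / 5)
    (hE : ∀ s ∈ subs l n le_rfl,
      |(E s : ℝ) / Z - v ^ s.toFinset.card * walshCoeff C.outputDist s.toFinset| ≤ τ)
    (hZ : 0 < Z) (hK1 : Z * ((n + 1) ^ l + 1) ≤ 2 ^ K) (hK2 : 2 ^ K ≤ 2 * (Z * ((n + 1) ^ l + 1)))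
    (hT : 20 * ((n + 1) ^ l + 1) ≤ T * δ) :
    ∑ x, |C.noisyDist ε x - 𝔼 ω : Fin T → Bits (n + K),
      if rejection ((subs l n le_rfl).map fun s => (s, E s)) ω = x then (1 : ℝ) else 0| ≤ δ := by
  set c := (subs l n le_rfl).map fun s => (s, E s) with hc
  set N : ℝ := (n + 1) ^ l with hN
  have hN1 : 1 ≤ N := one_le_pow₀ (by linarith [(n.cast_nonneg : (0 : ℝ) ≤ n)])
  have hZ' : (0 : ℝ) < Z := by exact_mod_cast hZ
  have hα0 : 0 ≤ κ * √α := by positivity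
  have hK1' : (Z : ℝ) * (N + 1) ≤ 2 ^ K := by rw [hN]; exact_mod_cast hK1
  have hK2' : (2 : ℝ) ^ K ≤ 2 * (Z * (N + 1)) := by rw [hN]; exact_mod_cast hK2
  have h2n : (0 : ℝ) < 2 ^ n := by positivity
  have h2K : (0 : ℝ) < 2 ^ K := by positivity
  set e : Finset (Fin n) → ℝ := fun S => v ^ S.card * walshCoeff C.outputDist S with he
  have hw := abs_walshSum_sub_le (e := e) hE hτ
  set g : Bits n → ℝ := fun x => walshSum c x / Z / 2 ^ n with hg
  -- the signed function is close to the noisy distribution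
  have hf : ∀ x, (∑ s, (if s.card ≤ l then v ^ s.card else 0) * walshCoeff C.outputDist s *
      walsh s x) = ∑ S ∈ Finset.univ.filter (fun S : Finset (Fin n) => S.card ≤ l),
        e S * walsh S x := by
    intro x
    rw [Finset.sum_filter]
    refine Finset.sum_congr rfl fun s _ => ?_
    split <;> simp [he]
  have hgd : ∑ x, |g x - C.noisyDist ε x| ≤ δ / 5 := by
    refine le_trans ?_ hη
    have h1 := C.l1_noisyDist_sub_le hκ hα hm
    have h2 : ∑ x, |g x - (∑ s, (if s.card ≤ l then v ^ s.card else 0) *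
        walshCoeff C.outputDist s * walsh s x) / 2 ^ n| ≤ N * τ := by
      calc _ ≤ ∑ _x : Bits n, N * τ / 2 ^ n := by
            refine Finset.sum_le_sum fun x _ => ?_
            rw [hf, hg, ← sub_div, abs_div, abs_of_pos h2n]
            gcongr
            exact hw x
        _ = N * τ := by
            simp
            field_simp
    calc _ ≤ ∑ x, (|g x - (∑ s, (if s.card ≤ l then v ^ s.card else 0) *
        walshCoeff C.outputDist s * walsh s x) / 2 ^ n| +
          |(∑ s, (if s.card ≤ l then v ^ s.card else 0) *
        walshCoeff C.outputDist s * walsh s x) / 2 ^ n - C.noisyDist ε x|) :=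
          Finset.sum_le_sum fun x _ => abs_sub_le _ _ _
      _ ≤ _ := by rw [Finset.sum_add_distrib]; linarith
  have hp0 := C.noisyDist_nonneg hε0 hε1
  set σ : ℝ := ∑ x, max 0 (g x) with hσ
  have hclip : ∑ x, |max 0 (g x) - C.noisyDist ε x| ≤ δ / 5 := by
    refine (Finset.sum_le_sum fun x _ => ?_).trans hgd
    have h1 : C.noisyDist ε x = max 0 (C.noisyDist ε x) := (max_eq_right (hp0 x)).symm
    calc |max 0 (g x) - C.noisyDist ε x| = |max 0 (g x) - max 0 (C.noisyDist ε x)| := by rw [← h1]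
      _ ≤ |g x - C.noisyDist ε x| := by
          rw [max_comm 0, max_comm 0]
          exact abs_max_sub_max_le_abs _ _ _
  have hσ1 : |σ - 1| ≤ δ / 5 := by
    rw [hσ, ← C.sum_noisyDist ε, ← Finset.sum_sub_distrib]
    exact (Finset.abs_sum_le_sum_abs _ _).trans hclip
  obtain ⟨hσ2, hσ3⟩ := abs_le.1 hσ1
  have hσ0 : 4 / 5 ≤ σ := by linarith
  -- no threshold exceeds the range of the random number
  have hle : ∀ x, walshSum c x ≤ 2 ^ K := by
    intro x
    have h1 : |∑ S ∈ Finset.univ.filter (fun S : Finset (Fin n) => S.card ≤ l), e S * walsh S x| ≤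
        N := by
      rw [← sum_subs l (fun S => e S * walsh S x)]
      refine (abs_list_sum_le _ _ (c := 1) fun s _ => ?_).trans ?_
      · rw [abs_mul, abs_walsh, mul_one, he, abs_mul, abs_of_nonneg (pow_nonneg hv0 _)]
        exact mul_le_one₀ (pow_le_one₀ hv0 hv1) (abs_nonneg _) (C.abs_walshCoeff_outputDist_le _)
      · rw [mul_one, hN]
        exact_mod_cast subs_length_le _
    have h2 : (walshSum c x : ℝ) / Z ≤ N + 1 := by
      have := (abs_le.1 (hw x)).2
      have := (abs_le.1 h1).2
      linarith
    rw [div_le_iff₀ hZ'] at h2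
    have h3 : (walshSum c x : ℝ) ≤ 2 ^ K := by linarith
    exact_mod_cast h3
  -- probabilities of acceptance
  set a : ℝ := σ * (Z / 2 ^ K) with ha
  have hacc : ∀ x, max 0 (g x) * (Z / 2 ^ K) =
      𝔼 w : Bits (n + K), if accepts c w ∧ candidate w = x then (1 : ℝ) else 0 := by
    intro x
    rw [expect_accepts c x (hle x), hg, ← mul_comm (2 ^ K : ℝ), mul_comm (max 0 _)]
    have h1 : max 0 ((walshSum c x : ℝ) / Z / 2 ^ n) = max 0 (walshSum c x : ℝ) / Z / 2 ^ n := by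
      rw [← max_div_div_right hZ'.le, ← max_div_div_right h2n.le, zero_div, zero_div]
    rw [h1]
    field_simp
  have hZK : 1 / (2 * (N + 1)) ≤ Z / 2 ^ K := by
    rw [div_le_div_iff₀ (by positivity) h2K]
    linarith
  have hZK' : Z / 2 ^ K ≤ (1 : ℝ) / 2 := by
    rw [div_le_div_iff₀ h2K (by norm_num)]
    nlinarith
  have ha1 : 2 / 5 / (N + 1) ≤ a := by
    calc 2 / 5 / (N + 1) = 4 / 5 * (1 / (2 * (N + 1))) := by field_simp; norm_num
      _ ≤ a := by rw [ha]; gcongr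
  have ha0 : 0 < a := lt_of_lt_of_le (by positivity) ha1
  have ha2 : a ≤ 1 := by
    calc a ≤ 6 / 5 * (1 / 2) := by rw [ha]; gcongr; linarith
      _ ≤ 1 := by norm_num
  have hrej := rejection_law (accepts c) candidate (zeros n) T ha0 hacc
    (by rw [← Finset.sum_mul])
  have hfail : 2 * (1 - a) ^ T ≤ δ / 4 := by
    have h1 : 8 / δ ≤ a * T := by
      rw [div_le_iff₀ hδ0]
      calc 8 = 2 / 5 / (N + 1) * (20 * (N + 1)) := by field_simp; norm_num
        _ ≤ a * (T * δ) := by gcongr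
        _ = a * T * δ := by ring
    have h2 : (1 - a) ^ T ≤ Real.exp (-(a * T)) := by
      rw [mul_comm, ← mul_neg, Real.exp_nat_mul]
      exact pow_le_pow_left₀ (by linarith) (by linarith [Real.add_one_le_exp (-a)]) _
    have h3 : 8 / δ ≤ Real.exp (a * T) := by linarith [Real.add_one_le_exp (a * T)]
    rw [Real.exp_neg] at h2
    have h4 : (Real.exp (a * T))⁻¹ ≤ δ / 8 := by
      rw [← inv_div]
      exact inv_anti₀ (by positivity) h3
    linarith
  have hnorm : ∑ x, |max 0 (g x) * (Z / 2 ^ K) / a - max 0 (g x)| ≤ δ / 5 := by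
    have h1 : ∀ x, max 0 (g x) * (Z / 2 ^ K) / a - max 0 (g x) =
        max 0 (g x) * ((1 - σ) / σ) := by
      intro x
      have : σ ≠ 0 := by linarith
      rw [ha]
      field_simp
    simp only [h1, abs_mul, abs_of_nonneg (le_max_left 0 (g _)), ← Finset.sum_mul]
    rw [← hσ, abs_div, abs_of_pos (by linarith : 0 < σ), mul_div_cancel₀ _ (by linarith : σ ≠ 0),
      abs_sub_comm]
    exact hσ1
  have htri : ∀ x, |C.noisyDist ε x - 𝔼 ω : Fin T → Bits (n + K),
      if rejection c ω = x then (1 : ℝ) else 0| ≤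
      |(𝔼 ω : Fin T → Bits (n + K), if rejection c ω = x then (1 : ℝ) else 0) -
        max 0 (g x) * (Z / 2 ^ K) / a| + |max 0 (g x) * (Z / 2 ^ K) / a - max 0 (g x)| +
      |max 0 (g x) - C.noisyDist ε x| := by
    intro x
    rw [abs_sub_comm]
    exact (abs_sub_le _ (max 0 (g x)) _).trans (add_le_add_left (abs_sub_le _ _ _) _)
  refine (Finset.sum_le_sum fun x _ => htri x).trans ?_
  rw [Finset.sum_add_distrib, Finset.sum_add_distrib]
  have hrej' : ∑ x, |(𝔼 ω : Fin T → Bits (n + K), if rejection c ω = x then (1 : ℝ) else 0) -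
      max 0 (g x) * (Z / 2 ^ K) / a| ≤ 2 * (1 - a) ^ T := hrej
  linarith

/-! ### Accuracy of the estimated coefficients -/

theorem opProd_smul {n : ℕ} (v : ℂ) (A : Fin n → Op n) (s : List (Fin n)) :
    opProd (fun j => v • A j) s = v ^ s.length • opProd A s := by
  induction s with
  | nil => simp [opProd]
  | cons j s ih =>
    rw [opProd, ih, opProd, List.length_cons, Matrix.smul_mul, Matrix.mul_smul, smul_smul, pow_succ']

theorem expVal_smul {n : ℕ} (φ : Bits n → ℂ) (v : ℂ) (B : Op n) :
    expVal φ (v • B) = v * expVal φ B := by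
  simp only [expVal, Finset.mul_sum, Matrix.smul_apply, smul_eq_mul]
  exact Finset.sum_congr rfl fun x _ => Finset.sum_congr rfl fun y _ => by ring

theorem conj_diagonal_walsh {n : ℕ} {V : Op n} (hV : V * Vᴴ = 1) (s : Finset (Fin n)) :
    (Vᴴ * Matrix.diagonal (fun x => ((walsh s x : ℝ) : ℂ)) * V).IsHermitian ∧
      Vᴴ * Matrix.diagonal (fun x => ((walsh s x : ℝ) : ℂ)) * V ∈
        Matrix.unitaryGroup (Bits n) ℂ := by
  set D : Op n := Matrix.diagonal fun x => ((walsh s x : ℝ) : ℂ) with hD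
  have hDH : Dᴴ = D := by
    rw [hD, Matrix.diagonal_conjTranspose]
    congr 1
    ext x
    simp
  have hDD : D * D = 1 := by
    rw [hD, Matrix.diagonal_mul_diagonal, ← Matrix.diagonal_one]
    congr 1
    ext x
    have h1 : walsh s x * walsh s x = 1 := by rw [← abs_mul_abs_self, abs_walsh, one_mul]
    exact_mod_cast h1
  have hH : (Vᴴ * D * V)ᴴ = Vᴴ * D * V := by
    rw [Matrix.conjTranspose_mul, Matrix.conjTranspose_mul, hDH, Matrix.conjTranspose_conjTranspose,
      Matrix.mul_assoc]
  refine ⟨hH, Matrix.mem_unitaryGroup_iff.2 ?_⟩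
  rw [Matrix.star_eq_conjTranspose, hH]
  calc Vᴴ * D * V * (Vᴴ * D * V) = Vᴴ * D * (V * Vᴴ) * D * V := by simp only [Matrix.mul_assoc]
    _ = Vᴴ * (D * D) * V := by rw [hV, Matrix.mul_one, Matrix.mul_assoc Vᴴ]
    _ = 1 := by rw [hDD, Matrix.mul_one]; exact mul_eq_one_comm.1 hV

/-- With probability at least `1 - e⁻ⁿ`, all estimates computed from random coins approximate the
damped Walsh coefficients of the output distribution. The matrices handed to the estimator are
the `V† Z_j V` multiplied by the damping factor `u / 2 ^ w`. -/
theorem expect_coeffs_not_accurate_le {n S M L T R l u w : ℕ} {U V : Circuit n} {A : Fin n → Op n}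
    (hAdef : ∀ j, A j = V.matrixᴴ * onQubit j pauliZ * V.matrix)
    (hAu : ∀ j, A j ∈ Matrix.unitaryGroup (Bits n) ℂ)
    (hS : ∀ j x, (nonzeroRows (A j) x).length ≤ S) {a : Fin n → Fin S → Bits n → GaussianInt}
    (ha : ∀ j r y, ‖(a j r y).toComplex / 2 ^ M - entryVal (A j) r y‖ ≤ (1 / 2) ^ M)
    {amp : Bits n → GaussianInt}
    (hamp : ∀ x, ‖(amp x).toComplex / 2 ^ M - U.state x‖ ≤ (1 / 2) ^ M) {sam : Bits L → Bits n}
    (hsam : ∑ x, |‖U.state x‖ ^ 2 - 𝔼 ω, if sam ω = x then (1 : ℝ) else 0| ≤ (1 / 2) ^ M)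
    (hu : u ≤ 2 ^ w) {τ : ℝ} (hτ0 : 0 < τ) (hτ1 : τ ≤ 1) (hT0 : 0 < T)
    (hτ : 9 * 4 ^ n * (2 * S + 2) ^ l * (1 / 2) ^ M ≤ τ / 2)
    (hT : (n + 2 * (n + 1) ^ l) * (576 * ((2 * S + 2) ^ l) ^ 2) ≤ T * τ ^ 2) (hR : T * L ≤ R) :
    (𝔼 r : Bits R, if ∀ s ∈ subs l n le_rfl,
      |((sampleSum (fun j k y => entryRow (A j) k y) (fun j k y => (u : GaussianInt) * a j k y) amp
        (2 ^ M) (M + w) sam (splitCoins hR r) s : ℤ) : ℝ) / ((T * 2 ^ M : ℕ) : ℝ) -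
          ((u : ℝ) / 2 ^ w) ^ s.toFinset.card *
            walshCoeff (Circuit.outputDist (U ++ V)) s.toFinset| ≤ τ then (0 : ℝ) else 1) ≤
      Real.exp (-n) := by
  set v : ℝ := (u : ℝ) / 2 ^ w with hv
  have hv0 : 0 ≤ v := by positivity
  have hv1 : v ≤ 1 := by
    rw [hv, div_le_one (by positivity)]
    exact_mod_cast hu
  have hvn : ‖(v : ℂ)‖ ≤ 1 := by rwa [Complex.norm_real, Real.norm_eq_abs, abs_of_nonneg hv0]
  have hVV := Circuit.matrix_unitary V
  have hprod : ∀ s ∈ subs l n le_rfl, opProd (fun j => (v : ℂ) • A j) s = ((v ^ s.length : ℝ) : ℂ) •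
      (V.matrixᴴ * Matrix.diagonal (fun x => ((walsh s.toFinset x : ℝ) : ℂ)) * V.matrix) := by
    intro s hs
    rw [opProd_smul, ← opProd_conj hVV (subs_pairwise hs).1, ← funext hAdef, Complex.ofReal_pow]
  have hφ : ∀ x, ‖U.state x‖ ≤ 1 := by
    intro x
    have h1 := U.sum_norm_sq_state
    have h2 := Finset.single_le_sum (f := fun x => ‖U.state x‖ ^ 2)
      (fun x _ => sq_nonneg _) (Finset.mem_univ x)
    rw [h1] at h2
    exact (sq_le_one_iff₀ (norm_nonneg _)).1 h2
  have key := expect_not_accurate_le (row := fun j k y => entryRow (A j) k y)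
    (val := fun j k y => (u : GaussianInt) * a j k y)
    (val' := fun j k y => (v : ℂ) * entryVal (A j) k y) (A := fun j => (v : ℂ) • A j)
    (amp := amp) (M := M) (h := M + w) (φ := U.state) (sam := sam) (l := l) (τ := τ) (T := T)
    (fun j r y => by
      rw [norm_mul]
      refine mul_le_one₀ hvn (norm_nonneg _) ?_
      unfold entryVal
      split
      · exact entry_norm_bound_of_unitary (hAu j) _ _
      · simp)
    (fun j r y => by
      have h1 : ((u : GaussianInt) * a j r y).toComplex / 2 ^ (M + w) -
          (v : ℂ) * entryVal (A j) r y =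
            (v : ℂ) * ((a j r y).toComplex / 2 ^ M - entryVal (A j) r y) := by
        rw [GaussianInt.toComplex_mul, map_natCast, hv, pow_add]
        push_cast
        field_simp
      rw [h1, norm_mul]
      calc _ ≤ 1 * (1 / 2 : ℝ) ^ M := mul_le_mul hvn (ha j r y) (norm_nonneg _) zero_le_one
        _ = _ := one_mul _)
    (fun j x f => by
      simp only [mul_assoc, ← Finset.mul_sum, Matrix.smul_apply, smul_eq_mul]
      rw [sum_entryVal _ _ (hS j x)])
    hφ hamp hsam
    (fun s hs => by
      rw [hprod s hs]
      obtain ⟨h1, h2⟩ := conj_diagonal_walsh hVV s.toFinset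
      refine ⟨?_, fun x y => ?_⟩
      · rw [Matrix.IsHermitian, Matrix.conjTranspose_smul, h1.eq]
        simp
      · rw [Matrix.smul_apply, smul_eq_mul, norm_mul, Complex.norm_real, Real.norm_eq_abs,
          abs_of_nonneg (pow_nonneg hv0 _)]
        exact mul_le_one₀ (pow_le_one₀ hv0 hv1) (norm_nonneg _)
          (entry_norm_bound_of_unitary h2 _ _))
    hτ0 hτ1 hT0 hτ hT
  rw [← expect_splitCoins hR] at key
  refine le_trans (le_of_eq ?_) key
  refine Finset.expect_congr rfl fun r _ => ?_
  refine if_congr (forall₂_congr fun s hs => ?_) rfl rfl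
  rw [hprod s hs, expVal_smul, ← walshCoeff_outputDist, ← Complex.ofReal_mul, Complex.ofReal_re,
    List.toFinset_card_of_nodup (subs_pairwise hs).1]
  push_cast
  rfl

/-! ### Choice of the parameters -/

/-- A dyadic damping factor `u / 2 ^ w` close to `1 - t`, and a cutoff `l` for the weights. -/
theorem exists_damping {t B : ℝ} (ht0 : 0 < t) (ht1 : t < 1) (hB : 0 < B) :
    ∃ l u w : ℕ, u ≤ 2 ^ w ∧ (l : ℝ) * |(u : ℝ) / 2 ^ w - (1 - t)| ≤ 1 / (2 * B) ∧
      (1 - t) ^ (l + 1) ≤ 1 / B := by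
  obtain ⟨l, hl⟩ := exists_pow_lt_of_lt_one (by positivity : 0 < 1 / B) (by linarith : 1 - t < 1)
  obtain ⟨w, hw⟩ := exists_nat_gt (l * (2 * B))
  have h2w : (0 : ℝ) < 2 ^ w := by positivity
  have hw2 : (w : ℝ) ≤ 2 ^ w := by exact_mod_cast Nat.lt_two_pow_self.le
  have hx0 : 0 ≤ (1 - t) * 2 ^ w := mul_nonneg (by linarith) h2w.le
  have e1 := Nat.floor_le hx0
  have e2 := Nat.lt_floor_add_one ((1 - t) * 2 ^ w)
  refine ⟨l, ⌊(1 - t) * 2 ^ w⌋₊, w, ?_, ?_, ?_⟩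
  · have : ((⌊(1 - t) * 2 ^ w⌋₊ : ℕ) : ℝ) ≤ 2 ^ w := by nlinarith
    exact_mod_cast this
  · have h1 : |((⌊(1 - t) * 2 ^ w⌋₊ : ℕ) : ℝ) / 2 ^ w - (1 - t)| ≤ 1 / 2 ^ w := by
      rw [show ((⌊(1 - t) * 2 ^ w⌋₊ : ℕ) : ℝ) / 2 ^ w - (1 - t) =
        (((⌊(1 - t) * 2 ^ w⌋₊ : ℕ) : ℝ) - (1 - t) * 2 ^ w) / 2 ^ w by field_simp, abs_div,
        abs_of_pos h2w]
      gcongr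
      rw [abs_le]
      constructor <;> linarith
    calc (l : ℝ) * |((⌊(1 - t) * 2 ^ w⌋₊ : ℕ) : ℝ) / 2 ^ w - (1 - t)| ≤ l * (1 / 2 ^ w) := by gcongr
      _ ≤ 1 / (2 * B) := by
          rw [mul_one_div, div_le_div_iff₀ h2w (by positivity), one_mul]
          linarith
  · rw [pow_succ]
    calc (1 - t) ^ l * (1 - t) ≤ (1 - t) ^ l * 1 :=
          mul_le_mul_of_nonneg_left (by linarith) (pow_nonneg (by linarith) _)
      _ ≤ 1 / B := by rw [mul_one]; exact hl.le

/-- A random number of `N.size` bits can be compared with all thresholds up to `N`, and this makes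
acceptance at most twice less likely than a random number below `N` would. -/
theorem two_pow_size_bounds {N : ℕ} (hN : 0 < N) : N ≤ 2 ^ N.size ∧ 2 ^ N.size ≤ 2 * N := by
  refine ⟨N.lt_size_self.le, ?_⟩
  have h1 : 0 < N.size := Nat.size_pos.2 hN
  have h2 : 2 ^ (N.size - 1) ≤ N := Nat.lt_size.1 (by omega)
  calc 2 ^ N.size = 2 * 2 ^ (N.size - 1) := by rw [← pow_succ']; congr 1; omega
    _ ≤ 2 * N := Nat.mul_le_mul_left 2 h2

namespace PolyTimeComputable

/-- Approximations with polynomially many bits, as Gaussian integers. -/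
theorem approximation {ι : Type} {inp : ι → Data} {a b : ι → ℕ → ℤ} {M : ι → ℕ}
    (h : PolyTimeComputable (fun p : ι × ℕ => .cons (inp p.1) (unary p.2))
      (fun p => .cons (encInt (a p.1 p.2)) (encInt (b p.1 p.2))))
    (hM : PolyTimeComputable inp (fun i => unary (M i))) :
    PolyTimeComputable inp (fun i => encGauss ⟨a i (M i), b i (M i)⟩) :=
  ((refl inp).pair hM).trans (h.reindex fun i => (i, M i))

end PolyTimeComputable

theorem toComplex_mk (a b : ℤ) :
    GaussianInt.toComplex ⟨a, b⟩ = (a : ℂ) + (b : ℂ) * Complex.I := rfl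

/-! ### The algorithm -/

/-- Rejection sampling with polynomially many trials is a polynomial-time sampler. -/
theorem exists_samplable_rejection {ι : Type} {inp : ι → Data} {n K T : ι → ℕ}
    {c : (i : ι) → List (List (Fin (n i)) × ℤ)}
    (hn : PolyTimeComputable inp (fun i => unary (n i)))
    (hK : PolyTimeComputable inp (fun i => unary (K i)))
    (hT : PolyTimeComputable inp (fun i => unary (T i)))
    (hc : PolyTimeComputable inp (fun i => encCoeffs (c i))) :
    ∃ q : (i : ι) → PMF (Bits (n i)), PolyTimeSamplable inp q ∧
      ∀ i x, (q i x).toReal = 𝔼 ω : Fin (T i) → Bits (n i + K i),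
        if rejection (c i) ω = x then (1 : ℝ) else 0 := by
  obtain ⟨Pn, hPn⟩ := hn.size_le
  obtain ⟨PK, hPK⟩ := hK.size_le
  obtain ⟨PT, hPT⟩ := hT.size_le
  simp only [unary_size] at hPn hPK hPT
  have hR : ∀ i, T i * (n i + K i) ≤ (PT * (Pn + PK)).eval (inp i).size := by
    intro i
    rw [Polynomial.eval_mul, Polynomial.eval_add]
    exact Nat.mul_le_mul (by linarith [hPT i]) (by linarith [hPn i, hPK i])
  refine ⟨fun i => (coins _).map fun r => rejection (c i) (splitCoins (hR i) r),
    ⟨PT * (Pn + PK), fun i r => rejection (c i) (splitCoins (hR i) r), ?_, fun i => rfl⟩, ?_⟩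
  · let ctx : ((i : ι) × Bits ((PT * (Pn + PK)).eval (inp i).size)) → Data :=
      fun p => .cons (inp p.1) (encBits p.2)
    have hn2 : PolyTimeComputable ctx (fun p => unary (n p.1)) := hn.weak
    have hK2 : PolyTimeComputable ctx (fun p => unary (K p.1)) := hK.weak
    have hT2 : PolyTimeComputable ctx (fun p => unary (T p.1)) := hT.weak
    have hc2 : PolyTimeComputable ctx (fun p => encCoeffs (c p.1)) := hc.weak
    have hr : PolyTimeComputable ctx (fun p => encBits p.2) := (PolyTimeComputable.refl ctx).tail
    have ht : PolyTimeComputable (fun p : (p : (i : ι) × Bits ((PT * (Pn + PK)).eval (inp i).size)) ×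
        Fin (T p.1) => .cons (ctx p.1) (unary (p.2 : ℕ))) (fun p => unary (p.2 : ℕ)) :=
      PolyTimeComputable.var _ _
    exact PolyTimeComputable.rejection hn2 hK2 hT2 hc2
      (PolyTimeComputable.splitCoins (h := fun p : (p : (i : ι) ×
        Bits ((PT * (Pn + PK)).eval (inp i).size)) × Fin (T p.1) => hR p.1.1)
        (hn2.unary_add hK2).weak hr.weak ht)
  · intro i x
    rw [coins_map_apply, expect_splitCoins (hR i) fun ω => if rejection (c i) ω = x then (1 : ℝ) else 0]

/-- The algorithm for a noise rate in the range covered by its guess `t`. -/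
theorem exists_algorithm {α δ t B : ℝ} (hα : 1 ≤ α) (hδ0 : 0 < δ) (hδ1 : δ < 1)
    (hB : B = 10 * √α / δ) (C U V : (n : ℕ+) → Circuit n) (hC : ∀ n, C n = U n ++ V n)
    (hCT : IsCT fun n => (U n).state)
    (hECS : IsECS fun n j => (V n).matrix.conjTranspose * onQubit j pauliZ * (V n).matrix)
    (hanti : ∀ n : ℕ+, ∑ x, (C n).outputDist x ^ 2 ≤ α / 2 ^ (n : ℕ)) (ht0 : 0 < t) (ht1 : t < 1) :
    ∃ (R : Polynomial ℕ)
      (desc : (i : (n : ℕ+) × Bits (R.eval (n : ℕ))) → Data)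
      (q : (i : (n : ℕ+) × Bits (R.eval (n : ℕ))) → PMF (Bits i.1)),
      PolyTimeComputable (fun i => .cons (unary i.1) (encBits i.2)) desc ∧
      PolyTimeSamplable (fun i => .cons (unary i.1) (desc i)) q ∧
      ∀ ε : ℝ, t ≤ ε → ε < 1 → ε - t ≤ t / B → ∀ n : ℕ+,
        1 - 1 / Real.exp (n : ℕ) ≤
          ((coins (R.eval (n : ℕ))).toOuterMeasure
            {r | l1Dist ((C n).noisyDist ε) (q ⟨n, r⟩) ≤ δ}).toReal := by
  classical
  have hα' : 0 < √α := Real.sqrt_pos.2 (by linarith)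
  have hB0 : 0 < B := by rw [hB]; positivity
  obtain ⟨l, u, w, hu, hlv, hlB⟩ := exists_damping ht0 ht1 hB0
  obtain ⟨⟨q0, ⟨L0, sam0, hsam0, hq0⟩, hq0d⟩, a1, b1, hab1, hamp1⟩ := hCT
  obtain ⟨hA, s, hs, hrow, a2, b2, hab2, hval2⟩ := hECS
  -- each of the at most `(n + 1)^l` coefficients is estimated with accuracy `1 / (c0 (n + 1)^l)`
  obtain ⟨c0, hc0⟩ := exists_nat_gt (20 / δ)
  have hc0' : (20 : ℝ) < c0 * δ := (div_lt_iff₀ hδ0).1 hc0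
  have hc01 : (20 : ℝ) < c0 := by nlinarith
  set v : ℝ := (u : ℝ) / 2 ^ w with hv
  have hv0 : 0 ≤ v := by positivity
  have hv1 : v ≤ 1 := by
    rw [hv, div_le_one (by positivity)]
    exact_mod_cast hu
  -- the parameters, as polynomials in the number of qubits
  let X : Polynomial ℕ := Polynomial.X
  let Np : Polynomial ℕ := (X + 1) ^ l
  let Wp : Polynomial ℕ := (2 * s + 2) ^ l
  let Mp : Polynomial ℕ := 2 * X + 18 * (Polynomial.C c0 * Np * Wp)
  let Tp : Polynomial ℕ := 576 * Wp ^ 2 * (Polynomial.C c0 * Np) ^ 2 * (X + 2 * Np)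
  let Lp : Polynomial ℕ := L0.comp (2 * X + 1 + (2 * Mp + 1) + 1)
  let M : ℕ+ → ℕ := fun n => Mp.eval (n : ℕ)
  let T : ℕ+ → ℕ := fun n => Tp.eval (n : ℕ)
  let S : ℕ+ → ℕ := fun n => s.eval (n : ℕ)
  let L : ℕ+ → ℕ := fun n => L0.eval (Data.cons (unary n) (unary (M n))).size
  let R : Polynomial ℕ := Tp * Lp
  have hNe : ∀ n : ℕ, Np.eval n = (n + 1) ^ l := fun n => by simp [Np, X]
  have hWe : ∀ n : ℕ, Wp.eval n = (2 * s.eval n + 2) ^ l := fun n => by simp [Wp]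
  have hMe : ∀ n : ℕ+, M n = 2 * n + 18 * (c0 * (n + 1) ^ l * (2 * S n + 2) ^ l) := fun n => by
    simp [M, Mp, hNe, hWe, X, S]
  have hTe : ∀ n : ℕ+, T n = 576 * ((2 * S n + 2) ^ l) ^ 2 * (c0 * (n + 1) ^ l) ^ 2 *
      (n + 2 * (n + 1) ^ l) := fun n => by
    simp [T, Tp, hNe, hWe, X, S]
  have hLe : ∀ n : ℕ+, L n = Lp.eval (n : ℕ) := fun n => by
    simp [L, Lp, M, X, Data.size, unary_size]
  have hR : ∀ n : ℕ+, T n * L n ≤ R.eval (n : ℕ) := fun n => by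
    rw [hLe, Polynomial.eval_mul]
  -- the programs
  have hn : PolyTimeComputable (fun n : ℕ+ => unary n) (fun n : ℕ+ => unary n) :=
    PolyTimeComputable.refl _
  have hpM : PolyTimeComputable (fun n : ℕ+ => unary n) (fun n => unary (M n)) := hn.unary_eval Mp
  have hpT : PolyTimeComputable (fun n : ℕ+ => unary n) (fun n => unary (T n)) := hn.unary_eval Tp
  have hpS : PolyTimeComputable (fun n : ℕ+ => unary n) (fun n => unary (S n)) := hn.unary_eval s
  have hpL : PolyTimeComputable (fun n : ℕ+ => unary n) (fun n => unary (L n)) := by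
    simp only [hLe]
    exact hn.unary_eval Lp
  let A : (n : ℕ+) → Fin n → Op n :=
    fun n j => (V n).matrix.conjTranspose * onQubit j pauliZ * (V n).matrix
  let row : (n : ℕ+) → Fin n → Fin (S n) → Bits n → Bits n := fun n j k y => entryRow (A n j) k y
  let ent : (n : ℕ+) → Fin n → Fin (S n) → Bits n → GaussianInt :=
    fun n j k y => ⟨a2 ⟨n, j, k, y⟩ (M n), b2 ⟨n, j, k, y⟩ (M n)⟩
  let val : (n : ℕ+) → Fin n → Fin (S n) → Bits n → GaussianInt :=
    fun n j k y => (u : GaussianInt) * ent n j k y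
  let amp : (n : ℕ+) → Bits n → GaussianInt := fun n y => ⟨a1 ⟨n, y⟩ (M n), b1 ⟨n, y⟩ (M n)⟩
  let sam : (n : ℕ+) → Bits (L n) → Bits n := fun n y => sam0 (n, M n) y
  have hpval : PolyTimeComputable
      (fun i : (n : ℕ+) × Fin n × Fin (S n) × Bits n =>
        encList [unary i.1, unary i.2.1, unary i.2.2.1, encBits i.2.2.2])
      (fun i => encGauss (val i.1 i.2.1 i.2.2.1 i.2.2.2)) := by
    refine PolyTimeComputable.gauss_mul (PolyTimeComputable.const _ _)
      (PolyTimeComputable.approximation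
        (M := fun i : (n : ℕ+) × Fin n × Fin (S n) × Bits n => M i.1) hab2 ?_)
    exact (PolyTimeComputable.refl _).head.trans (hpM.reindex _)
  have hpamp : PolyTimeComputable
      (fun i : (n : ℕ+) × Bits n => .cons (unary i.1) (encBits i.2))
      (fun i => encGauss (amp i.1 i.2)) := by
    refine PolyTimeComputable.approximation (M := fun i : (n : ℕ+) × Bits n => M i.1) hab1 ?_
    exact (PolyTimeComputable.refl _).head.trans (hpM.reindex _)
  have hpsam : PolyTimeComputable
      (fun i : (n : ℕ+) × Bits (L n) => .cons (unary i.1) (encBits i.2))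
      (fun i => encBits (sam i.1 i.2)) := by
    have h1 := PolyTimeComputable.refl
      (fun i : (n : ℕ+) × Bits (L n) => Data.cons (unary i.1) (encBits i.2))
    exact ((h1.head.pair (h1.head.trans (hpM.reindex _))).pair h1.tail).trans
      (hsam0.reindex fun i : (n : ℕ+) × Bits (L n) => ⟨(i.1, M i.1), i.2⟩)
  have hdesc := PolyTimeComputable.coeffs (row := row) (R := fun n => R.eval (n : ℕ))
    (h := fun n => M n + w) l hR hpS hpL hpT
    hpM.nat_two_pow (hpM.unary_add (PolyTimeComputable.const _ (unary w))) hrow hpval hpamp hpsam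
  let E : (i : (n : ℕ+) × Bits (R.eval (n : ℕ))) → List (Fin i.1) → ℤ := fun i s =>
    sampleSum (row i.1) (val i.1) (amp i.1) (2 ^ M i.1) (M i.1 + w) (sam i.1)
      (splitCoins (hR i.1) i.2) s
  let c : (i : (n : ℕ+) × Bits (R.eval (n : ℕ))) → List (List (Fin i.1) × ℤ) := fun i =>
    (subs l (i.1 : ℕ) le_rfl).map fun s => (s, E i s)
  let N : ℕ+ → ℕ := fun n => T n * 2 ^ M n * (((n : ℕ) + 1) ^ l + 1)
  let inp : ((n : ℕ+) × Bits (R.eval (n : ℕ))) → Data :=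
    fun i => .cons (unary i.1) (encCoeffs (c i))
  have hin : PolyTimeComputable inp (fun i => unary i.1) := (PolyTimeComputable.refl inp).head
  have hpN1 : PolyTimeComputable (fun n : ℕ+ => unary n)
      (fun n : ℕ+ => unary (((n : ℕ) + 1) ^ l + 1)) := by
    simpa only [Polynomial.eval_add, hNe, Polynomial.eval_one] using hn.unary_eval (Np + 1)
  have hpK : PolyTimeComputable (fun n : ℕ+ => unary n) (fun n => unary (N n).size) :=
    ((hpT.nat_of_unary.mul hpM.nat_two_pow).mul hpN1.nat_of_unary).unary_size
  have hpT2 : PolyTimeComputable (fun n : ℕ+ => unary n)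
      (fun n : ℕ+ => unary (c0 * (((n : ℕ) + 1) ^ l + 1))) :=
    (PolyTimeComputable.const _ (unary c0)).unary_mul hpN1
  obtain ⟨q, hqsam, hq⟩ := exists_samplable_rejection (inp := inp) (n := fun i => (i.1 : ℕ))
    (K := fun i => (N i.1).size) (T := fun i => c0 * (((i.1 : ℕ) + 1) ^ l + 1)) (c := c)
    hin (hin.trans (hpK.reindex _)) (hin.trans (hpT2.reindex _)) (PolyTimeComputable.refl inp).tail
  refine ⟨R, fun i => encCoeffs (c i), q, hdesc, hqsam, fun ε hε hε1 hεt n => ?_⟩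
  -- accuracy
  have hNpos : (1 : ℝ) ≤ ((n : ℕ) + 1 : ℝ) ^ l :=
    one_le_pow₀ (by linarith [((n : ℕ).cast_nonneg : (0 : ℝ) ≤ (n : ℕ))])
  have hcN : (1 : ℝ) ≤ c0 * ((n : ℕ) + 1 : ℝ) ^ l := by nlinarith
  have hT0 : 0 < T n := by
    have h1 : 0 < c0 := by
      have : (0 : ℝ) < c0 := by linarith
      exact_mod_cast this
    have := n.pos
    rw [hTe]
    positivity
  set τ : ℝ := 1 / (c0 * ((n : ℕ) + 1 : ℝ) ^ l) with hτ
  have hτ0 : 0 < τ := by positivity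
  have hτ1 : τ ≤ 1 := by rw [hτ, div_le_one (by positivity)]; exact hcN
  have hNτ : ((n : ℕ) + 1 : ℝ) ^ l * τ ≤ δ / 20 := by
    rw [hτ, mul_one_div, mul_comm (c0 : ℝ), ← div_div, div_self (by positivity),
      div_le_div_iff₀ (by linarith) (by norm_num)]
    linarith
  have hκ : 3 / (2 * B) * √α = 3 * δ / 20 := by
    rw [hB]
    field_simp
    norm_num
  have hgood : ∀ r : Bits (R.eval (n : ℕ)), (∀ s ∈ subs l (n : ℕ) le_rfl,
      |(E ⟨n, r⟩ s : ℝ) / ((T n * 2 ^ M n : ℕ) : ℝ) - v ^ s.toFinset.card *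
        walshCoeff (C n).outputDist s.toFinset| ≤ τ) →
      l1Dist ((C n).noisyDist ε) (q ⟨n, r⟩) ≤ δ := by
    intro r hr
    simp only [l1Dist, hq]
    obtain ⟨hK1, hK2⟩ := two_pow_size_bounds (N := N n) (by positivity)
    refine sum_abs_noisyDist_sub_rejection_le (C n) (Z := T n * 2 ^ M n) (by linarith) hε1.le hδ0
      hδ1.le (κ := 3 / (2 * B)) (by positivity) (hanti n)
      (abs_truncated_pow_sub_le hB0 ht0 hε hε1.le hεt hv0 hv1 hlv hlB) hv0 hv1 hτ0.le ?_ hr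
      (by positivity) hK1 hK2 ?_
    · rw [hκ]; linarith
    · push_cast
      nlinarith
  have hbad := expect_coeffs_not_accurate_le (U := U n) (V := V n) (A := A n) (a := ent n)
    (amp := amp n) (sam := sam n) (R := R.eval (n : ℕ)) (T := T n) (M := M n) (l := l)
    (fun j => rfl) (fun j => (hA n j).1) (fun j x => hs n j x)
    (fun j r y => by
      rw [toComplex_mk]
      exact hval2 ⟨n, j, r, y⟩ (M n))
    (fun x => by
      rw [toComplex_mk]
      exact hamp1 ⟨n, x⟩ (M n))
    (by
      have h1 := hq0d (n, M n)
      simp only [l1Dist, hq0, coins_map_apply] at h1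
      exact h1)
    hu hτ0 hτ1 hT0
    (by
      set Y : ℝ := (c0 : ℝ) * ((n : ℕ) + 1 : ℝ) ^ l * (2 * (S n : ℕ) + 2 : ℝ) ^ l with hY
      have h1 : 18 * Y ≤ 2 ^ (18 * (c0 * ((n : ℕ) + 1) ^ l * (2 * S n + 2) ^ l)) := by
        have h2 := (Nat.lt_two_pow_self
          (n := 18 * (c0 * ((n : ℕ) + 1) ^ l * (2 * S n + 2) ^ l))).le
        rw [hY]
        exact_mod_cast h2
      have h3 : (2 : ℝ) ^ M n =
          4 ^ (n : ℕ) * 2 ^ (18 * (c0 * ((n : ℕ) + 1) ^ l * (2 * S n + 2) ^ l)) := by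
        rw [hMe, pow_add, pow_mul]
        norm_num
      rw [one_div, inv_pow, hτ, div_div, ← div_eq_mul_inv, div_le_div_iff₀ (by positivity)
        (by positivity), h3]
      calc 9 * 4 ^ (n : ℕ) * (2 * (S n : ℕ) + 2 : ℝ) ^ l * (c0 * ((n : ℕ) + 1 : ℝ) ^ l * 2)
          = 4 ^ (n : ℕ) * (18 * Y) := by rw [hY]; ring
        _ ≤ 4 ^ (n : ℕ) * 2 ^ (18 * (c0 * ((n : ℕ) + 1) ^ l * (2 * S n + 2) ^ l)) := by gcongr
        _ = _ := (one_mul _).symm)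
    (by
      rw [hTe, hτ]
      push_cast
      rw [div_pow, one_pow, mul_one_div, le_div_iff₀ (by positivity)]
      exact le_of_eq (by ring))
    (hR n)
  rw [coins_toOuterMeasure, one_div, ← Real.exp_neg, sub_le_iff_le_add]
  refine le_trans ?_ (add_le_add_right hbad _)
  rw [← Finset.expect_add_distrib]
  refine le_trans (le_of_eq ?_) (Finset.expect_le_expect (f := fun _ => (1 : ℝ)) fun r _ => ?_)
  · simp
  · split
    · split <;> norm_num
    · rename_i h
      rw [if_neg]
      · simp
      · intro h'
        rw [← hC] at h'
        exact h (hgood r h')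

end CTECS

theorem theorem1 (α : ℝ) (hα : 1 ≤ α) (δ : ℝ) (hδ0 : 0 < δ) (hδ1 : δ < 1)
    (C : (n : ℕ+) → Circuit n) (hunif : IsUniform C) (hC : IsCTECS C)
    (hanti : ∀ n : ℕ+, ∑ x, (C n).outputDist x ^ 2 ≤ α / 2 ^ (n : ℕ))
    (lam : ℝ) :
    -- the algorithm (number of coin tosses `R`, output `desc`) and its output distribution `q`
    -- are chosen before `ε`: they know `α`, `δ`, `lam` and the circuits, not the noise rate
    ∃ (R : Polynomial ℕ)
      (desc : (i : (n : ℕ+) × Bits (R.eval (n : ℕ))) → Data)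
      (q : (i : (n : ℕ+) × Bits (R.eval (n : ℕ))) → PMF (Bits i.1)),
      PolyTimeComputable (fun i => .cons (unary i.1) (encBits i.2)) desc ∧
      PolyTimeSamplable (fun i => .cons (unary i.1) (desc i)) q ∧
      ∀ ε : ℝ, 0 < ε → ε < 1 →
        1 ≤ ε / lam →
        ε / lam ≤
          1 + 1 / ((10 * Real.sqrt α / δ) * Real.logb 2 (10 * Real.sqrt α / δ)) →
        ∀ n : ℕ+,
          1 - 1 / Real.exp (n : ℕ) ≤
            ((coins (R.eval (n : ℕ))).toOuterMeasure
              {r | l1Dist ((C n).noisyDist ε) (q ⟨n, r⟩) ≤ δ}).toReal := by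
  obtain ⟨U, V, hUV, -, -, hCT, hECS⟩ := hC
  have hlam : ∀ ε : ℝ, 0 < ε → 1 ≤ ε / lam → 0 < lam ∧ lam ≤ ε := by
    intro ε hε h
    have h0 : 0 < lam := by
      by_contra hneg
      have := div_nonpos_of_nonneg_of_nonpos hε.le (not_lt.1 hneg)
      linarith
    exact ⟨h0, (one_le_div h0).1 h⟩
  by_cases h : 0 < lam ∧ lam < 1
  · obtain ⟨R, desc, q, hdesc, hq, hprob⟩ := exists_algorithm hα hδ0 hδ1 rfl C U V hUV hCT hECS
      hanti h.1 h.2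
    refine ⟨R, desc, q, hdesc, hq, fun ε hε0 hε1 h1 h2 n => ?_⟩
    refine hprob ε (hlam ε hε0 h1).2 hε1 ?_ n
    set B : ℝ := 10 * Real.sqrt α / δ with hB
    have hB10 : 10 ≤ B := by
      have hs : 1 ≤ Real.sqrt α := Real.one_le_sqrt.2 hα
      rw [hB, le_div_iff₀ hδ0]
      nlinarith
    have hlog : 1 ≤ Real.logb 2 B := by
      rw [Real.le_logb_iff_rpow_le (by norm_num) (by linarith), Real.rpow_one]
      linarith
    have h3 : 1 / (B * Real.logb 2 B) ≤ 1 / B :=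
      one_div_le_one_div_of_le (by linarith) (by nlinarith)
    have h4 : ε / lam ≤ 1 + 1 / B := by linarith
    rw [div_le_iff₀ h.1] at h4
    have h5 : (1 + 1 / B) * lam = lam + lam / B := by ring
    linarith
  · -- no noise rate satisfies the hypotheses, so the algorithm for another guess serves
    obtain ⟨R, desc, q, hdesc, hq, -⟩ := exists_algorithm hα hδ0 hδ1 rfl C U V hUV hCT hECS
      hanti (t := 1 / 2) (by norm_num) (by norm_num)
    refine ⟨R, desc, q, hdesc, hq, fun ε hε0 hε1 h1 _ n => ?_⟩
    obtain ⟨h2, h3⟩ := hlam ε hε0 h1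
    exact absurd ⟨h2, h3.trans_lt hε1⟩ h
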